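/- Let $\alpha_+,\alpha_-\ge 0$ and $\nu_+,\nu_->0$. Let $\chi_0,\chi_1,\dots$ be the normalized Hermite functions on $\mathbb R$ (with $\sqrt{n+1}\,\chi_{n+1}(q)-\sqrt2\,q\,\chi_n(q)+\sqrt n\,\chi_{n-1}(q)=0$), and for $U\in L^2(\mathbb R^3)$ write $U(x,q_+,q_-)=\sum_{m,n\ge 0}u_{m,n}(x)\chi_m(q_+)\chi_n(q_-)$, in short $U\sim\{u_{m,n}\}$. Put $$r_{m,n}=\nu_+^2(m+\tfrac12)+\nu_-^2(n+\tfrac12),\qquad L_{m,n}u=-u''+r_{m,n}u \quad (m,n\in\mathbb N_0),$$ where $L_{m,n}$ is applied piecewise, on each of the intervals listed below, and let $[u'](o)=u'(o+)-u'(o-)$ denote the jump of the derivative at $o$. Consider the matching conditions $$(\mathrm M_+)\quad [u_{m,n}'](1)=\tfrac{\alpha_+}{\sqrt2}\bigl(\sqrt{m+1}\,u_{m+1,n}(1)+\sqrt m\,u_{m-1,n}(1)\bigr)\quad\text{for all } m,n,$$ $$(\mathrm M_-)\quad [u_{m,n}'](-1)=\tfrac{\alpha_-}{\sqrt2}\bigl(\sqrt{n+1}\,u_{m,n+1}(-1)+\sqrt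 n\,u_{m,n-1}(-1)\bigr)\quad\text{for all } m,n.$$ The operator $\mathbf A_\alpha$ in $L^2(\mathbb R^3)$ has as its domain the set of all $U\sim\{u_{m,n}\}$ such that $u_{m,n}\in H^1(\mathbb R)$ for all $m,n$, the restrictions of $u_{m,n}$ to $(-\infty,-1)$, $(-1,1)$ and $(1,\infty)$ lie in $H^2$, $\sum_{m,n}\int_{\mathbb R}|L_{m,n}u_{m,n}|^2dx<\infty$, and $(\mathrm M_+)$ and $(\mathrm M_-)$ hold; it acts by $\mathbf A_\alpha U\sim\{L_{m,n}u_{m,n}\}$. (It is the realization of $-\partial_x^2+\frac{\nu_+^2}2(-\partial_{q_+}^2+q_+^2)+\frac{\nu_-^2}2(-\partial_{q_-}^2+q_-^2)$ with the conditions $[U'_x](\pm1,q_+,q_-)=\alpha_\pm q_\pm U(\pm1,q_+,q_-)$.) The operator $\mathbf A^+$ in $L^2(\mathbb R_+\times\mathbb R^2)$ has as its domain the set of all $U\sim\{u_{m,n}\}$ such that $u_{m,n}\in H^1(\mathbb R_+)$ and $u_{m,n}(0)=0$ for all $m,n$, the restrictions of $u_{m,n}$ to $(0,1)$ and $(1,\infty)$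 lie in $H^2$, $\sum_{m,n}\int_{\mathbb R_+}|L_{m,n}u_{m,n}|^2dx<\infty$, and $(\mathrm M_+)$ holds; it acts by $\mathbf A^+U\sim\{L_{m,n}u_{m,n}\}$. The operator $\mathbf A^-$ in $L^2(\mathbb R_-\times\mathbb R^2)$ is defined in the same way, with $\mathbb R_-$, the intervals $(-\infty,-1)$, $(-1,0)$ and the condition $(\mathrm M_-)$. Let $\mathbf A^\circ_\alpha=\mathbf A^+\oplus\mathbf A^-$, an operator in $L^2(\mathbb R^3)=L^2(\mathbb R_+\times\mathbb R^2)\oplus L^2(\mathbb R_-\times\mathbb R^2)$. Then for every non-real $\Lambda\in\mathbb C$ the bounded inverses $(\mathbf A^\circ_\alpha-\Lambda)^{-1}$ and $(\mathbf A_\alpha-\Lambda)^{-1}$ exist, and $$(\mathbf A^\circ_\alpha-\Lambda)^{-3}-(\mathbf A_\alpha-\Lambda)^{-3}$$ is a trace class operator in $L^2(\mathbb R^3)$. -/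

import Mathlib

open MeasureTheory Filter Topology Set
open scoped ENNReal

noncomputable section

namespace Smilansky

/-! ### Hilbert space notions: resolvents and the trace class -/

/-- `IsResolventAt A Λ R`: the set `A ⊆ H × H` (to be thought of as the graph `{(U, A U)}` of an
unbounded operator) is the graph of an operator such that `A - Λ` is a bijection of the domain onto
`H`, and its inverse is the bounded operator `R = (A - Λ)⁻¹`.  Indeed the graph of `(A - Λ)⁻¹` is
`{(F - Λ U, U) : (U, F) ∈ A}`, and this has to be the graph of the injective operator `R`. -/
def IsResolventAt {H : Type*} [NormedAddCommGroup H] [NormedSpace ℂ H]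
    (A : Set (H × H)) (Λ : ℂ) (R : H →L[ℂ] H) : Prop :=
  Function.Injective R ∧ ∀ U F : H, (U, F) ∈ A ↔ R (F - Λ • U) = U

/-- `T` is of trace class: `∑ ⟨|T| e_i, e_i⟩ < ∞` for every orthonormal basis `(e_i)`, where
`|T| = (T* T)^{1/2}`. -/
def IsTraceClass {H : Type*} [NormedAddCommGroup H] [InnerProductSpace ℂ H] [CompleteSpace H]
    (T : H →L[ℂ] H) : Prop :=
  ∀ (w : Set H) (b : HilbertBasis w ℂ H),
    Summable fun i : w => (inner ℂ (b i) (CFC.abs T (b i))).re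

/-! ### Sobolev functions of one variable -/

/-- On the (open) interval `I`: `u ∈ H¹(I)`, `u` is the continuous (locally absolutely continuous)
representative of its class, and `g ∈ L²(I)` is its derivative. -/
def HasH1Deriv (I : Set ℝ) (u g : ℝ → ℂ) : Prop :=
  MemLp u 2 (volume.restrict I) ∧ MemLp g 2 (volume.restrict I) ∧
    ∀ x ∈ I, ∀ y ∈ I, u y - u x = ∫ t in x..y, g t

/-- The jump `d(o+) - d(o-)` of `d` at the point `o` exists and equals `c`. -/
def HasJump (d : ℝ → ℂ) (o : ℝ) (c : ℂ) : Prop :=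
  ∃ a b : ℂ, Tendsto d (𝓝[>] o) (𝓝 a) ∧ Tendsto d (𝓝[<] o) (𝓝 b) ∧ c = a - b

/-! ### Expansion in Hermite functions -/

/-- The Hilbert space `L²(ℝ³)`; the coordinates are `(x, (q₊, q₋))`. -/
abbrev L2R3 : Type := Lp ℂ 2 (volume : Measure (ℝ × ℝ × ℝ))

/-- The normalized Hermite functions
`χ_n(q) = (n! √π)^{-1/2} He_n(√2 q) exp(-q²/2)`, with `He_n` the probabilists' polynomials. -/
def hermiteFun (n : ℕ) (q : ℝ) : ℝ :=
  (√((n.factorial : ℝ) * √Real.pi))⁻¹ *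
    (Polynomial.aeval (√2 * q) (Polynomial.hermite n) * Real.exp (-q ^ 2 / 2))

/-- The coefficients `u_{m,n}(x)` in `U(x, q₊, q₋) = ∑ u_{m,n}(x) χ_m(q₊) χ_n(q₋)`. -/
def hermiteCoeff (U : ℝ × ℝ × ℝ → ℂ) (m n : ℕ) (x : ℝ) : ℂ :=
  ∫ q : ℝ × ℝ, U (x, q) * ((hermiteFun m q.1 * hermiteFun n q.2 : ℝ) : ℂ)

/-- `r_{m,n} = ν₊² (m + 1/2) + ν₋² (n + 1/2)`. -/
def rCoeff (νp νm : ℝ) (m n : ℕ) : ℝ := νp ^ 2 * (m + 1 / 2) + νm ^ 2 * (n + 1 / 2)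

/-! ### The operators -/

/-- Let `Ω` be an open interval, cut into the open intervals of the family `pieces`.
On `Ω × ℝ²`, the coefficients of `U` are represented by the functions `v m n ∈ H¹(Ω)`,
with derivative `d m n`, whose restriction to each of the pieces lies in `H²`, with second
derivative `s m n`; the sum of the `‖L_{m,n} v_{m,n}‖²` over `m, n` is finite, where
`L_{m,n} v = -v'' + r_{m,n} v`; and `F` is the function with the coefficients
`L_{m,n} v_{m,n}`. -/
structure IsAction (νp νm : ℝ) (Ω : Set ℝ) (pieces : Set (Set ℝ)) (U F : ℝ × ℝ × ℝ → ℂ)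
    (v d s : ℕ → ℕ → ℝ → ℂ) : Prop where
  rep : ∀ m n, v m n =ᵐ[volume.restrict Ω] hermiteCoeff U m n
  memH1 : ∀ m n, HasH1Deriv Ω (v m n) (d m n)
  memH2 : ∀ m n, ∀ I ∈ pieces, HasH1Deriv I (d m n) (s m n)
  finite : ∑' p : ℕ × ℕ, ∫⁻ x in Ω,
    ‖-s p.1 p.2 x + (rCoeff νp νm p.1 p.2 : ℂ) * v p.1 p.2 x‖ₑ ^ 2 < ∞
  image : ∀ m n, hermiteCoeff F m n =ᵐ[volume.restrict Ω]
    fun x => -s m n x + (rCoeff νp νm m n : ℂ) * v m n x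

/-- The matching conditions at `x = 1`:
`[v'_{m,n}](1) = (α₊/√2) (√(m+1) v_{m+1,n}(1) + √m v_{m-1,n}(1))`.
(For `m = 0` the last term is absent: its factor is `√0 = 0`.) -/
def MatchingPlus (αp : ℝ) (v d : ℕ → ℕ → ℝ → ℂ) : Prop :=
  ∀ m n, HasJump (d m n) 1 (((αp / √2 : ℝ) : ℂ) *
    (((√(m + 1 : ℝ) : ℝ) : ℂ) * v (m + 1) n 1 + ((√(m : ℝ) : ℝ) : ℂ) * v (m - 1) n 1))

/-- The matching conditions at `x = -1`:
`[v'_{m,n}](-1) = (α₋/√2) (√(n+1) v_{m,n+1}(-1) + √n v_{m,n-1}(-1))`. -/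
def MatchingMinus (αm : ℝ) (v d : ℕ → ℕ → ℝ → ℂ) : Prop :=
  ∀ m n, HasJump (d m n) (-1) (((αm / √2 : ℝ) : ℂ) *
    (((√(n + 1 : ℝ) : ℝ) : ℂ) * v m (n + 1) (-1) + ((√(n : ℝ) : ℝ) : ℂ) * v m (n - 1) (-1)))

/-- The graph of the operator `A_α` in `L²(ℝ³)`. -/
def opA (αp αm νp νm : ℝ) : Set (L2R3 × L2R3) :=
  {p | ∃ v d s, IsAction νp νm univ {Iio (-1), Ioo (-1) 1, Ioi 1} p.1 p.2 v d s ∧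
    MatchingPlus αp v d ∧ MatchingMinus αm v d}

/-- `A⁺ U = F` on the half-space `ℝ₊ × ℝ²` (only the restrictions of `U` and `F` to the half-space
matter): matching condition at `x = 1`, Dirichlet condition at `x = 0`. -/
def IsActionPlus (αp νp νm : ℝ) (U F : ℝ × ℝ × ℝ → ℂ) : Prop :=
  ∃ v d s, IsAction νp νm (Ioi 0) {Ioo 0 1, Ioi 1} U F v d s ∧
    MatchingPlus αp v d ∧ ∀ m n, Tendsto (v m n) (𝓝[>] 0) (𝓝 0)

/-- `A⁻ U = F` on the half-space `ℝ₋ × ℝ²` (only the restrictions of `U` and `F` to the half-space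
matter): matching condition at `x = -1`, Dirichlet condition at `x = 0`. -/
def IsActionMinus (αm νp νm : ℝ) (U F : ℝ × ℝ × ℝ → ℂ) : Prop :=
  ∃ v d s, IsAction νp νm (Iio 0) {Iio (-1), Ioo (-1) 0} U F v d s ∧
    MatchingMinus αm v d ∧ ∀ m n, Tendsto (v m n) (𝓝[<] 0) (𝓝 0)

/-- The graph of `A°_α = A⁺ ⊕ A⁻` with respect to the decomposition
`L²(ℝ³) = L²(ℝ₊ × ℝ²) ⊕ L²(ℝ₋ × ℝ²)`. -/
def opACirc (αp αm νp νm : ℝ) : Set (L2R3 × L2R3) :=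
  {p | IsActionPlus αp νp νm p.1 p.2 ∧ IsActionMinus αm νp νm p.1 p.2}

end Smilansky

end

/-! Expansion in Hermite functions turns both operators into systems of ordinary differential
operators -u'' + r_p u, p = (m, n), coupled only through the jumps of u' at ±1. `opGraph` treats
them together: both are described with a possible break at 0, and the flag `dir` selects either the
Dirichlet condition there or the absence of a break. Below, k stands for `rootIndex p` = √(m + n +
1), so that r_p is of order k².

Resolvents. The couplings at ±1 are real symmetric Jacobi matrices, so Green's formula summed over a
box m, n < N leaves interface terms only on the edge of the box. A trace inequality gives ∑
|u_p(±1)|² / k < ∞ on the domains, which bounds the edge terms by N ρ_N with ρ summable. Since the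
harmonic series diverges, they are arbitrarily small for infinitely many N, and this suffices
because the sums over boxes converge. Hence the operators are symmetric (`opGraph_symmetric`), which
yields uniqueness and |Im Λ| ‖U‖ ≤ ‖F‖. Solutions are limits of solutions of systems truncated to
boxes; there the energy identity is exact and bounds everything uniformly in N
(`exists_mem_opGraph`).

Difference. Let R and R₀ be the resolvents of A_α and A°_α. Both operators have the same matching
conditions at ±1, so Green's formula between their domains (`IsExpansion.inner_sub_eq`) retains only
the origin: ⟨(R - R₀) X, Y⟩ is the sum over p of conj (u_p(0)) times the jump of w_p' at 0, with u =
R X and w the resolvent of A°_α at conj Λ applied to Y. Thus R - R₀ is a sum of rank-one operators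
indexed by p.

Decay. The modes interact only at distance 1 from the origin. An energy estimate with a weight that
vanishes at ±1 (`IsMode.weighted_energy`) does not see this interaction, and shows that each
application of a resolvent gains a factor k⁻⁴ in the local square norm near 0, up to an
exponentially small error (`HasLocalDecay.resolvent`). With `IsMode.origin_trace_le`, n preceding
resolvents make the squared trace at most of order k^{-(4n+3)} and the squared jump at most of order
k^{-(4n+1)} (`exists_origin_bound`).

Conclusion. R³ - R₀³ is the sum of R^a (R - R₀) R₀^b over a + b = 2. The rank-one terms have norms
O(k^{-(4a+4b+4)/2}) = O(k⁻⁶) = O((m + n + 1)⁻³), summable over pairs. For second powers this count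
would give (m + n + 1)⁻², whose sum over pairs diverges logarithmically. `hasTraceBound_of_tsum` and
`HasTraceBound.isTraceClass` turn summability into the trace class property. -/

noncomputable section

namespace Smilansky

/-! ### Primitives and one-sided limits -/

/-- The increments of `f` on `I` are the integrals of `g`, which is integrable on `I`. -/
def IsPrimitiveOn (I : Set ℝ) (f g : ℝ → ℂ) : Prop :=
  IntegrableOn g I ∧ ∀ x ∈ I, ∀ y ∈ I, f y - f x = ∫ t in x..y, g t

/-- Reduction to real-valued integrands: the primitives of the real and imaginary parts are
multiplied by the constants 1 and I and added. -/
theorem absolutelyContinuous_integral {g : ℝ → ℂ} {a b : ℝ} (hg : IntervalIntegrable g volume a b) :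
    AbsolutelyContinuousOnInterval (fun x => ∫ t in a..x, g t) a b := by
  have hre : IntervalIntegrable (fun t => (g t).re) volume a b := ⟨hg.1.re, hg.2.re⟩
  have him : IntervalIntegrable (fun t => (g t).im) volume a b := ⟨hg.1.im, hg.2.im⟩
  have hc : ∀ c : ℂ, AbsolutelyContinuousOnInterval (fun _ : ℝ => c) a b := fun c =>
    (LipschitzWith.const c).lipschitzOnWith.absolutelyContinuousOnInterval
  have h1 := (hre.absolutelyContinuousOnInterval_intervalIntegral (left_mem_uIcc)).fun_smul (hc 1)
  have h2 := (him.absolutelyContinuousOnInterval_intervalIntegral (left_mem_uIcc)).fun_smul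
    (hc Complex.I)
  have h3 := h1.add h2
  unfold AbsolutelyContinuousOnInterval at h3 ⊢
  refine Tendsto.congr' ?_ h3
  rw [Filter.EventuallyEq, eventually_inf_principal]
  refine Eventually.of_forall fun E hE => ?_
  have key : ∀ x ∈ uIcc a b, ((fun x => (∫ t in a..x, (g t).re) • (1 : ℂ)) +
      fun x => (∫ t in a..x, (g t).im) • Complex.I) x = ∫ t in a..x, g t := by
    intro x hx
    have hgx : IntervalIntegrable g volume a x := hg.mono_set (uIcc_subset_uIcc_left hx)
    have e1 : ∫ t in a..x, (g t).re = (∫ t in a..x, g t).re :=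
      intervalIntegral.intervalIntegral_re hgx
    have e2 : ∫ t in a..x, (g t).im = (∫ t in a..x, g t).im :=
      intervalIntegral.intervalIntegral_im hgx
    apply Complex.ext <;> simp [e1, e2]
  refine Finset.sum_congr rfl fun i hi => ?_
  have hh := hE.1 i hi
  rw [key _ hh.1, key _ hh.2]

/-- The product minus the integral on the right is absolutely continuous with derivative zero almost
everywhere, hence constant. Every integration by parts for Sobolev functions below rests on this. -/
theorem mul_sub_mul_eq_integral {f g h k : ℝ → ℂ} {a b : ℝ}
    (hg : IntervalIntegrable g volume a b) (hk : IntervalIntegrable k volume a b)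
    (hf : ∀ x ∈ uIcc a b, f x - f a = ∫ t in a..x, g t)
    (hh : ∀ x ∈ uIcc a b, h x - h a = ∫ t in a..x, k t) :
    f b * h b - f a * h a = ∫ t in a..b, (g t * h t + f t * k t) := by
  have hc : ∀ c : ℂ, AbsolutelyContinuousOnInterval (fun _ : ℝ => c) a b := fun c =>
    (LipschitzWith.const c).lipschitzOnWith.absolutelyContinuousOnInterval
  set f' : ℝ → ℂ := fun x => f a + ∫ t in a..x, g t
  set h' : ℝ → ℂ := fun x => h a + ∫ t in a..x, k t
  have ef : ∀ x ∈ uIcc a b, f x = f' x := fun x hx => by simp only [f']; rw [← hf x hx]; ring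
  have eh : ∀ x ∈ uIcc a b, h x = h' x := fun x hx => by simp only [h']; rw [← hh x hx]; ring
  have acf : AbsolutelyContinuousOnInterval f' a b :=
    (hc (f a)).add (absolutelyContinuous_integral hg)
  have ach : AbsolutelyContinuousOnInterval h' a b :=
    (hc (h a)).add (absolutelyContinuous_integral hk)
  have hi : IntervalIntegrable (fun t => g t * h' t + f' t * k t) volume a b :=
    (hg.mul_continuousOn ach.continuousOn).add (hk.continuousOn_mul acf.continuousOn)
  have acw : AbsolutelyContinuousOnInterval
      ((fun x => f' x • h' x) - fun x => ∫ t in a..x, (g t * h' t + f' t * k t)) a b :=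
    (acf.fun_smul ach).sub (absolutelyContinuous_integral hi)
  obtain ⟨C, hC⟩ := acw.const_of_ae_hasDerivAt_zero (by
    filter_upwards [hg.ae_hasDerivAt_integral, hk.ae_hasDerivAt_integral,
      hi.ae_hasDerivAt_integral] with x h1 h2 h3 hx
    have d1 := (h1 hx a left_mem_uIcc).const_add (f a)
    have d2 := (h2 hx a left_mem_uIcc).const_add (h a)
    have d3 := h3 hx a left_mem_uIcc
    have := (d1.mul d2).sub d3
    convert! this using 1
    simp only [f', h']
    ring)
  have ha := hC a left_mem_uIcc
  have hb := hC b right_mem_uIcc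
  have e3 : ∫ t in a..b, (g t * h t + f t * k t) = ∫ t in a..b, (g t * h' t + f' t * k t) :=
    intervalIntegral.integral_congr fun t ht => by
      simp only [ef t ht, eh t ht]
  rw [e3, ef b right_mem_uIcc, ef a left_mem_uIcc, eh b right_mem_uIcc, eh a left_mem_uIcc]
  simp only [Pi.sub_apply, smul_eq_mul, intervalIntegral.integral_same, sub_zero] at ha hb
  rw [ha, ← hb]; ring

namespace IsPrimitiveOn

variable {I : Set ℝ} {f g h k : ℝ → ℂ} {a b : ℝ} {A B : ℂ}

theorem continuousOn (hI : I.OrdConnected) (hf : IsPrimitiveOn I f g) : ContinuousOn f I := by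
  rcases I.eq_empty_or_nonempty with rfl | ⟨c, hc⟩
  · exact continuousOn_empty _
  have h1 : ∀ x ∈ I, f x = f c + ∫ t in c..x, g t := fun x hx => by
    rw [← hf.2 c hc x hx]; ring
  have hG : Continuous fun x => f c + ∫ t in c..x, I.indicator g t := by
    refine continuous_const.add ?_
    refine intervalIntegral.continuous_primitive (fun a b => ?_) c
    exact (((integrable_indicator_iff hI.measurableSet).2 hf.1).integrableOn).intervalIntegrable
  refine hG.continuousOn.congr fun x hx => ?_
  simp only
  rw [h1 x hx]
  congr 1
  exact intervalIntegral.integral_congr fun t ht =>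
    (indicator_of_mem (hI.uIcc_subset hc hx ht) g).symm

/-- A primitive on `I` extends continuously to the real line. -/
theorem exists_continuous (hI : I.OrdConnected) (hne : I.Nonempty) (hf : IsPrimitiveOn I f g) :
    ∃ F : ℝ → ℂ, Continuous F ∧ EqOn F f I ∧
      ∀ x y, F y - F x = ∫ t in x..y, I.indicator g t := by
  obtain ⟨c, hc⟩ := hne
  have hint : ∀ a b, IntervalIntegrable (I.indicator g) volume a b := fun a b =>
    (((integrable_indicator_iff hI.measurableSet).2 hf.1).integrableOn).intervalIntegrable
  refine ⟨fun x => f c + ∫ t in c..x, I.indicator g t, ?_, fun x hx => ?_, fun x y => ?_⟩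
  · exact continuous_const.add (intervalIntegral.continuous_primitive hint c)
  · have : ∫ t in c..x, I.indicator g t = ∫ t in c..x, g t :=
      intervalIntegral.integral_congr fun t ht =>
        indicator_of_mem (hI.uIcc_subset hc hx ht) g
    simp only [this, ← hf.2 c hc x hx]; ring
  · simp only [add_sub_add_left_eq_sub]
    exact intervalIntegral.integral_interval_sub_left (hint c y) (hint c x)

theorem exists_limits_Ioo (hab : a < b) (hf : IsPrimitiveOn (Ioo a b) f g) :
    ∃ A B, Tendsto f (𝓝[>] a) (𝓝 A) ∧ Tendsto f (𝓝[<] b) (𝓝 B) := by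
  obtain ⟨F, hF, hEq, -⟩ := hf.exists_continuous ordConnected_Ioo (nonempty_Ioo.2 hab)
  refine ⟨F a, F b, ?_, ?_⟩
  · refine (hF.continuousWithinAt (s := Ioi a)).tendsto.congr' ?_
    filter_upwards [Ioo_mem_nhdsGT hab] with x hx using hEq hx
  · refine (hF.continuousWithinAt (s := Iio b)).tendsto.congr' ?_
    filter_upwards [Ioo_mem_nhdsLT hab] with x hx using hEq hx

theorem integral_Ioo (hab : a < b) (hf : IsPrimitiveOn (Ioo a b) f g)
    (hA : Tendsto f (𝓝[>] a) (𝓝 A)) (hB : Tendsto f (𝓝[<] b) (𝓝 B)) :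
    ∫ t in Ioo a b, g t = B - A := by
  obtain ⟨F, hF, hEq, hi⟩ := hf.exists_continuous ordConnected_Ioo (nonempty_Ioo.2 hab)
  have h1 : A = F a := tendsto_nhds_unique hA
    ((hF.continuousWithinAt (s := Ioi a)).tendsto.congr' (by
      filter_upwards [Ioo_mem_nhdsGT hab] with x hx using hEq hx))
  have h2 : B = F b := tendsto_nhds_unique hB
    ((hF.continuousWithinAt (s := Iio b)).tendsto.congr' (by
      filter_upwards [Ioo_mem_nhdsLT hab] with x hx using hEq hx))
  rw [h1, h2, hi, intervalIntegral.integral_of_le hab.le, ← integral_Ioc_eq_integral_Ioo]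
  rw [integral_Ioc_eq_integral_Ioo, integral_Ioc_eq_integral_Ioo]
  exact setIntegral_congr_fun measurableSet_Ioo fun t ht => (indicator_of_mem ht g).symm

/-- The primitive has a limit at infinity because g is integrable, and that limit is 0 because f is
integrable as well; only the finite endpoint contributes. -/
theorem integral_Ioi (hf : IsPrimitiveOn (Ioi a) f g) (hfi : IntegrableOn f (Ioi a))
    (hA : Tendsto f (𝓝[>] a) (𝓝 A)) : ∫ t in Ioi a, g t = - A := by
  obtain ⟨F, hF, hEq, hi⟩ := hf.exists_continuous ordConnected_Ioi nonempty_Ioi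
  have h1 : A = F a := tendsto_nhds_unique hA
    ((hF.continuousWithinAt (s := Ioi a)).tendsto.congr' (by
      filter_upwards [self_mem_nhdsWithin] with x hx using hEq hx))
  have hlim : Tendsto F atTop (𝓝 (F a + ∫ t in Ioi a, g t)) := by
    have := (intervalIntegral_tendsto_integral_Ioi a hf.1 tendsto_id).const_add (F a)
    refine this.congr' ?_
    filter_upwards [eventually_ge_atTop a] with x hx
    have h2 : ∫ t in a..x, (Ioi a).indicator g t = ∫ t in a..x, g t := by
      refine intervalIntegral.integral_congr_ae (Eventually.of_forall fun t ht => ?_)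
      rw [uIoc_of_le hx] at ht
      exact indicator_of_mem ht.1 g
    simp only [id, ← h2, ← hi]; ring
  have hz : F a + ∫ t in Ioi a, g t = 0 := by
    have hFi : IntegrableAtFilter F atTop :=
      ⟨Ioi a, Ioi_mem_atTop a, hfi.congr_fun hEq.symm measurableSet_Ioi⟩
    refine hFi.eq_zero_of_tendsto ?_ hlim
    intro s hs
    obtain ⟨N, hN⟩ := mem_atTop_sets.1 hs
    refine le_antisymm le_top ?_
    rw [← Real.volume_Ici (a := N)]
    exact measure_mono hN
  rw [h1]; exact (neg_eq_of_add_eq_zero_right hz).symm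

theorem integral_Iio (hf : IsPrimitiveOn (Iio a) f g) (hfi : IntegrableOn f (Iio a))
    (hA : Tendsto f (𝓝[<] a) (𝓝 A)) : ∫ t in Iio a, g t = A := by
  have hneg : Tendsto (fun x : ℝ => -x) (𝓝[>] (-a)) (𝓝[<] a) := by
    simpa using tendsto_neg_nhdsGT (a := -a)
  have hp : Iio a = (fun x : ℝ => -x) ⁻¹' (Ioi (-a)) := by ext; simp
  have hp' : Ioi (-a) = (fun x : ℝ => -x) ⁻¹' (Iio a) := by ext; simp
  have hm := (Measure.measurePreserving_neg (volume : Measure ℝ))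
  have he : MeasurableEmbedding (fun x : ℝ => -x) := (MeasurableEquiv.neg ℝ).measurableEmbedding
  have key : IsPrimitiveOn (Ioi (-a)) (fun x => f (-x)) (fun x => -g (-x)) := by
    refine ⟨?_, fun x hx y hy => ?_⟩
    · refine Integrable.neg ?_
      rw [hp']
      exact (hm.integrableOn_comp_preimage he).2 hf.1
    · rw [hf.2 (-x) (by simpa [neg_lt] using hx) (-y) (by simpa [neg_lt] using hy),
        intervalIntegral.integral_neg, intervalIntegral.integral_comp_neg,
        intervalIntegral.integral_symm]
  have := key.integral_Ioi (by rw [hp']; exact (hm.integrableOn_comp_preimage he).2 hfi)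
    (hA.comp hneg)
  rw [integral_neg, hp', hm.setIntegral_preimage_emb he] at this
  exact neg_injective this

end IsPrimitiveOn

/-! ### Sobolev functions -/

theorem measurePreserving_neg_restrict (I : Set ℝ) :
    MeasurePreserving (fun x : ℝ => -x) (volume.restrict ((fun x : ℝ => -x) ⁻¹' I))
      (volume.restrict I) :=
  (Measure.measurePreserving_neg (volume : Measure ℝ)).restrict_preimage_emb
    (MeasurableEquiv.neg ℝ).measurableEmbedding I

theorem memLp_conj {μ : Measure ℝ} {f : ℝ → ℂ} (hf : MemLp f 2 μ) :
    MemLp (fun x => (starRingEnd ℂ) (f x)) 2 μ :=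
  hf.of_le (Complex.continuous_conj.comp_aestronglyMeasurable hf.1)
    (Eventually.of_forall fun x => by simp)

theorem memLp_mul_integrable {μ : Measure ℝ} {f g : ℝ → ℂ} (hf : MemLp f 2 μ) (hg : MemLp g 2 μ) :
    Integrable (fun x => f x * g x) μ := hf.integrable_mul hg

/-- Cauchy–Schwarz against the constant 1, in the form that the variance of ‖f‖ is nonnegative; M /
(b - a) is the mean. -/
theorem norm_sq_setIntegral_le {f : ℝ → ℂ} {a b : ℝ} (hab : a < b)
    (hf : MemLp f 2 (volume.restrict (Ioo a b))) :
    ‖∫ x in Ioo a b, f x‖ ^ 2 ≤ (b - a) * ∫ x in Ioo a b, ‖f x‖ ^ 2 := by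
  set M := ∫ x in Ioo a b, ‖f x‖
  have hle : ‖∫ x in Ioo a b, f x‖ ≤ M := norm_integral_le_integral_norm _
  have hi1 : Integrable (fun x => ‖f x‖) (volume.restrict (Ioo a b)) :=
    (hf.integrable one_le_two).norm
  have hi2 : Integrable (fun x => ‖f x‖ ^ 2) (volume.restrict (Ioo a b)) :=
    hf.norm.integrable_sq
  have h0 : 0 ≤ ∫ x in Ioo a b, (‖f x‖ - M / (b - a)) ^ 2 := integral_nonneg fun x => sq_nonneg _
  have h1 : ∫ x in Ioo a b, (‖f x‖ - M / (b - a)) ^ 2 =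
      (∫ x in Ioo a b, ‖f x‖ ^ 2) - 2 * (M / (b - a)) * M + (M / (b - a)) ^ 2 * (b - a) := by
    have : ∀ x, (‖f x‖ - M / (b - a)) ^ 2 =
      ‖f x‖ ^ 2 - 2 * (M / (b - a)) * ‖f x‖ + (M / (b - a)) ^ 2 := fun x => by ring
    simp_rw [this]
    rw [integral_add (f := fun x => ‖f x‖ ^ 2 - 2 * (M / (b - a)) * ‖f x‖)
      (hi2.sub (hi1.const_mul _)) (integrable_const _),
      integral_sub hi2 (hi1.const_mul _), integral_const_mul, integral_const]
    simp only [Measure.real, Measure.restrict_apply_univ, Real.volume_Ioo, smul_eq_mul,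
      ENNReal.toReal_ofReal (sub_nonneg.2 hab.le), M]
    ring
  have hba : 0 < b - a := sub_pos.2 hab
  have h2 : M ^ 2 ≤ (b - a) * ∫ x in Ioo a b, ‖f x‖ ^ 2 := by
    rw [h1] at h0
    have : (∫ x in Ioo a b, ‖f x‖ ^ 2) - 2 * (M / (b - a)) * M + (M / (b - a)) ^ 2 * (b - a)
      = (∫ x in Ioo a b, ‖f x‖ ^ 2) - M ^ 2 / (b - a) := by field_simp; ring
    rw [this, sub_nonneg, div_le_iff₀ hba] at h0
    linarith
  exact (pow_le_pow_left₀ (norm_nonneg _) hle 2).trans h2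

namespace HasH1Deriv

variable {I : Set ℝ} {u d v e : ℝ → ℂ} {a b : ℝ}

theorem mono (h : HasH1Deriv I u d) {J : Set ℝ} (hJ : J ⊆ I) : HasH1Deriv J u d :=
  ⟨h.1.mono_measure (Measure.restrict_mono hJ le_rfl),
    h.2.1.mono_measure (Measure.restrict_mono hJ le_rfl),
    fun x hx y hy => h.2.2 x (hJ hx) y (hJ hy)⟩

theorem intervalIntegrable (hI : I.OrdConnected) (h : HasH1Deriv I u d) {x y : ℝ} (hx : x ∈ I)
    (hy : y ∈ I) : IntervalIntegrable d volume x y := by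
  have : IntegrableOn d (uIcc x y) := by
    have hm := h.2.1.mono_measure (Measure.restrict_mono (hI.uIcc_subset hx hy) le_rfl)
    have : IsFiniteMeasure (volume.restrict (uIcc x y)) := ⟨by
      simp only [Measure.restrict_apply_univ]; exact isCompact_uIcc.measure_lt_top⟩
    exact hm.integrable one_le_two
  exact this.intervalIntegrable

theorem add (hI : I.OrdConnected) (h : HasH1Deriv I u d) (h' : HasH1Deriv I v e) :
    HasH1Deriv I (fun x => u x + v x) (fun x => d x + e x) := by
  refine ⟨h.1.add h'.1, h.2.1.add h'.2.1, fun x hx y hy => ?_⟩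
  rw [intervalIntegral.integral_add (h.intervalIntegrable hI hx hy)
    (h'.intervalIntegrable hI hx hy), ← h.2.2 x hx y hy, ← h'.2.2 x hx y hy]
  ring

theorem const_mul (c : ℂ) (h : HasH1Deriv I u d) :
    HasH1Deriv I (fun x => c * u x) (fun x => c * d x) := by
  refine ⟨h.1.const_mul c, h.2.1.const_mul c, fun x hx y hy => ?_⟩
  rw [intervalIntegral.integral_const_mul, ← h.2.2 x hx y hy]
  ring

theorem conj (h : HasH1Deriv I u d) :
    HasH1Deriv I (fun x => (starRingEnd ℂ) (u x)) (fun x => (starRingEnd ℂ) (d x)) := by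
  refine ⟨memLp_conj h.1, memLp_conj h.2.1, fun x hx y hy => ?_⟩
  rw [← map_sub, h.2.2 x hx y hy]
  simp only [intervalIntegral, integral_conj, map_sub]

theorem comp_neg (h : HasH1Deriv I u d) :
    HasH1Deriv ((fun x : ℝ => -x) ⁻¹' I) (fun x => u (-x)) (fun x => -d (-x)) := by
  refine ⟨h.1.comp_measurePreserving (measurePreserving_neg_restrict I),
    (h.2.1.comp_measurePreserving (measurePreserving_neg_restrict I)).neg, fun x hx y hy => ?_⟩
  rw [h.2.2 (-x) hx (-y) hy, intervalIntegral.integral_neg, intervalIntegral.integral_comp_neg,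
    intervalIntegral.integral_symm]

theorem neg (h : HasH1Deriv I u d) : HasH1Deriv I (fun x => -u x) (fun x => -d x) := by
  simpa using h.const_mul (-1)

theorem isPrimitiveOn_Ioo (h : HasH1Deriv (Ioo a b) u d) : IsPrimitiveOn (Ioo a b) u d :=
  ⟨h.2.1.integrable one_le_two, h.2.2⟩

theorem mul (hI : I.OrdConnected) (h : HasH1Deriv I u d) (h' : HasH1Deriv I v e) :
    IsPrimitiveOn I (fun x => u x * v x) (fun x => d x * v x + u x * e x) := by
  refine ⟨(memLp_mul_integrable h.2.1 h'.1).add (memLp_mul_integrable h.1 h'.2.1),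
    fun x hx y hy => ?_⟩
  have hs : uIcc x y ⊆ I := hI.uIcc_subset hx hy
  exact mul_sub_mul_eq_integral (h.intervalIntegrable hI hx hy) (h'.intervalIntegrable hI hx hy)
    (fun z hz => h.2.2 x hx z (hs hz)) (fun z hz => h'.2.2 x hx z (hs hz))

theorem exists_limits_Ioo (hab : a < b) (h : HasH1Deriv (Ioo a b) u d) :
    ∃ A B, Tendsto u (𝓝[>] a) (𝓝 A) ∧ Tendsto u (𝓝[<] b) (𝓝 B) :=
  h.isPrimitiveOn_Ioo.exists_limits_Ioo hab

theorem continuous (h : HasH1Deriv univ u d) : Continuous u := by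
  rw [continuous_iff_continuousAt]
  intro x
  have hI := (h.mono (subset_univ (Ioo (x - 1) (x + 1)))).isPrimitiveOn_Ioo
  exact (hI.continuousOn ordConnected_Ioo).continuousAt
    (Ioo_mem_nhds (by linarith) (by linarith))

theorem of_hasDerivAt_Ioo (hd : ∀ x, HasDerivAt u (d x) x) (hc : Continuous d) :
    HasH1Deriv (Ioo a b) u d := by
  have hu : Continuous u := continuous_iff_continuousAt.2 fun x => (hd x).continuousAt
  have key : ∀ f : ℝ → ℂ, Continuous f → MemLp f 2 (volume.restrict (Ioo a b)) := by
    intro f hf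
    obtain ⟨C, hC⟩ := isCompact_Icc.exists_bound_of_continuousOn (hf.continuousOn (s := Icc a b))
    refine MemLp.of_bound hf.aestronglyMeasurable C ?_
    exact (ae_restrict_iff' measurableSet_Ioo).2 (Eventually.of_forall fun x hx =>
      hC x (Ioo_subset_Icc_self hx))
  exact ⟨key u hu, key d hc, fun x _ y _ => (intervalIntegral.integral_eq_sub_of_hasDerivAt
    (fun z _ => hd z) (hc.intervalIntegrable _ _)).symm⟩

theorem smooth_mul {φ φ' : ℝ → ℂ} (hd : ∀ x, HasDerivAt φ (φ' x) x) (hc : Continuous φ')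
    (h : HasH1Deriv (Ioo a b) u d) :
    HasH1Deriv (Ioo a b) (fun x => φ x * u x) (fun x => φ' x * u x + φ x * d x) := by
  have hu : Continuous φ := continuous_iff_continuousAt.2 fun x => (hd x).continuousAt
  have key : ∀ f g : ℝ → ℂ, Continuous f → MemLp g 2 (volume.restrict (Ioo a b)) →
      MemLp (fun x => f x * g x) 2 (volume.restrict (Ioo a b)) := by
    intro f g hf hg
    obtain ⟨C, hC⟩ := isCompact_Icc.exists_bound_of_continuousOn (hf.continuousOn (s := Icc a b))
    refine MemLp.of_le_mul (c := C) hg (hf.aestronglyMeasurable.mul hg.1) ?_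
    refine (ae_restrict_iff' measurableSet_Ioo).2 (Eventually.of_forall fun x hx => ?_)
    rw [norm_mul]
    exact mul_le_mul_of_nonneg_right (hC x (Ioo_subset_Icc_self hx)) (norm_nonneg _)
  refine ⟨key φ u hu h.1, (key φ' u hc h.1).add (key φ d hu h.2.1), ?_⟩
  exact ((of_hasDerivAt_Ioo hd hc).mul ordConnected_Ioo h).2

end HasH1Deriv

/-! ### Traces of `H²` functions -/

/-- Two integrations by parts against a test function φ with a double zero at the far endpoint leave
only D φ(a) - A φ'(a). The choice of φ isolates either the value or the derivative at a. -/
theorem norm_sq_trace_le {u d s : ℝ → ℂ} {a h : ℝ} (hh : 0 < h)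
    (hu : HasH1Deriv (Ioo a (a + h)) u d) (hd : HasH1Deriv (Ioo a (a + h)) d s) {A D : ℂ}
    (hA : Tendsto u (𝓝[>] a) (𝓝 A)) (hD : Tendsto d (𝓝[>] a) (𝓝 D))
    {φ φ' φ'' : ℝ → ℝ} (h1 : ∀ x, HasDerivAt φ (φ' x) x) (h2 : ∀ x, HasDerivAt φ' (φ'' x) x)
    (hc : Continuous φ'') (hφ : φ (a + h) = 0) (hφ' : φ' (a + h) = 0) {p q : ℝ}
    (hp : ∀ x ∈ Ioo a (a + h), |φ x| ≤ p) (hq : ∀ x ∈ Ioo a (a + h), |φ'' x| ≤ q) :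
    ‖D * φ a - A * φ' a‖ ^ 2 ≤ h * (2 * p ^ 2 * (∫ x in Ioo a (a + h), ‖s x‖ ^ 2) +
      2 * q ^ 2 * ∫ x in Ioo a (a + h), ‖u x‖ ^ 2) := by
  have hab : a < a + h := by linarith
  obtain ⟨-, A', -, hA'⟩ := hu.exists_limits_Ioo hab
  obtain ⟨-, D', -, hD'⟩ := hd.exists_limits_Ioo hab
  have c1 : Continuous φ := continuous_iff_continuousAt.2 fun x => (h1 x).continuousAt
  have c2 : Continuous φ' := continuous_iff_continuousAt.2 fun x => (h2 x).continuousAt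
  have k1 : HasH1Deriv (Ioo a (a + h)) (fun x => (φ x : ℂ)) (fun x => (φ' x : ℂ)) :=
    HasH1Deriv.of_hasDerivAt_Ioo (fun x => (h1 x).ofReal_comp) (Complex.continuous_ofReal.comp c2)
  have k2 : HasH1Deriv (Ioo a (a + h)) (fun x => (φ' x : ℂ)) (fun x => (φ'' x : ℂ)) :=
    HasH1Deriv.of_hasDerivAt_Ioo (fun x => (h2 x).ofReal_comp) (Complex.continuous_ofReal.comp hc)
  have m1 := hd.mul ordConnected_Ioo k1
  have m2 := hu.mul ordConnected_Ioo k2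
  have l : ∀ (f : ℝ → ℝ), Continuous f → ∀ x (S : Set ℝ),
      Tendsto (fun y => (f y : ℂ)) (𝓝[S] x) (𝓝 (f x : ℂ)) := fun f hf x S =>
    (Complex.continuous_ofReal.comp hf).continuousWithinAt
  have i1 := m1.integral_Ioo hab (hD.mul (l φ c1 a _)) (hD'.mul (l φ c1 (a + h) _))
  have i2 := m2.integral_Ioo hab (hA.mul (l φ' c2 a _)) (hA'.mul (l φ' c2 (a + h) _))
  have i3 : ∫ t in Ioo a (a + h), (s t * φ t - u t * φ'' t) = -(D * φ a - A * φ' a) := by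
    have : ∀ t, s t * φ t - u t * φ'' t =
      (s t * φ t + d t * φ' t) - (d t * φ' t + u t * φ'' t) := fun t => by ring
    simp_rw [this]
    rw [integral_sub m1.1 m2.1, i1, i2, hφ, hφ']
    simp only [Complex.ofReal_zero, mul_zero]; ring
  have bd : ∀ (f g : ℝ → ℂ) (c : ℝ), Continuous f →
      MemLp g 2 (volume.restrict (Ioo a (a + h))) →
      MemLp (fun x => g x * f x) 2 (volume.restrict (Ioo a (a + h))) := by
    intro f g _ hf hg
    obtain ⟨C, hC⟩ := isCompact_Icc.exists_bound_of_continuousOn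
      (hf.continuousOn (s := Icc a (a + h)))
    refine MemLp.of_le_mul (c := C) hg (hg.1.mul hf.aestronglyMeasurable) ?_
    refine (ae_restrict_iff' measurableSet_Ioo).2 (Eventually.of_forall fun x hx => ?_)
    rw [norm_mul, mul_comm]
    exact mul_le_mul_of_nonneg_right (hC x (Ioo_subset_Icc_self hx)) (norm_nonneg _)
  have hm : MemLp (fun t => s t * (φ t : ℂ) - u t * (φ'' t : ℂ)) 2
      (volume.restrict (Ioo a (a + h))) :=
    (bd _ _ p (Complex.continuous_ofReal.comp c1) hd.2.1).sub
      (bd _ _ p (Complex.continuous_ofReal.comp hc) hu.1)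
  have hcs := norm_sq_setIntegral_le hab hm
  rw [i3, norm_neg, add_sub_cancel_left] at hcs
  refine hcs.trans (mul_le_mul_of_nonneg_left ?_ hh.le)
  have is : Integrable (fun x => ‖s x‖ ^ 2) (volume.restrict (Ioo a (a + h))) :=
    hd.2.1.norm.integrable_sq
  have iu : Integrable (fun x => ‖u x‖ ^ 2) (volume.restrict (Ioo a (a + h))) :=
    hu.1.norm.integrable_sq
  rw [← integral_const_mul, ← integral_const_mul, ← integral_add (is.const_mul _) (iu.const_mul _)]
  refine integral_mono_ae hm.norm.integrable_sq ((is.const_mul _).add (iu.const_mul _)) ?_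
  refine (ae_restrict_iff' measurableSet_Ioo).2 (Eventually.of_forall fun x hx => ?_)
  have e1 : ‖s x * (φ x : ℂ) - u x * (φ'' x : ℂ)‖ ≤ ‖s x‖ * p + ‖u x‖ * q := by
    refine (norm_sub_le _ _).trans ?_
    rw [norm_mul, norm_mul, Complex.norm_real, Complex.norm_real]
    gcongr
    · exact hp x hx
    · exact hq x hx
  calc ‖s x * (φ x : ℂ) - u x * (φ'' x : ℂ)‖ ^ 2 ≤ (‖s x‖ * p + ‖u x‖ * q) ^ 2 := by gcongr
    _ ≤ 2 * p ^ 2 * ‖s x‖ ^ 2 + 2 * q ^ 2 * ‖u x‖ ^ 2 := by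
      nlinarith [sq_nonneg (‖s x‖ * p - ‖u x‖ * q)]

theorem norm_sq_value_le {u d s : ℝ → ℂ} {a h : ℝ} (hh : 0 < h)
    (hu : HasH1Deriv (Ioo a (a + h)) u d) (hd : HasH1Deriv (Ioo a (a + h)) d s) {A : ℂ}
    (hA : Tendsto u (𝓝[>] a) (𝓝 A)) :
    ‖A‖ ^ 2 ≤ 2 * h ^ 3 * (∫ x in Ioo a (a + h), ‖s x‖ ^ 2) +
      32 / h * ∫ x in Ioo a (a + h), ‖u x‖ ^ 2 := by
  have hab : a < a + h := by linarith
  obtain ⟨D, -, hD, -⟩ := hd.exists_limits_Ioo hab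
  -- With y = x - a, the test function is y (1 - y/h)²: value 0 and slope 1 at a, a double zero at a
  -- + h, |φ| ≤ h and |φ''| ≤ 4/h.
  have h1 : ∀ x, HasDerivAt (fun x => (x - a) - 2 / h * (x - a) ^ 2 + 1 / h ^ 2 * (x - a) ^ 3)
      (1 - 4 / h * (x - a) + 3 / h ^ 2 * (x - a) ^ 2) x := fun x => by
    have e := (hasDerivAt_id x).sub_const a
    refine ((e.sub ((e.pow 2).const_mul (2 / h))).add
      ((e.pow 3).const_mul (1 / h ^ 2))).congr_deriv ?_
    simp only [id]; push_cast; ring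
  have h2 : ∀ x, HasDerivAt (fun x => 1 - 4 / h * (x - a) + 3 / h ^ 2 * (x - a) ^ 2)
      (- (4 / h) + 6 / h ^ 2 * (x - a)) x := fun x => by
    have e := (hasDerivAt_id x).sub_const a
    refine (((e.const_mul (4 / h)).const_sub 1).add
      ((e.pow 2).const_mul (3 / h ^ 2))).congr_deriv ?_
    simp only [id]; push_cast; ring
  have := norm_sq_trace_le (p := h) (q := 4 / h) hh hu hd hA hD h1 h2 (by fun_prop)
    (by field_simp; ring) (by field_simp; ring) (fun x hx => by
      have y0 : 0 < x - a := by linarith [hx.1]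
      have y1 : x - a < h := by linarith [hx.2]
      have : (x - a) - 2 / h * (x - a) ^ 2 + 1 / h ^ 2 * (x - a) ^ 3 =
        (x - a) * (1 - (x - a) / h) ^ 2 := by field_simp; ring
      rw [this]
      have z0 : 0 ≤ (x - a) / h := by positivity
      have z1 : (x - a) / h ≤ 1 := (div_le_one hh).2 y1.le
      have z2 : (1 - (x - a) / h) ^ 2 ≤ 1 := by nlinarith
      rw [abs_of_nonneg (by positivity)]
      nlinarith [sq_nonneg (1 - (x - a) / h)]) (fun x hx => by
      have y0 : 0 < x - a := by linarith [hx.1]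
      have y1 : x - a < h := by linarith [hx.2]
      have : - (4 / h) + 6 / h ^ 2 * (x - a) = (6 * ((x - a) / h) - 4) / h := by field_simp; ring
      have z0 : 0 ≤ (x - a) / h := by positivity
      have z1 : (x - a) / h ≤ 1 := (div_le_one hh).2 y1.le
      rw [this, abs_div, abs_of_pos hh]
      gcongr
      rw [abs_le]; constructor <;> linarith)
  simp only [sub_self] at this
  norm_num at this
  convert! this using 1
  field_simp
  ring

theorem norm_sq_deriv_le {u d s : ℝ → ℂ} {a h : ℝ} (hh : 0 < h)
    (hu : HasH1Deriv (Ioo a (a + h)) u d) (hd : HasH1Deriv (Ioo a (a + h)) d s) {D : ℂ}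
    (hD : Tendsto d (𝓝[>] a) (𝓝 D)) :
    ‖D‖ ^ 2 ≤ 2 * h * (∫ x in Ioo a (a + h), ‖s x‖ ^ 2) +
      72 / h ^ 3 * ∫ x in Ioo a (a + h), ‖u x‖ ^ 2 := by
  have hab : a < a + h := by linarith
  obtain ⟨A, -, hA, -⟩ := hu.exists_limits_Ioo hab
  -- With y = x - a, the test function is (1 - y/h)² (1 + 2y/h): value 1 and slope 0 at a, a double
  -- zero at a + h, |φ| ≤ 1 and |φ''| ≤ 6/h².
  have h1 : ∀ x, HasDerivAt (fun x => 1 - 3 / h ^ 2 * (x - a) ^ 2 + 2 / h ^ 3 * (x - a) ^ 3)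
      (- (6 / h ^ 2 * (x - a)) + 6 / h ^ 3 * (x - a) ^ 2) x := fun x => by
    have e := (hasDerivAt_id x).sub_const a
    refine ((((e.pow 2).const_mul (3 / h ^ 2)).const_sub 1).add
      ((e.pow 3).const_mul (2 / h ^ 3))).congr_deriv ?_
    simp only [id]; push_cast; ring
  have h2 : ∀ x, HasDerivAt (fun x => - (6 / h ^ 2 * (x - a)) + 6 / h ^ 3 * (x - a) ^ 2)
      (- (6 / h ^ 2) + 12 / h ^ 3 * (x - a)) x := fun x => by
    have e := (hasDerivAt_id x).sub_const a
    refine ((e.const_mul (6 / h ^ 2)).neg.add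
      ((e.pow 2).const_mul (6 / h ^ 3))).congr_deriv ?_
    simp only [id]; push_cast; ring
  have := norm_sq_trace_le (p := 1) (q := 6 / h ^ 2) hh hu hd hA hD h1 h2 (by fun_prop)
    (by field_simp; ring) (by field_simp; ring) (fun x hx => by
      have y0 : 0 < x - a := by linarith [hx.1]
      have y1 : x - a < h := by linarith [hx.2]
      have : 1 - 3 / h ^ 2 * (x - a) ^ 2 + 2 / h ^ 3 * (x - a) ^ 3 =
        (1 - (x - a) / h) ^ 2 * (1 + 2 * ((x - a) / h)) := by field_simp; ring
      rw [this]
      have z0 : 0 ≤ (x - a) / h := by positivity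
      have z1 : (x - a) / h ≤ 1 := (div_le_one hh).2 y1.le
      rw [abs_of_nonneg (by positivity)]
      nlinarith [mul_nonneg (mul_nonneg z0 z0) (sub_nonneg.2 z1), mul_nonneg z0 z0]) (fun x hx => by
      have y0 : 0 < x - a := by linarith [hx.1]
      have y1 : x - a < h := by linarith [hx.2]
      have : - (6 / h ^ 2) + 12 / h ^ 3 * (x - a) = (12 * ((x - a) / h) - 6) / h ^ 2 := by
        field_simp; ring
      have z0 : 0 ≤ (x - a) / h := by positivity
      have z1 : (x - a) / h ≤ 1 := (div_le_one hh).2 y1.le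
      rw [this, abs_div, abs_of_pos (pow_pos hh 2)]
      gcongr
      rw [abs_le]; constructor <;> linarith)
  simp only [sub_self] at this
  norm_num at this
  convert! this using 1
  field_simp
  ring

theorem setIntegral_Ioo_comp_neg (f : ℝ → ℝ) (a b : ℝ) :
    ∫ x in Ioo a b, f (-x) = ∫ x in Ioo (-b) (-a), f x := by
  have hp : Ioo a b = (fun x : ℝ => -x) ⁻¹' (Ioo (-b) (-a)) := by ext; simp
  rw [hp]
  exact (Measure.measurePreserving_neg (volume : Measure ℝ)).setIntegral_preimage_emb
    (MeasurableEquiv.neg ℝ).measurableEmbedding f _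

theorem HasH1Deriv.comp_neg_Ioo {u d : ℝ → ℂ} {a b : ℝ} (h : HasH1Deriv (Ioo a b) u d) :
    HasH1Deriv (Ioo (-b) (-a)) (fun x => u (-x)) (fun x => -d (-x)) := by
  have hp : Ioo (-b) (-a) = (fun x : ℝ => -x) ⁻¹' (Ioo a b) := by
    ext; simp only [mem_Ioo, mem_preimage]; constructor <;> rintro ⟨_, _⟩ <;> constructor <;>
      linarith
  rw [hp]; exact h.comp_neg

theorem tendsto_comp_neg_right {f : ℝ → ℂ} {a : ℝ} {A : ℂ} (h : Tendsto f (𝓝[<] a) (𝓝 A)) :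
    Tendsto (fun x => f (-x)) (𝓝[>] (-a)) (𝓝 A) :=
  h.comp (by simpa using tendsto_neg_nhdsGT (a := -a))

theorem norm_sq_value_le_left {u d s : ℝ → ℂ} {a h : ℝ} (hh : 0 < h)
    (hu : HasH1Deriv (Ioo (a - h) a) u d) (hd : HasH1Deriv (Ioo (a - h) a) d s) {A : ℂ}
    (hA : Tendsto u (𝓝[<] a) (𝓝 A)) :
    ‖A‖ ^ 2 ≤ 2 * h ^ 3 * (∫ x in Ioo (a - h) a, ‖s x‖ ^ 2) +
      32 / h * ∫ x in Ioo (a - h) a, ‖u x‖ ^ 2 := by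
  have e : -(a - h) = -a + h := by ring
  have hu' := hu.comp_neg_Ioo
  have hd' := hd.comp_neg_Ioo.neg
  rw [e] at hu' hd'
  have := norm_sq_value_le hh hu' (by simpa using hd') (tendsto_comp_neg_right hA)
  rw [setIntegral_Ioo_comp_neg (fun x => ‖s x‖ ^ 2),
    setIntegral_Ioo_comp_neg (fun x => ‖u x‖ ^ 2)] at this
  simpa [sub_eq_add_neg, add_comm] using this

/-! ### Functions with second derivatives off the interface points `-1`, `0`, `1` -/

theorem HasJump.unique {d : ℝ → ℂ} {o : ℝ} {c c' : ℂ} (h : HasJump d o c) (h' : HasJump d o c') :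
    c = c' := by
  obtain ⟨a, b, h1, h2, rfl⟩ := h
  obtain ⟨a', b', h1', h2', rfl⟩ := h'
  rw [tendsto_nhds_unique h1 h1', tendsto_nhds_unique h2 h2']

theorem HasJump.add {d e : ℝ → ℂ} {o : ℝ} {c c' : ℂ} (h : HasJump d o c) (h' : HasJump e o c') :
    HasJump (fun x => d x + e x) o (c + c') := by
  obtain ⟨a, b, h1, h2, rfl⟩ := h
  obtain ⟨a', b', h1', h2', rfl⟩ := h'
  exact ⟨_, _, h1.add h1', h2.add h2', by ring⟩

theorem HasJump.const_mul {d : ℝ → ℂ} {o : ℝ} {c : ℂ} (k : ℂ) (h : HasJump d o c) :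
    HasJump (fun x => k * d x) o (k * c) := by
  obtain ⟨a, b, h1, h2, rfl⟩ := h
  exact ⟨_, _, h1.const_mul k, h2.const_mul k, by ring⟩

theorem HasJump.conj {d : ℝ → ℂ} {o : ℝ} {c : ℂ} (h : HasJump d o c) :
    HasJump (fun x => (starRingEnd ℂ) (d x)) o ((starRingEnd ℂ) c) := by
  obtain ⟨a, b, h1, h2, rfl⟩ := h
  exact ⟨_, _, (Complex.continuous_conj.tendsto a).comp h1,
    (Complex.continuous_conj.tendsto b).comp h2, map_sub _ _ _⟩

theorem hasJump_of_continuousAt {d : ℝ → ℂ} {o : ℝ} (h : ContinuousAt d o) : HasJump d o 0 :=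
  ⟨d o, d o, h.tendsto.mono_left nhdsWithin_le_nhds, h.tendsto.mono_left nhdsWithin_le_nhds,
    (sub_self _).symm⟩

/-- `u ∈ H¹(ℝ)` with derivative `d`, and on each of the intervals between `-∞, -1, 0, 1, ∞` the
function `d` belongs to `H¹` and has the derivative `s`. -/
structure IsMode (u d s : ℝ → ℂ) : Prop where
  memH1 : HasH1Deriv univ u d
  left : HasH1Deriv (Iio (-1)) d s
  midLeft : HasH1Deriv (Ioo (-1) 0) d s
  midRight : HasH1Deriv (Ioo 0 1) d s
  right : HasH1Deriv (Ioi 1) d s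

theorem ae_mem_pieces : ∀ᵐ x : ℝ, x ∈ Iio (-1) ∪ Ioo (-1) 0 ∪ Ioo 0 1 ∪ Ioi (1 : ℝ) := by
  have h : ∀ a : ℝ, ∀ᵐ x : ℝ, x ≠ a := fun a => by simp [ae_iff]
  filter_upwards [h (-1), h 0, h 1] with x h1 h2 h3
  rcases lt_or_gt_of_ne h1 with h1 | h1
  · exact Or.inl (Or.inl (Or.inl h1))
  rcases lt_or_gt_of_ne h2 with h2 | h2
  · exact Or.inl (Or.inl (Or.inr ⟨h1, h2⟩))
  rcases lt_or_gt_of_ne h3 with h3 | h3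
  · exact Or.inl (Or.inr ⟨h2, h3⟩)
  · exact Or.inr h3

theorem volume_restrict_pieces : (volume : Measure ℝ) = volume.restrict (Iio (-1)) +
    volume.restrict (Ioo (-1) 0) + volume.restrict (Ioo 0 1) + volume.restrict (Ioi 1) := by
  rw [← Measure.restrict_union, ← Measure.restrict_union, ← Measure.restrict_union]
  · exact (Measure.restrict_eq_self_of_ae_mem ae_mem_pieces).symm
  · rw [Set.disjoint_left]; rintro x ((h | h) | h) h' <;> simp at h h' <;> linarith
  · exact measurableSet_Ioi
  · rw [Set.disjoint_left]; rintro x (h | h) h' <;> simp at h h' <;> linarith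
  · exact measurableSet_Ioo
  · rw [Set.disjoint_left]; rintro x h h'; simp at h h'; linarith
  · exact measurableSet_Ioo

theorem integral_eq_sum_pieces {f : ℝ → ℂ} (hf : Integrable f) :
    ∫ x, f x = (∫ x in Iio (-1), f x) + (∫ x in Ioo (-1) 0, f x) + (∫ x in Ioo 0 1, f x) +
      ∫ x in Ioi 1, f x := by
  conv_lhs => rw [volume_restrict_pieces]
  have h : ∀ I : Set ℝ, Integrable f (volume.restrict I) := fun I => hf.integrableOn
  rw [integral_add_measure (((h _).add_measure (h _)).add_measure (h _)) (h _),
    integral_add_measure ((h _).add_measure (h _)) (h _), integral_add_measure (h _) (h _)]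

theorem memLp_of_pieces {f : ℝ → ℂ} (h1 : MemLp f 2 (volume.restrict (Iio (-1))))
    (h2 : MemLp f 2 (volume.restrict (Ioo (-1) 0))) (h3 : MemLp f 2 (volume.restrict (Ioo 0 1)))
    (h4 : MemLp f 2 (volume.restrict (Ioi 1))) : MemLp f 2 volume := by
  have key : ∀ {μ ν : Measure ℝ}, MemLp f 2 μ → MemLp f 2 ν → MemLp f 2 (μ + ν) := by
    intro μ ν hμ hν
    have hm : AEStronglyMeasurable f (μ + ν) := by
      rw [aestronglyMeasurable_add_measure_iff]; exact ⟨hμ.1, hν.1⟩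
    rw [memLp_two_iff_integrable_sq_norm hm]
    exact ((memLp_two_iff_integrable_sq_norm hμ.1).1 hμ).add_measure
      ((memLp_two_iff_integrable_sq_norm hν.1).1 hν)
  rw [volume_restrict_pieces]
  exact key (key (key h1 h2) h3) h4

namespace IsMode

variable {u d s v e t : ℝ → ℂ}

theorem add (h : IsMode u d s) (h' : IsMode v e t) :
    IsMode (fun x => u x + v x) (fun x => d x + e x) (fun x => s x + t x) :=
  ⟨h.1.add ordConnected_univ h'.1, h.2.add ordConnected_Iio h'.2, h.3.add ordConnected_Ioo h'.3,
    h.4.add ordConnected_Ioo h'.4, h.5.add ordConnected_Ioi h'.5⟩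

theorem const_mul (c : ℂ) (h : IsMode u d s) :
    IsMode (fun x => c * u x) (fun x => c * d x) (fun x => c * s x) :=
  ⟨h.1.const_mul c, h.2.const_mul c, h.3.const_mul c, h.4.const_mul c, h.5.const_mul c⟩

theorem conj (h : IsMode u d s) : IsMode (fun x => (starRingEnd ℂ) (u x))
    (fun x => (starRingEnd ℂ) (d x)) (fun x => (starRingEnd ℂ) (s x)) :=
  ⟨h.1.conj, h.2.conj, h.3.conj, h.4.conj, h.5.conj⟩

theorem memLp (h : IsMode u d s) : MemLp u 2 volume := by simpa using h.1.1

theorem memLp_deriv (h : IsMode u d s) : MemLp d 2 volume := by simpa using h.1.2.1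

theorem memLp_snd (h : IsMode u d s) : MemLp s 2 volume :=
  memLp_of_pieces h.2.2.1 h.3.2.1 h.4.2.1 h.5.2.1

theorem continuous (h : IsMode u d s) : Continuous u := h.1.continuous

theorem exists_hasJump_zero (h : IsMode u d s) : ∃ c, HasJump d 0 c := by
  obtain ⟨-, b, -, hb⟩ := h.midLeft.exists_limits_Ioo (by norm_num)
  obtain ⟨a, -, ha, -⟩ := h.midRight.exists_limits_Ioo (by norm_num)
  exact ⟨_, a, b, ha, hb, rfl⟩

/-- Integration by parts on each of the four pieces; since v is continuous, the one-sided boundary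
terms combine into the jumps of d. -/
theorem integral_mul (h : IsMode u d s) (hv : HasH1Deriv univ v e) {j₁ j₂ j₃ : ℂ}
    (h₁ : HasJump d (-1) j₁) (h₂ : HasJump d 0 j₂) (h₃ : HasJump d 1 j₃) :
    ∫ x, (s x * v x + d x * e x) = -(j₁ * v (-1) + j₂ * v 0 + j₃ * v 1) := by
  obtain ⟨a₁, b₁, ha₁, hb₁, rfl⟩ := h₁
  obtain ⟨a₂, b₂, ha₂, hb₂, rfl⟩ := h₂
  obtain ⟨a₃, b₃, ha₃, hb₃, rfl⟩ := h₃
  have hv0 : MemLp v 2 volume := by simpa using hv.1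
  have he0 : MemLp e 2 volume := by simpa using hv.2.1
  have l : ∀ x (S : Set ℝ), Tendsto v (𝓝[S] x) (𝓝 (v x)) := fun x S =>
    hv.continuous.continuousWithinAt
  have hi : Integrable fun x => s x * v x + d x * e x :=
    (memLp_mul_integrable h.memLp_snd hv0).add (memLp_mul_integrable h.memLp_deriv he0)
  have hw : Integrable fun x => d x * v x := memLp_mul_integrable h.memLp_deriv hv0
  rw [integral_eq_sum_pieces hi,
    (h.2.mul ordConnected_Iio (hv.mono (subset_univ _))).integral_Iio hw.integrableOn
      (hb₁.mul (l _ _)),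
    (h.3.mul ordConnected_Ioo (hv.mono (subset_univ _))).integral_Ioo (by norm_num)
      (ha₁.mul (l _ _)) (hb₂.mul (l _ _)),
    (h.4.mul ordConnected_Ioo (hv.mono (subset_univ _))).integral_Ioo (by norm_num)
      (ha₂.mul (l _ _)) (hb₃.mul (l _ _)),
    (h.5.mul ordConnected_Ioi (hv.mono (subset_univ _))).integral_Ioi hw.integrableOn
      (ha₃.mul (l _ _))]
  ring

/-- Green's formula. -/
theorem integral_sub (h : IsMode u d s) (h' : IsMode v e t) {j₁ j₂ j₃ k₁ k₂ k₃ : ℂ}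
    (h₁ : HasJump d (-1) j₁) (h₂ : HasJump d 0 j₂) (h₃ : HasJump d 1 j₃)
    (h₁' : HasJump e (-1) k₁) (h₂' : HasJump e 0 k₂) (h₃' : HasJump e 1 k₃) :
    ∫ x, (u x * t x - s x * v x) = (j₁ * v (-1) - u (-1) * k₁) + (j₂ * v 0 - u 0 * k₂) +
      (j₃ * v 1 - u 1 * k₃) := by
  have i1 := h.integral_mul h'.1 h₁ h₂ h₃
  have i2 := h'.integral_mul h.1 h₁' h₂' h₃'
  have hi : Integrable fun x => s x * v x + d x * e x :=
    (memLp_mul_integrable h.memLp_snd h'.memLp).add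
      (memLp_mul_integrable h.memLp_deriv h'.memLp_deriv)
  have hi' : Integrable fun x => t x * u x + e x * d x :=
    (memLp_mul_integrable h'.memLp_snd h.memLp).add
      (memLp_mul_integrable h'.memLp_deriv h.memLp_deriv)
  have : ∀ x, u x * t x - s x * v x =
      (t x * u x + e x * d x) - (s x * v x + d x * e x) := fun x => by ring
  simp_rw [this]
  rw [MeasureTheory.integral_sub hi' hi, i1, i2]
  ring

end IsMode

/-! ### Hermite functions -/

open Polynomial in
theorem integrable_polynomial_mul_gaussian (p : ℝ[X]) :
    Integrable fun x : ℝ => p.eval x * Real.exp (-x ^ 2 / 2) := by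
  induction p using Polynomial.induction_on' with
  | add p q hp hq =>
    refine (hp.add hq).congr (Eventually.of_forall fun x => ?_)
    simp [add_mul]
  | monomial n a =>
    have := (integrable_rpow_mul_exp_neg_mul_sq (b := 1 / 2) (by norm_num) (s := n)
      (by have := n.cast_nonneg (α := ℝ); linarith)).const_mul a
    refine this.congr (Eventually.of_forall fun x => ?_)
    simp only [eval_monomial, Real.rpow_natCast, mul_assoc]
    congr 3
    ring

open Polynomial in
/-- The probabilists' Hermite polynomials with real coefficients. -/
def hermiteReal (n : ℕ) : ℝ[X] := (hermite n).map (Int.castRingHom ℝ)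

open Polynomial in
theorem hermiteReal_succ (n : ℕ) :
    hermiteReal (n + 1) = X * hermiteReal n - derivative (hermiteReal n) := by
  simp [hermiteReal, hermite_succ, derivative_map]

open Polynomial in
theorem hermiteReal_monic (n : ℕ) : (hermiteReal n).Monic := (hermite_monic n).map _

open Polynomial in
theorem natDegree_hermiteReal (n : ℕ) : (hermiteReal n).natDegree = n := by
  rw [hermiteReal, (hermite_monic n).natDegree_map, natDegree_hermite]

open Polynomial in
theorem hermiteFun_eq (n : ℕ) (q : ℝ) : hermiteFun n q =
    (√((n.factorial : ℝ) * √Real.pi))⁻¹ *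
      ((hermiteReal n).eval (√2 * q) * Real.exp (-(√2 * q) ^ 2 / 2) *
        Real.exp ((√2 * q) ^ 2 / 4)) := by
  rw [hermiteFun, hermiteReal, eval_map, aeval_def, mul_assoc, ← Real.exp_add]
  congr 4
  rw [mul_pow, Real.sq_sqrt (by norm_num)]; ring

-- Rodrigues' formula: He_{n+1} e^{-x²/2} is minus the derivative of He_n e^{-x²/2}, so each
-- integration by parts moves one derivative onto p.
open Polynomial in
theorem integral_polynomial_mul_hermite (p : ℝ[X]) (n : ℕ) :
    ∫ x : ℝ, (p * hermiteReal n).eval x * Real.exp (-x ^ 2 / 2) =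
      ∫ x : ℝ, (derivative^[n] p).eval x * Real.exp (-x ^ 2 / 2) := by
  induction n generalizing p with
  | zero => simp [hermiteReal]
  | succ n ih =>
    rw [Function.iterate_succ_apply, ← ih]
    have hd : ∀ x : ℝ, HasDerivAt (fun x => (hermiteReal n).eval x * Real.exp (-x ^ 2 / 2))
        (-((hermiteReal (n + 1)).eval x * Real.exp (-x ^ 2 / 2))) x := fun x => by
      have h1 : HasDerivAt (fun x : ℝ => -x ^ 2 / 2) (-x) x := by
        refine (((hasDerivAt_id x).pow 2).neg.div_const 2).congr_deriv ?_
        simp only [id]; push_cast; ring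
      refine (((hermiteReal n).hasDerivAt x).mul h1.exp).congr_deriv ?_
      rw [hermiteReal_succ]; simp; ring
    have := integral_mul_deriv_eq_deriv_mul_of_integrable (u := fun x => p.eval x)
      (u' := fun x => (derivative p).eval x) (fun x _ => p.hasDerivAt x) (fun x _ => hd x)
      ((integrable_polynomial_mul_gaussian (p * hermiteReal (n + 1))).neg.congr
        (Eventually.of_forall fun x => by simp; ring))
      ((integrable_polynomial_mul_gaussian (derivative p * hermiteReal n)).congr
        (Eventually.of_forall fun x => by simp; ring))
      ((integrable_polynomial_mul_gaussian (p * hermiteReal n)).congr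
        (Eventually.of_forall fun x => by simp; ring))
    simp only [mul_neg, integral_neg, neg_inj, ← mul_assoc] at this
    simpa [eval_mul] using this

-- For m < n the n-th derivative of He_m vanishes by degree; for m = n it is the constant m!,
-- because He_m is monic.
open Polynomial in
theorem integral_hermite_mul_hermite (m n : ℕ) :
    ∫ x : ℝ, (hermiteReal m * hermiteReal n).eval x * Real.exp (-x ^ 2 / 2) =
      if m = n then n.factorial * √(2 * Real.pi) else 0 := by
  have key : ∀ m n : ℕ, m < n →
      ∫ x : ℝ, (hermiteReal m * hermiteReal n).eval x * Real.exp (-x ^ 2 / 2) = 0 := by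
    intro m n h
    rw [integral_polynomial_mul_hermite,
      iterate_derivative_eq_zero (by rwa [natDegree_hermiteReal])]
    simp
  split_ifs with h
  · subst h
    rw [integral_polynomial_mul_hermite]
    have : derivative^[m] (hermiteReal m) = C (m.factorial : ℝ) := by
      ext k
      rw [coeff_iterate_derivative, coeff_C]
      split_ifs with hk
      · subst hk
        have h1 := (hermiteReal_monic m).coeff_natDegree
        rw [natDegree_hermiteReal] at h1
        simp [h1, Nat.descFactorial_self]
      · rw [coeff_eq_zero_of_natDegree_lt (by rw [natDegree_hermiteReal]; lia), smul_zero]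
    rw [this]
    simp only [eval_C, integral_const_mul]
    have := integral_gaussian (1 / 2)
    rw [show Real.pi / (1 / 2) = 2 * Real.pi by ring] at this
    rw [← this]
    congr 2
    ext x; ring_nf
  · rcases lt_or_gt_of_ne h with h | h
    · exact key m n h
    · rw [mul_comm]; exact key n m h

theorem continuous_hermiteFun (n : ℕ) : Continuous (hermiteFun n) := by
  have : hermiteFun n = fun q => (√((n.factorial : ℝ) * √Real.pi))⁻¹ *
      ((hermiteReal n).eval (√2 * q) * Real.exp (-(√2 * q) ^ 2 / 2) *
        Real.exp ((√2 * q) ^ 2 / 4)) := funext (hermiteFun_eq n)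
  rw [this]
  have := (hermiteReal n).continuous
  fun_prop

theorem hermiteFun_mul_hermiteFun (m n : ℕ) (q : ℝ) : hermiteFun m q * hermiteFun n q =
    ((√((m.factorial : ℝ) * √Real.pi))⁻¹ * (√((n.factorial : ℝ) * √Real.pi))⁻¹) *
      ((hermiteReal m * hermiteReal n).eval (√2 * q) * Real.exp (-(√2 * q) ^ 2 / 2)) := by
  have : Real.exp (-(√2 * q) ^ 2 / 2) * Real.exp ((√2 * q) ^ 2 / 4) *
      Real.exp ((√2 * q) ^ 2 / 4) = 1 := by
    rw [← Real.exp_add, ← Real.exp_add, Real.exp_eq_one_iff]; ring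
  rw [hermiteFun_eq, hermiteFun_eq, Polynomial.eval_mul]
  linear_combination ((√((m.factorial : ℝ) * √Real.pi))⁻¹ * (√((n.factorial : ℝ) * √Real.pi))⁻¹) *
      (((hermiteReal m).eval (√2 * q) * (hermiteReal n).eval (√2 * q)) *
        Real.exp (-(√2 * q) ^ 2 / 2)) * this

theorem integrable_hermiteFun_mul (m n : ℕ) :
    Integrable fun q => hermiteFun m q * hermiteFun n q := by
  simp_rw [hermiteFun_mul_hermiteFun]
  exact ((integrable_polynomial_mul_gaussian _).comp_mul_left' (by positivity)).const_mul _

theorem integral_hermiteFun_mul (m n : ℕ) :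
    ∫ q, hermiteFun m q * hermiteFun n q = if m = n then 1 else 0 := by
  simp_rw [hermiteFun_mul_hermiteFun]
  rw [integral_const_mul, Measure.integral_comp_mul_left
    (fun x => (hermiteReal m * hermiteReal n).eval x * Real.exp (-x ^ 2 / 2)),
    integral_hermite_mul_hermite]
  split_ifs with h
  · subst h
    rw [← mul_inv, Real.mul_self_sqrt (by positivity), abs_of_pos (by positivity), smul_eq_mul,
      Real.sqrt_mul (by norm_num)]
    have := m.factorial_pos
    field_simp
  · simp

open Polynomial in
/-- A linear condition on polynomials holds if it holds for the Hermite polynomials. -/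
theorem linearMap_eq_zero_of_hermite (L : ℝ[X] →ₗ[ℝ] ℂ) (h : ∀ n, L (hermiteReal n) = 0) (p : ℝ[X]) :
    L p = 0 := by
  suffices H : ∀ (n : ℕ) (p : ℝ[X]), p.degree < n → L p = 0 from
    H (p.natDegree + 1) p (degree_le_natDegree.trans_lt (by exact_mod_cast Nat.lt_succ_self _))
  intro n
  induction n with
  | zero =>
    intro p hp
    have : p = 0 := by
      rw [← degree_eq_bot]; by_contra h0
      rw [degree_eq_natDegree (by rintro rfl; simp at h0)] at hp
      exact absurd hp (by simp)
    simp [this]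
  | succ n ih =>
    intro p hp
    have h1 : p = C (p.coeff n) * hermiteReal n + (p - C (p.coeff n) * hermiteReal n) := by ring
    have h2 : (p - C (p.coeff n) * hermiteReal n).degree < n := by
      rw [degree_lt_iff_coeff_zero]
      intro k hk
      rw [coeff_sub, coeff_C_mul]
      rcases hk.eq_or_lt with rfl | hk
      · have h1 := (hermiteReal_monic n).coeff_natDegree
        rw [natDegree_hermiteReal] at h1
        simp [h1]
      · rw [coeff_eq_zero_of_natDegree_lt (p := hermiteReal n)
            (by rw [natDegree_hermiteReal]; exact hk),
          (degree_lt_iff_coeff_zero p (n + 1)).1 hp k hk]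
        simp
    rw [h1, map_add, ih _ h2, C_mul', map_smul, h n]
    simp

/-! ### Completeness of the Hermite functions of two variables -/

/-- An integrable function whose Fourier transform vanishes is zero. -/
theorem ae_eq_zero_of_forall_integral_exp_eq_zero {h : ℝ × ℝ → ℂ} (hh : Integrable h)
    (h0 : ∀ s t : ℝ, ∫ q : ℝ × ℝ, h q * Complex.exp ((s * q.1 + t * q.2 : ℝ) * Complex.I) = 0) :
    h =ᵐ[volume] 0 := by
  -- For real g, the positive and negative parts are densities of two finite measures with the same
  -- characteristic function, so the measures and hence the densities coincide.
  have real_case : ∀ g : ℝ × ℝ → ℝ, Integrable g → (∀ s t : ℝ, ∫ q : ℝ × ℝ,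
      (g q : ℂ) * Complex.exp ((s * q.1 + t * q.2 : ℝ) * Complex.I) = 0) → g =ᵐ[volume] 0 := by
    intro g hg hg0
    obtain ⟨g', hg'm, hgg'⟩ := hg.1
    have hg'i : Integrable g' := hg.congr hgg'
    have hm : Measurable g' := hg'm.measurable
    have hm' : Measurable fun x => -g' x := hm.neg
    have hfin : ∀ f : ℝ × ℝ → ℝ, Integrable f →
        IsFiniteMeasure (volume.withDensity fun x => ENNReal.ofReal (f x)) := fun f hf =>
      isFiniteMeasure_withDensity_ofReal hf.2
    have := hfin g' hg'i
    have := hfin (fun x => -g' x) hg'i.neg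
    have heq : (volume.withDensity fun x => ENNReal.ofReal (g' x)) =
        volume.withDensity fun x => ENNReal.ofReal (-g' x) := by
      refine Measure.ext_of_charFunDual (funext fun L => ?_)
      rw [charFunDual_apply, charFunDual_apply,
        integral_withDensity_eq_integral_toReal_smul hm.ennreal_ofReal
          (Eventually.of_forall fun _ => ENNReal.ofReal_lt_top),
        integral_withDensity_eq_integral_toReal_smul hm'.ennreal_ofReal
          (Eventually.of_forall fun _ => ENNReal.ofReal_lt_top), ← sub_eq_zero]
      have hbd : ∀ f : ℝ × ℝ → ℝ, Measurable f → Integrable f → Integrable fun q =>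
          (ENNReal.ofReal (f q)).toReal • Complex.exp ((L q : ℂ) * Complex.I) := by
        intro f hfm hf
        refine hf.abs.mono' ?_ (Eventually.of_forall fun q => ?_)
        · have : Continuous fun q : ℝ × ℝ => Complex.exp ((L q : ℂ) * Complex.I) := by fun_prop
          exact (hfm.ennreal_ofReal.ennreal_toReal.aestronglyMeasurable).smul
            this.aestronglyMeasurable
        · rw [norm_smul, Complex.norm_exp_ofReal_mul_I, mul_one, ENNReal.toReal_ofReal',
            Real.norm_of_nonneg (le_max_right _ _)]
          exact max_le (le_abs_self _) (abs_nonneg _)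
      rw [← integral_sub (hbd _ hm hg'i) (hbd _ hm' hg'i.neg), ← hg0 (L (1, 0)) (L (0, 1))]
      refine integral_congr_ae ?_
      filter_upwards [hgg'] with q hq
      have hL : L q = L (1, 0) * q.1 + L (0, 1) * q.2 := by
        have : q = q.1 • ((1 : ℝ), (0 : ℝ)) + q.2 • ((0 : ℝ), (1 : ℝ)) := by ext <;> simp
        conv_lhs => rw [this, map_add, map_smul, map_smul]
        simp [mul_comm]
      rw [← sub_smul, ← hL, hq, ENNReal.toReal_ofReal', ENNReal.toReal_ofReal']
      have : max (g' q) 0 - max (-g' q) 0 = g' q := by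
        rcases le_total 0 (g' q) with h | h
        · rw [max_eq_left h, max_eq_right (by linarith)]; ring
        · rw [max_eq_right h, max_eq_left (by linarith)]; ring
      rw [this, Complex.real_smul]
    rw [withDensity_eq_iff_of_sigmaFinite hm.ennreal_ofReal.aemeasurable
      hm'.ennreal_ofReal.aemeasurable] at heq
    filter_upwards [heq, hgg'] with q h1 h2
    rw [h2, Pi.zero_apply]
    have h3 := congrArg ENNReal.toReal h1
    simp only [ENNReal.toReal_ofReal'] at h3
    rcases le_total 0 (g' q) with h | h
    · rw [max_eq_left h, max_eq_right (by linarith)] at h3; exact h3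
    · rw [max_eq_right h, max_eq_left (by linarith)] at h3; linarith
  have hexp : ∀ s t : ℝ, Integrable fun q : ℝ × ℝ =>
      h q * Complex.exp ((s * q.1 + t * q.2 : ℝ) * Complex.I) := fun s t => by
    refine hh.mono (hh.1.mul (by fun_prop)) (Eventually.of_forall fun q => ?_)
    rw [norm_mul, Complex.norm_exp_ofReal_mul_I, mul_one]
  -- The transform of the conjugate also vanishes (replace (s, t) by (-s, -t) and conjugate), so the
  -- real and imaginary parts fall under the real case.
  have hconj : ∀ s t : ℝ, ∫ q : ℝ × ℝ,
      (starRingEnd ℂ) (h q) * Complex.exp ((s * q.1 + t * q.2 : ℝ) * Complex.I) = 0 := by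
    intro s t
    have := congrArg (starRingEnd ℂ) (h0 (-s) (-t))
    rw [← integral_conj, map_zero] at this
    rw [← this]
    congr 1
    ext q
    rw [map_mul, ← Complex.exp_conj, map_mul, Complex.conj_I, Complex.conj_ofReal]
    congr 2
    push_cast; ring
  have hci : Integrable fun q => (starRingEnd ℂ) (h q) :=
    hh.mono (Complex.continuous_conj.comp_aestronglyMeasurable hh.1)
      (Eventually.of_forall fun q => by simp)
  have hcexp : ∀ s t : ℝ, Integrable fun q : ℝ × ℝ =>
      (starRingEnd ℂ) (h q) * Complex.exp ((s * q.1 + t * q.2 : ℝ) * Complex.I) := fun s t => by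
    refine hci.mono (hci.1.mul (by fun_prop)) (Eventually.of_forall fun q => ?_)
    rw [norm_mul, Complex.norm_exp_ofReal_mul_I, mul_one]
  have hre := real_case (fun q => (h q).re) hh.re fun s t => by
    have : ∀ q : ℝ × ℝ, ((h q).re : ℂ) * Complex.exp ((s * q.1 + t * q.2 : ℝ) * Complex.I) =
        (1 / 2 : ℂ) * (h q * Complex.exp ((s * q.1 + t * q.2 : ℝ) * Complex.I) +
          (starRingEnd ℂ) (h q) * Complex.exp ((s * q.1 + t * q.2 : ℝ) * Complex.I)) := fun q => by
      rw [Complex.re_eq_add_conj]; ring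
    simp_rw [this]
    rw [integral_const_mul, integral_add (hexp s t) (hcexp s t), h0, hconj]; simp
  have him := real_case (fun q => (h q).im) hh.im fun s t => by
    have : ∀ q : ℝ × ℝ, ((h q).im : ℂ) * Complex.exp ((s * q.1 + t * q.2 : ℝ) * Complex.I) =
        (1 / (2 * Complex.I) : ℂ) * (h q * Complex.exp ((s * q.1 + t * q.2 : ℝ) * Complex.I) -
          (starRingEnd ℂ) (h q) * Complex.exp ((s * q.1 + t * q.2 : ℝ) * Complex.I)) := fun q => by
      rw [Complex.im_eq_sub_conj]; ring
    simp_rw [this]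
    rw [integral_const_mul, integral_sub (hexp s t) (hcexp s t), h0, hconj]; simp
  filter_upwards [hre, him] with q h1 h2
  exact Complex.ext h1 h2

/-- Supplies the dominating function for integrating the exponential series against a Gaussian. The
bound is 2|a||x| ≤ 2a² + x²/2. -/
theorem memLp_gaussian_exp (a b : ℝ) : MemLp (fun q : ℝ × ℝ =>
    Real.exp (-q.1 ^ 2 / 2 + |a * q.1|) * Real.exp (-q.2 ^ 2 / 2 + |b * q.2|)) 2 volume := by
  have h1 : ∀ a : ℝ, Integrable fun x : ℝ => Real.exp (-x ^ 2 / 2 + |a * x|) ^ 2 := by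
    intro a
    have := (integrable_exp_neg_mul_sq (b := 1 / 2) (by norm_num)).const_mul (Real.exp (2 * a ^ 2))
    refine this.mono' (by fun_prop) (Eventually.of_forall fun x => ?_)
    rw [Real.norm_of_nonneg (by positivity), ← Real.exp_nat_mul, ← Real.exp_add, Real.exp_le_exp]
    rw [abs_mul]
    push_cast
    nlinarith [sq_nonneg (2 * |a| - |x|), sq_abs a, sq_abs x]
  rw [memLp_two_iff_integrable_sq (by fun_prop)]
  simp_rw [mul_pow]
  exact (h1 a).mul_prod (h1 b)

open Polynomial in
theorem memLp_polynomial_mul_gaussian (p r : ℝ[X]) : MemLp (fun q : ℝ × ℝ =>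
    (p.eval (√2 * q.1) * Real.exp (-q.1 ^ 2 / 2)) *
      (r.eval (√2 * q.2) * Real.exp (-q.2 ^ 2 / 2))) 2 volume := by
  have h1 : ∀ p : ℝ[X], Integrable fun x : ℝ =>
      (p.eval (√2 * x) * Real.exp (-x ^ 2 / 2)) ^ 2 := by
    intro p
    refine ((integrable_polynomial_mul_gaussian (p * p)).comp_mul_left' (R := √2)
      (by positivity)).congr (Eventually.of_forall fun x => ?_)
    have : -(√2 * x) ^ 2 / 2 = -x ^ 2 / 2 + -x ^ 2 / 2 := by
      rw [mul_pow, Real.sq_sqrt (by norm_num)]; ring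
    simp only [eval_mul, this, Real.exp_add]
    ring
  have c := fun p : ℝ[X] => p.continuous
  have := c p
  have := c r
  rw [memLp_two_iff_integrable_sq (by fun_prop)]
  refine ((h1 p).mul_prod (h1 r)).congr (Eventually.of_forall fun q => ?_)
  simp only [mul_pow]

open Polynomial in
theorem integral_mul_polynomial_gaussian_eq_zero {g : ℝ × ℝ → ℂ} (hg : MemLp g 2 volume)
    (h0 : ∀ m n, ∫ q : ℝ × ℝ, g q * ((hermiteFun m q.1 * hermiteFun n q.2 : ℝ) : ℂ) = 0)
    (p r : ℝ[X]) : ∫ q : ℝ × ℝ, g q * (((p.eval (√2 * q.1) * Real.exp (-q.1 ^ 2 / 2)) *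
      (r.eval (√2 * q.2) * Real.exp (-q.2 ^ 2 / 2)) : ℝ) : ℂ) = 0 := by
  have hi : ∀ p r : ℝ[X], Integrable fun q : ℝ × ℝ => g q *
      (((p.eval (√2 * q.1) * Real.exp (-q.1 ^ 2 / 2)) *
      (r.eval (√2 * q.2) * Real.exp (-q.2 ^ 2 / 2)) : ℝ) : ℂ) := fun p r =>
    hg.integrable_mul (memLp_polynomial_mul_gaussian p r).ofReal
  let B : ℝ[X] →ₗ[ℝ] ℝ[X] →ₗ[ℝ] ℂ := LinearMap.mk₂ ℝ
    (fun p r => ∫ q : ℝ × ℝ, g q * (((p.eval (√2 * q.1) * Real.exp (-q.1 ^ 2 / 2)) *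
      (r.eval (√2 * q.2) * Real.exp (-q.2 ^ 2 / 2)) : ℝ) : ℂ))
    (fun p p' r => by
      rw [← integral_add (hi _ _) (hi _ _)]
      congr 1; ext q; simp only [eval_add]; push_cast; ring)
    (fun c p r => by
      rw [← integral_smul]
      congr 1; ext q; simp only [eval_smul, smul_eq_mul, Complex.real_smul]; push_cast; ring)
    (fun p r r' => by
      rw [← integral_add (hi _ _) (hi _ _)]
      congr 1; ext q; simp only [eval_add]; push_cast; ring)
    (fun c p r => by
      rw [← integral_smul]
      congr 1; ext q; simp only [eval_smul, smul_eq_mul, Complex.real_smul]; push_cast; ring)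
  have hB : ∀ m n, B (hermiteReal m) (hermiteReal n) = 0 := by
    intro m n
    have hc : ∀ n : ℕ, ((√((n.factorial : ℝ) * √Real.pi))⁻¹ : ℝ) ≠ 0 := fun n => by
      have := n.factorial_pos
      positivity
    have he : ∀ (n : ℕ) (x : ℝ), hermiteFun n x = (√((n.factorial : ℝ) * √Real.pi))⁻¹ *
        ((hermiteReal n).eval (√2 * x) * Real.exp (-x ^ 2 / 2)) := fun n x => by
      rw [hermiteFun, hermiteReal, eval_map, aeval_def]; rfl
    have := h0 m n
    simp_rw [he] at this
    have e : ∀ q : ℝ × ℝ, g q * (((√((m.factorial : ℝ) * √Real.pi))⁻¹ *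
        ((hermiteReal m).eval (√2 * q.1) * Real.exp (-q.1 ^ 2 / 2)) *
        ((√((n.factorial : ℝ) * √Real.pi))⁻¹ *
        ((hermiteReal n).eval (√2 * q.2) * Real.exp (-q.2 ^ 2 / 2))) : ℝ) : ℂ) =
        (((√((m.factorial : ℝ) * √Real.pi))⁻¹ * (√((n.factorial : ℝ) * √Real.pi))⁻¹ : ℝ) : ℂ) *
        (g q * ((((hermiteReal m).eval (√2 * q.1) * Real.exp (-q.1 ^ 2 / 2)) *
      ((hermiteReal n).eval (√2 * q.2) * Real.exp (-q.2 ^ 2 / 2)) : ℝ) : ℂ)) := fun q => by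
      push_cast; ring
    simp_rw [e] at this
    rw [integral_const_mul] at this
    exact (mul_eq_zero.1 this).resolve_left
      (Complex.ofReal_ne_zero.2 (mul_ne_zero (hc m) (hc n)))
  have h1 : ∀ p n, B p (hermiteReal n) = 0 := fun p n =>
    linearMap_eq_zero_of_hermite (B.flip (hermiteReal n)) (fun m => hB m n) p
  exact linearMap_eq_zero_of_hermite (B p) (h1 p) r

-- Orthogonality to all Hermite products means orthogonality to all polynomials times the Gaussian
-- γ. Expanding the character e^{i(s q₁ + t q₂)} in its power series, dominated by ‖g‖ γ e^{|s q₁ +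
-- t q₂|}, shows that the Fourier transform of g γ vanishes; so g γ = 0, and γ has no zeros.
open Polynomial in
theorem ae_eq_zero_of_forall_integral_hermiteFun {g : ℝ × ℝ → ℂ} (hg : MemLp g 2 volume)
    (h0 : ∀ m n, ∫ q : ℝ × ℝ, g q * ((hermiteFun m q.1 * hermiteFun n q.2 : ℝ) : ℂ) = 0) :
    g =ᵐ[volume] 0 := by
  set γ : ℝ × ℝ → ℝ := fun q => Real.exp (-q.1 ^ 2 / 2) * Real.exp (-q.2 ^ 2 / 2)
  have hpow : ∀ j k : ℕ, ∫ q : ℝ × ℝ, g q * ((q.1 ^ j * q.2 ^ k * γ q : ℝ) : ℂ) = 0 := by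
    intro j k
    rw [← integral_mul_polynomial_gaussian_eq_zero hg h0 ((C (√2)⁻¹ * X) ^ j) ((C (√2)⁻¹ * X) ^ k)]
    congr 1; ext q; congr 2
    simp only [eval_pow, eval_mul, eval_C, eval_X, γ]
    rw [inv_mul_cancel_left₀ (by positivity), inv_mul_cancel_left₀ (by positivity)]
    ring
  have hpi : ∀ j k : ℕ, Integrable fun q : ℝ × ℝ => g q * ((q.1 ^ j * q.2 ^ k * γ q : ℝ) : ℂ) := by
    intro j k
    have := memLp_polynomial_mul_gaussian ((C (√2)⁻¹ * X) ^ j) ((C (√2)⁻¹ * X) ^ k)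
    refine (hg.integrable_mul this.ofReal).congr (Eventually.of_forall fun q => ?_)
    simp only [eval_pow, eval_mul, eval_C, eval_X, γ]
    have h2 : √(2 : ℝ) ≠ 0 := by positivity
    simp_rw [inv_mul_cancel_left₀ h2]
    exact congrArg (fun z : ℝ => g q * (z : ℂ)) (mul_mul_mul_comm _ _ _ _)
  have hbin : ∀ (s t : ℝ) (n : ℕ), ∫ q : ℝ × ℝ, g q * (((s * q.1 + t * q.2) ^ n * γ q : ℝ) : ℂ)
      = 0 := by
    intro s t n
    have e : ∀ q : ℝ × ℝ, g q * (((s * q.1 + t * q.2) ^ n * γ q : ℝ) : ℂ) =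
        ∑ m ∈ Finset.range (n + 1), ((s ^ m * t ^ (n - m) * n.choose m : ℝ) : ℂ) *
          (g q * ((q.1 ^ m * q.2 ^ (n - m) * γ q : ℝ) : ℂ)) := fun q => by
      rw [add_pow, Finset.sum_mul, Complex.ofReal_sum, Finset.mul_sum]
      refine Finset.sum_congr rfl fun m _ => ?_
      rw [mul_pow, mul_pow]; push_cast; ring
    simp_rw [e]
    rw [integral_finsetSum _ fun m _ => (hpi _ _).const_mul _]
    refine Finset.sum_eq_zero fun m _ => ?_
    rw [integral_const_mul, hpow, mul_zero]
  have hγc : Continuous γ := by fun_prop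
  have hgγ : Integrable fun q => g q * (γ q : ℂ) := by simpa using hpi 0 0
  have hz := ae_eq_zero_of_forall_integral_exp_eq_zero hgγ fun s t => by
    have hs := hasSum_integral_of_dominated_convergence (μ := (volume : Measure (ℝ × ℝ)))
      (F := fun (n : ℕ) q => g q * (γ q : ℂ) *
        ((((s * q.1 + t * q.2 : ℝ) : ℂ) * Complex.I) ^ n / n.factorial))
      (f := fun q => g q * (γ q : ℂ) * Complex.exp ((s * q.1 + t * q.2 : ℝ) * Complex.I))
      (fun n q => ‖g q‖ * γ q * (|s * q.1 + t * q.2| ^ n / n.factorial))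
      (fun n => hgγ.1.mul (by fun_prop))
      (fun n => Eventually.of_forall fun q => by
        rw [norm_mul, norm_mul, norm_div, norm_pow, norm_mul, Complex.norm_real, Complex.norm_real,
          Complex.norm_I, mul_one, Complex.norm_natCast, Real.norm_eq_abs, Real.norm_eq_abs,
          abs_of_pos (show 0 < γ q by positivity)])
      (Eventually.of_forall fun q => (Real.summable_pow_div_factorial _).mul_left _)
      (by
        have e : ∀ q : ℝ × ℝ, ∑' n : ℕ, ‖g q‖ * γ q * (|s * q.1 + t * q.2| ^ n / n.factorial) =
            ‖g q‖ * γ q * Real.exp |s * q.1 + t * q.2| := fun q => by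
          rw [tsum_mul_left, Real.exp_eq_exp_ℝ, NormedSpace.exp_eq_tsum_div]
        simp_rw [e]
        refine (hg.norm.integrable_mul (memLp_gaussian_exp s t)).mono'
          ((hg.1.norm.mul (by fun_prop)).mul (by fun_prop)) (Eventually.of_forall fun q => ?_)
        rw [Real.norm_of_nonneg (by positivity)]
        simp only [Pi.mul_apply, γ, mul_assoc]
        refine mul_le_mul_of_nonneg_left ?_ (norm_nonneg _)
        rw [← Real.exp_add, ← Real.exp_add, ← Real.exp_add, Real.exp_le_exp]
        linarith [abs_add_le (s * q.1) (t * q.2)])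
      (Eventually.of_forall fun q => by
        refine HasSum.mul_left _ ?_
        rw [Complex.exp_eq_exp_ℂ]
        exact NormedSpace.expSeries_div_hasSum_exp _)
    refine hs.unique ?_
    convert! hasSum_zero using 2 with n
    have e : ∀ q : ℝ × ℝ, g q * (γ q : ℂ) *
        ((((s * q.1 + t * q.2 : ℝ) : ℂ) * Complex.I) ^ n / n.factorial) =
        (Complex.I ^ n / n.factorial) * (g q * (((s * q.1 + t * q.2) ^ n * γ q : ℝ) : ℂ)) :=
      fun q => by rw [mul_pow]; push_cast; ring
    simp_rw [e]
    rw [integral_const_mul, hbin, mul_zero]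
  filter_upwards [hz] with q hq
  have : (γ q : ℂ) ≠ 0 := Complex.ofReal_ne_zero.2 (by positivity)
  exact (mul_eq_zero.1 hq).resolve_right this

/-! ### The expansion in Hermite functions as an isometry -/

/-- The functions `χ_m ⊗ χ_n` of two variables. -/
def hermiteProd (p : ℕ × ℕ) (q : ℝ × ℝ) : ℂ := ((hermiteFun p.1 q.1 * hermiteFun p.2 q.2 : ℝ) : ℂ)

theorem continuous_hermiteProd (p : ℕ × ℕ) : Continuous (hermiteProd p) := by
  have h1 := continuous_hermiteFun p.1
  have h2 := continuous_hermiteFun p.2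
  unfold hermiteProd
  fun_prop

theorem integral_hermiteProd_mul (p p' : ℕ × ℕ) :
    ∫ q, hermiteProd p q * hermiteProd p' q = if p = p' then 1 else 0 := by
  have e : ∀ q : ℝ × ℝ, hermiteProd p q * hermiteProd p' q =
      ((hermiteFun p.1 q.1 * hermiteFun p'.1 q.1 : ℝ) : ℂ) *
        ((hermiteFun p.2 q.2 * hermiteFun p'.2 q.2 : ℝ) : ℂ) := fun q => by
    simp only [hermiteProd]; push_cast; ring
  simp_rw [e]
  rw [Measure.volume_eq_prod, integral_prod_mul (L := ℂ)
    (fun x : ℝ => ((hermiteFun p.1 x * hermiteFun p'.1 x : ℝ) : ℂ))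
    (fun x : ℝ => ((hermiteFun p.2 x * hermiteFun p'.2 x : ℝ) : ℂ)),
    integral_complex_ofReal, integral_complex_ofReal, integral_hermiteFun_mul,
    integral_hermiteFun_mul]
  by_cases h1 : p.1 = p'.1 <;> by_cases h2 : p.2 = p'.2 <;> simp [h1, h2, Prod.ext_iff]

theorem integrable_hermiteProd_sq (p : ℕ × ℕ) : Integrable fun q => ‖hermiteProd p q‖ ^ 2 := by
  refine ((integrable_hermiteFun_mul p.1 p.1).mul_prod (integrable_hermiteFun_mul p.2 p.2)).congr
    (Eventually.of_forall fun q => ?_)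
  simp only [hermiteProd, Complex.norm_real, Real.norm_eq_abs, sq_abs]
  ring

theorem memLp_tensor {f : ℝ → ℂ} (hf : MemLp f 2 volume) (p : ℕ × ℕ) :
    MemLp (fun z : ℝ × ℝ × ℝ => f z.1 * hermiteProd p z.2) 2 volume := by
  have hm : AEStronglyMeasurable (fun z : ℝ × ℝ × ℝ => f z.1 * hermiteProd p z.2) volume :=
    (hf.1.comp_fst (ν := (volume : Measure (ℝ × ℝ)))).mul
      ((continuous_hermiteProd p).comp continuous_snd).aestronglyMeasurable
  rw [memLp_two_iff_integrable_sq_norm hm]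
  refine (hf.norm.integrable_sq.mul_prod (integrable_hermiteProd_sq p)).congr
    (Eventually.of_forall fun z => ?_)
  simp only [norm_mul, mul_pow]

/-- The space of the coefficients. -/
abbrev L2R : Type := Lp ℂ 2 (volume : Measure ℝ)

/-- The map `f ↦ f ⊗ χ_m ⊗ χ_n`. -/
def tensorMap (p : ℕ × ℕ) : L2R →ₗ[ℂ] L2R3 where
  toFun f := (memLp_tensor (Lp.memLp f) p).toLp _
  map_add' f g := by
    rw [← MemLp.toLp_add, MemLp.toLp_eq_toLp_iff]
    have := (Measure.quasiMeasurePreserving_fst (μ := (volume : Measure ℝ))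
      (ν := (volume : Measure (ℝ × ℝ)))).ae (Lp.coeFn_add f g)
    filter_upwards [this] with z hz
    simp only [hz, Pi.add_apply]; ring
  map_smul' c f := by
    rw [RingHom.id_apply, ← MemLp.toLp_const_smul, MemLp.toLp_eq_toLp_iff]
    have := (Measure.quasiMeasurePreserving_fst (μ := (volume : Measure ℝ))
      (ν := (volume : Measure (ℝ × ℝ)))).ae (Lp.coeFn_smul c f)
    filter_upwards [this] with z hz
    simp only [hz, Pi.smul_apply, smul_eq_mul]; ring

theorem tensorMap_ae (p : ℕ × ℕ) (f : L2R) :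
    tensorMap p f =ᵐ[volume] fun z => f z.1 * hermiteProd p z.2 :=
  MemLp.coeFn_toLp (memLp_tensor (Lp.memLp f) p)

theorem conj_hermiteProd (p : ℕ × ℕ) (q : ℝ × ℝ) :
    (starRingEnd ℂ) (hermiteProd p q) = hermiteProd p q := Complex.conj_ofReal _

theorem inner_tensorMap (p p' : ℕ × ℕ) (f g : L2R) :
    inner ℂ (tensorMap p f) (tensorMap p' g) = if p = p' then inner ℂ f g else 0 := by
  rw [L2.inner_def, L2.inner_def]
  have : ∫ z, inner ℂ (tensorMap p f z) (tensorMap p' g z) =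
      ∫ z : ℝ × ℝ × ℝ, (inner ℂ (f z.1) (g z.1)) * (hermiteProd p z.2 * hermiteProd p' z.2) := by
    refine integral_congr_ae ?_
    filter_upwards [tensorMap_ae p f, tensorMap_ae p' g] with z h1 h2
    simp only [h1, h2, RCLike.inner_apply, map_mul, conj_hermiteProd]
    ring
  rw [this, Measure.volume_eq_prod, integral_prod_mul (L := ℂ) (fun x => inner ℂ (f x) (g x))
    (fun q => hermiteProd p q * hermiteProd p' q), integral_hermiteProd_mul]
  split_ifs <;> simp

/-- The isometry `f ↦ f ⊗ χ_m ⊗ χ_n`. -/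
def tensorIsometry (p : ℕ × ℕ) : L2R →ₗᵢ[ℂ] L2R3 where
  toLinearMap := tensorMap p
  norm_map' f := by
    have := inner_tensorMap p p f f
    rw [if_pos rfl, inner_self_eq_norm_sq_to_K, inner_self_eq_norm_sq_to_K] at this
    have h2 : ‖tensorMap p f‖ ^ 2 = ‖f‖ ^ 2 := by exact_mod_cast this
    exact (pow_left_inj₀ (norm_nonneg _) (norm_nonneg _) two_ne_zero).1 h2

theorem tensorIsometry_apply (p : ℕ × ℕ) (f : L2R) : tensorIsometry p f = tensorMap p f := rfl

theorem integrable_tensor_mul {f : ℝ → ℂ} (hf : MemLp f 2 volume) (p : ℕ × ℕ) {U : ℝ × ℝ × ℝ → ℂ}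
    (hU : MemLp U 2 volume) :
    Integrable fun z : ℝ × ℝ × ℝ => f z.1 * (U z * hermiteProd p z.2) :=
  ((memLp_tensor hf p).integrable_mul hU).congr
    (Eventually.of_forall fun z => by simp only [Pi.mul_apply]; ring)

theorem integral_mul_hermiteCoeff {f : ℝ → ℂ} (hf : MemLp f 2 volume) (p : ℕ × ℕ)
    {U : ℝ × ℝ × ℝ → ℂ} (hU : MemLp U 2 volume) :
    Integrable (fun x => f x * hermiteCoeff U p.1 p.2 x) ∧
    ∫ x, f x * hermiteCoeff U p.1 p.2 x =
      ∫ z : ℝ × ℝ × ℝ, f z.1 * (U z * hermiteProd p z.2) := by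
  have hi := integrable_tensor_mul hf p hU
  have e : ∀ x, ∫ q : ℝ × ℝ, f x * (U (x, q) * hermiteProd p q) =
      f x * hermiteCoeff U p.1 p.2 x := fun x => by
    rw [integral_const_mul]; rfl
  constructor
  · have := hi.integral_prod_left
    simp only [e] at this
    exact this
  · rw [Measure.volume_eq_prod, integral_prod _ hi]
    simp only [e]

/-- The coefficient `u_{m,n}` of an element of `L²(ℝ³)`, as an element of `L²(ℝ)`. -/
def coeff (p : ℕ × ℕ) : L2R3 →L[ℂ] L2R :=
  ContinuousLinearMap.adjoint (tensorIsometry p).toContinuousLinearMap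

/-- The slicewise integral and the adjoint of f ↦ f ⊗ χ_m ⊗ χ_n have, by Fubini, the same integral
over every set of finite measure. -/
theorem hermiteCoeff_ae (U : L2R3) (p : ℕ × ℕ) :
    hermiteCoeff U p.1 p.2 =ᵐ[volume] coeff p U := by
  have hind : ∀ (S : Set ℝ) (hS : MeasurableSet S) (hfin : volume S < ∞),
      MemLp (S.indicator fun _ => (1 : ℂ)) 2 volume := fun S hS hfin =>
    memLp_indicator_const 2 hS 1 (Or.inr hfin.ne)
  have hmul : ∀ (S : Set ℝ) (f : ℝ → ℂ) x, S.indicator (fun _ => (1 : ℂ)) x * f x =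
      S.indicator f x := fun S f x => by by_cases hx : x ∈ S <;> simp [hx]
  refine ae_eq_of_forall_setIntegral_eq_of_sigmaFinite ?_ ?_ ?_
  · intro S hS hfin
    have := (integral_mul_hermiteCoeff (hind S hS hfin) p (Lp.memLp U)).1
    simp only [hmul] at this
    exact (integrable_indicator_iff hS).1 this
  · intro S hS hfin
    have := (hind S hS hfin).integrable_mul (Lp.memLp (coeff p U))
    refine (integrable_indicator_iff hS).1 (this.congr (Eventually.of_forall fun x => ?_))
    exact hmul S _ x
  · intro S hS hfin
    have h1 := (integral_mul_hermiteCoeff (hind S hS hfin) p (Lp.memLp U)).2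
    simp only [hmul, integral_indicator hS] at h1
    rw [h1]
    set g : L2R := (hind S hS hfin).toLp _
    have hg : g =ᵐ[volume] S.indicator fun _ => (1 : ℂ) := MemLp.coeFn_toLp _
    have h2 : inner ℂ g (coeff p U) = inner ℂ (tensorMap p g) U := by
      rw [coeff, ContinuousLinearMap.adjoint_inner_right]; rfl
    rw [L2.inner_def, L2.inner_def] at h2
    have h3 : ∫ x, inner ℂ (g x) (coeff p U x) = ∫ x in S, coeff p U x := by
      rw [← integral_indicator hS]
      refine integral_congr_ae ?_
      filter_upwards [hg] with x hx
      rw [hx, RCLike.inner_apply, ← hmul, mul_comm]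
      by_cases hxS : x ∈ S <;> simp [hxS]
    rw [← h3, h2]
    refine integral_congr_ae ?_
    have hg' := (Measure.quasiMeasurePreserving_fst (μ := (volume : Measure ℝ))
      (ν := (volume : Measure (ℝ × ℝ)))).ae hg
    filter_upwards [tensorMap_ae p g, hg'] with z h4 h5
    rw [h4, h5, RCLike.inner_apply, map_mul, conj_hermiteProd]
    by_cases hzS : z.1 ∈ S <;> simp [hzS]

/-- For almost every x the slice U(x, ·) is square integrable and orthogonal to every Hermite
product, hence zero; countability of the index set allows a common null set. -/
theorem eq_zero_of_coeff_eq_zero {U : L2R3} (h : ∀ p, coeff p U = 0) : U = 0 := by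
  have h1 : ∀ᵐ x : ℝ, ∀ p : ℕ × ℕ, hermiteCoeff U p.1 p.2 x = 0 := by
    rw [ae_all_iff]
    intro p
    filter_upwards [hermiteCoeff_ae U p, h p ▸ Lp.coeFn_zero ℂ 2 (volume : Measure ℝ)] with x h2 h3
    rw [h2, h3]; rfl
  have hsm : StronglyMeasurable U := Lp.stronglyMeasurable U
  have h2 : ∀ᵐ x : ℝ, Integrable fun q : ℝ × ℝ => ‖U (x, q)‖ ^ 2 :=
    ((Lp.memLp U).norm.integrable_sq).prod_right_ae
  have h3 : ∀ᵐ x : ℝ, ∀ᵐ q : ℝ × ℝ, U (x, q) = 0 := by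
    filter_upwards [h1, h2] with x hx1 hx2
    have hm : MemLp (fun q : ℝ × ℝ => U (x, q)) 2 volume := by
      rw [memLp_two_iff_integrable_sq_norm]
      · exact hx2
      · exact (hsm.comp_measurable measurable_prodMk_left).aestronglyMeasurable
    exact ae_eq_zero_of_forall_integral_hermiteFun hm fun m n => hx1 (m, n)
  have h4 : ∀ᵐ z : ℝ × ℝ × ℝ, U z = 0 := by
    have hS : MeasurableSet {z : ℝ × ℝ × ℝ | U z = 0} :=
      hsm.measurable (measurableSet_singleton 0)
    exact (Measure.ae_prod_iff_ae_ae hS).2 h3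
  exact (Lp.eq_zero_iff_ae_eq_zero).2 h4

theorem isHilbertSum_tensorIsometry : IsHilbertSum ℂ (fun _ : ℕ × ℕ => L2R) tensorIsometry := by
  refine IsHilbertSum.mk (fun p p' hp f g => ?_) ?_
  · rw [tensorIsometry_apply, tensorIsometry_apply, inner_tensorMap, if_neg hp]
  · rw [top_le_iff, Submodule.topologicalClosure_eq_top_iff, eq_bot_iff]
    intro U hU
    refine eq_zero_of_coeff_eq_zero fun p => ?_
    refine ext_inner_left ℂ fun f => ?_
    rw [coeff, ContinuousLinearMap.adjoint_inner_right, inner_zero_right]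
    exact hU _ (Submodule.mem_iSup_of_mem p ⟨f, rfl⟩)

theorem linearIsometryEquiv_apply (U : L2R3) (p : ℕ × ℕ) :
    isHilbertSum_tensorIsometry.linearIsometryEquiv U p = coeff p U := by
  refine ext_inner_left ℂ fun f => ?_
  rw [coeff, ContinuousLinearMap.adjoint_inner_right]
  have h1 := lp.inner_single_left (𝕜 := ℂ) (G := fun _ : ℕ × ℕ => L2R) p f
    (isHilbertSum_tensorIsometry.linearIsometryEquiv U)
  change _ = inner ℂ (tensorIsometry p f) U
  rw [← h1, ← isHilbertSum_tensorIsometry.linearIsometryEquiv_symm_apply_single,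
    LinearIsometryEquiv.inner_map_eq_flip]
  simp

/-- Parseval's identity. -/
theorem hasSum_inner_coeff (U V : L2R3) :
    HasSum (fun p => inner ℂ (coeff p U) (coeff p V)) (inner ℂ U V) := by
  have := lp.hasSum_inner (𝕜 := ℂ) (isHilbertSum_tensorIsometry.linearIsometryEquiv U)
    (isHilbertSum_tensorIsometry.linearIsometryEquiv V)
  simpa only [linearIsometryEquiv_apply, LinearIsometryEquiv.inner_map_map] using this

theorem hasSum_norm_sq_coeff (U : L2R3) : HasSum (fun p => ‖coeff p U‖ ^ 2) (‖U‖ ^ 2) := by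
  have := hasSum_inner_coeff U U
  simp only [inner_self_eq_norm_sq_to_K] at this
  have h := Complex.hasSum_re this
  norm_cast at h

theorem norm_coeff_le (U : L2R3) (p : ℕ × ℕ) : ‖coeff p U‖ ≤ ‖U‖ := by
  have := le_hasSum (hasSum_norm_sq_coeff U) p fun _ _ => by positivity
  exact (pow_le_pow_iff_left₀ (norm_nonneg _) (norm_nonneg _) two_ne_zero).1 this

/-- The Riesz–Fischer theorem. -/
theorem exists_coeff_eq (w : ℕ × ℕ → L2R) (hw : Summable fun p => ‖w p‖ ^ 2) :
    ∃ U : L2R3, ∀ p, coeff p U = w p := by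
  have hm : Memℓp w 2 := by
    refine memℓp_gen ?_
    simpa using hw
  refine ⟨isHilbertSum_tensorIsometry.linearIsometryEquiv.symm ⟨w, hm⟩, fun p => ?_⟩
  rw [← linearIsometryEquiv_apply, LinearIsometryEquiv.apply_symm_apply]

/-! ### The graphs of the operators in terms of coefficients on the real line -/

/-- The coefficients of `U` are the functions `v p` with the derivatives `d p`, `s p`, and
`F` has the coefficients `L_p v_p`. -/
structure IsExpansion (νp νm : ℝ) (U F : L2R3) (v d s : ℕ × ℕ → ℝ → ℂ) : Prop where
  mode : ∀ p, IsMode (v p) (d p) (s p)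
  repr : ∀ p, v p =ᵐ[volume] coeff p U
  image : ∀ p, (fun x => -s p x + (rCoeff νp νm p.1 p.2 : ℂ) * v p x) =ᵐ[volume] coeff p F

/-- The condition at the point `0`: a Dirichlet condition or no condition. -/
def OriginCondition (dir : Bool) (v d s : ℕ × ℕ → ℝ → ℂ) : Prop :=
  match dir with
  | true => ∀ p, v p 0 = 0
  | false => ∀ p, HasH1Deriv (Ioo (-1) 1) (d p) (s p)

/-- The graph of `A_α` or of `A°_α`. -/
def opGraph (dir : Bool) (αp αm νp νm : ℝ) : Set (L2R3 × L2R3) :=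
  {P | ∃ v d s : ℕ × ℕ → ℝ → ℂ, IsExpansion νp νm P.1 P.2 v d s ∧
    MatchingPlus αp (fun m n => v (m, n)) (fun m n => d (m, n)) ∧
    MatchingMinus αm (fun m n => v (m, n)) (fun m n => d (m, n)) ∧ OriginCondition dir v d s}

theorem norm_sq_eq_integral {μ : Measure ℝ} (f : Lp ℂ 2 μ) : ‖f‖ ^ 2 = ∫ x, ‖f x‖ ^ 2 ∂μ := by
  have h := L2.inner_def (𝕜 := ℂ) f f
  simp only [inner_self_eq_norm_sq_to_K] at h
  have h2 : (∫ x, ((‖f x‖ : ℂ)) ^ 2 ∂μ) = ((∫ x, ‖f x‖ ^ 2 ∂μ : ℝ) : ℂ) := by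
    rw [← integral_complex_ofReal]; simp
  simp only [Complex.coe_algebraMap] at h
  rw [h2] at h
  exact_mod_cast h

theorem lintegral_enorm_sq_eq (f : L2R) : ∫⁻ x, ‖f x‖ₑ ^ 2 = ENNReal.ofReal (‖f‖ ^ 2) := by
  rw [norm_sq_eq_integral, ofReal_integral_eq_lintegral_ofReal (Lp.memLp f).norm.integrable_sq
    (Eventually.of_forall fun x => by positivity)]
  refine lintegral_congr fun x => ?_
  rw [ENNReal.ofReal_pow (norm_nonneg _), ofReal_norm]

/-- The finiteness of the sum of ‖L_p v_p‖² is automatic here: these are the coefficients of F, so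
Parseval's identity applies. -/
theorem IsExpansion.isAction {νp νm : ℝ} {U F : L2R3} {v d s : ℕ × ℕ → ℝ → ℂ}
    (h : IsExpansion νp νm U F v d s) (Ω : Set ℝ) (pieces : Set (Set ℝ))
    (hp : ∀ p, ∀ I ∈ pieces, HasH1Deriv I (d p) (s p)) :
    IsAction νp νm Ω pieces U F (fun m n => v (m, n)) (fun m n => d (m, n))
      (fun m n => s (m, n)) where
  rep m n := ae_restrict_of_ae ((h.repr (m, n)).trans (hermiteCoeff_ae U (m, n)).symm)
  memH1 m n := (h.mode (m, n)).1.mono (subset_univ _)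
  memH2 m n I hI := hp (m, n) I hI
  finite := by
    have hle : ∀ p : ℕ × ℕ, ∫⁻ x in Ω, ‖-s p x + (rCoeff νp νm p.1 p.2 : ℂ) * v p x‖ₑ ^ 2 ≤
        ENNReal.ofReal (‖coeff p F‖ ^ 2) := fun p => by
      rw [← lintegral_enorm_sq_eq]
      refine (lintegral_mono' Measure.restrict_le_self le_rfl).trans_eq ?_
      refine lintegral_congr_ae ?_
      filter_upwards [h.image p] with x hx
      rw [hx]
    refine (ENNReal.tsum_le_tsum hle).trans_lt ?_
    rw [← ENNReal.ofReal_tsum_of_nonneg (fun p => by positivity) (hasSum_norm_sq_coeff F).summable]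
    exact ENNReal.ofReal_lt_top
  image m n := ae_restrict_of_ae ((hermiteCoeff_ae F (m, n)).trans (h.image (m, n)).symm)

theorem opA_eq_opGraph (αp αm νp νm : ℝ) : opA αp αm νp νm = opGraph false αp αm νp νm := by
  ext ⟨U, F⟩
  constructor
  · rintro ⟨v, d, s, h, hP, hM⟩
    have hI : ∀ m n, HasH1Deriv (Ioo (-1) 1) (d m n) (s m n) := fun m n =>
      h.memH2 m n _ (by simp)
    refine ⟨fun p => v p.1 p.2, fun p => d p.1 p.2, fun p => s p.1 p.2, ⟨fun p => ?_, fun p => ?_,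
      fun p => ?_⟩, hP, hM, fun p => hI p.1 p.2⟩
    · exact ⟨h.memH1 p.1 p.2, h.memH2 p.1 p.2 _ (by simp),
        (hI p.1 p.2).mono (Ioo_subset_Ioo_right (by norm_num)),
        (hI p.1 p.2).mono (Ioo_subset_Ioo_left (by norm_num)), h.memH2 p.1 p.2 _ (by simp)⟩
    · have := h.rep p.1 p.2
      rw [Measure.restrict_univ] at this
      exact this.trans (hermiteCoeff_ae U p)
    · have := h.image p.1 p.2
      rw [Measure.restrict_univ] at this
      exact this.symm.trans (hermiteCoeff_ae F p)
  · rintro ⟨v, d, s, h, hP, hM, h0⟩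
    refine ⟨_, _, _, h.isAction univ _ fun p I hI => ?_, hP, hM⟩
    rcases hI with rfl | rfl | rfl
    · exact (h.mode p).left
    · exact h0 p
    · exact (h.mode p).right

/-- The function equal to `f` on the positive and to `g` on the negative half-line. -/
def glue (f g : ℝ → ℂ) (x : ℝ) : ℂ := if 0 < x then f x else if x < 0 then g x else 0

theorem glue_of_pos (f g : ℝ → ℂ) {x : ℝ} (hx : 0 < x) : glue f g x = f x := if_pos hx

theorem glue_of_neg (f g : ℝ → ℂ) {x : ℝ} (hx : x < 0) : glue f g x = g x := by
  rw [glue, if_neg hx.le.not_gt, if_pos hx]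

theorem volume_restrict_halves :
    (volume : Measure ℝ) = volume.restrict (Ioi 0) + volume.restrict (Iio 0) := by
  rw [← Measure.restrict_union _ measurableSet_Iio]
  · refine (Measure.restrict_eq_self_of_ae_mem ?_).symm
    have : ∀ᵐ x : ℝ, x ≠ 0 := by simp [ae_iff]
    filter_upwards [this] with x hx
    exact (lt_or_gt_of_ne hx).symm
  · rw [Set.disjoint_left]; intro x h h'; simp at h h'; linarith

theorem ae_of_halves {P : ℝ → Prop} (h : ∀ᵐ x ∂volume.restrict (Ioi (0 : ℝ)), P x)
    (h' : ∀ᵐ x ∂volume.restrict (Iio (0 : ℝ)), P x) : ∀ᵐ x, P x := by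
  rw [volume_restrict_halves, ae_add_measure_iff]; exact ⟨h, h'⟩

theorem memLp_glue {f g : ℝ → ℂ} (hf : MemLp f 2 (volume.restrict (Ioi 0)))
    (hg : MemLp g 2 (volume.restrict (Iio 0))) : MemLp (glue f g) 2 volume := by
  have hf' : MemLp (glue f g) 2 (volume.restrict (Ioi 0)) := hf.ae_eq (by
    filter_upwards [ae_restrict_mem measurableSet_Ioi] with x hx using (glue_of_pos f g hx).symm)
  have hg' : MemLp (glue f g) 2 (volume.restrict (Iio 0)) := hg.ae_eq (by
    filter_upwards [ae_restrict_mem measurableSet_Iio] with x hx using (glue_of_neg f g hx).symm)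
  rw [volume_restrict_halves]
  have hm : AEStronglyMeasurable (glue f g)
      (volume.restrict (Ioi (0 : ℝ)) + volume.restrict (Iio 0)) := by
    rw [aestronglyMeasurable_add_measure_iff]; exact ⟨hf'.1, hg'.1⟩
  rw [memLp_two_iff_integrable_sq_norm hm]
  exact ((memLp_two_iff_integrable_sq_norm hf'.1).1 hf').add_measure
    ((memLp_two_iff_integrable_sq_norm hg'.1).1 hg')

theorem HasH1Deriv.congr {I : Set ℝ} (hI : I.OrdConnected) {u d u' d' : ℝ → ℂ}
    (h : HasH1Deriv I u d) (hu : EqOn u u' I) (hd : EqOn d d' I) : HasH1Deriv I u' d' := by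
  refine ⟨h.1.ae_eq ?_, h.2.1.ae_eq ?_, fun x hx y hy => ?_⟩
  · filter_upwards [ae_restrict_mem hI.measurableSet] with x hx using hu hx
  · filter_upwards [ae_restrict_mem hI.measurableSet] with x hx using hd hx
  · rw [← hu hx, ← hu hy, h.2.2 x hx y hy]
    exact intervalIntegral.integral_congr fun t ht => hd (hI.uIcc_subset hx hy ht)

/-- The vanishing limits on both sides, and the value 0 that `glue` takes at the origin, make the
glued function the primitive of the glued derivative across 0; no point mass arises. -/
theorem hasH1Deriv_glue {f g f' g' : ℝ → ℂ} (hf : HasH1Deriv (Ioi 0) f f')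
    (hg : HasH1Deriv (Iio 0) g g') (hf0 : Tendsto f (𝓝[>] 0) (𝓝 0))
    (hg0 : Tendsto g (𝓝[<] 0) (𝓝 0)) : HasH1Deriv univ (glue f g) (glue f' g') := by
  have hd := memLp_glue hf.2.1 hg.2.1
  have hint : ∀ a b, IntervalIntegrable (glue f' g') volume a b := fun a b => by
    have hm := hd.mono_measure (Measure.restrict_le_self (s := uIcc a b))
    have : IsFiniteMeasure (volume.restrict (uIcc a b)) := ⟨by
      simp only [Measure.restrict_apply_univ]; exact isCompact_uIcc.measure_lt_top⟩
    have : IntegrableOn (glue f' g') (uIcc a b) := hm.integrable one_le_two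
    exact this.intervalIntegrable
  have hpos : ∀ x, 0 < x → glue f g x = ∫ t in 0..x, glue f' g' t := fun x hx => by
    have hfx : HasH1Deriv (Ioo 0 (x + 1)) f f' := hf.mono Ioo_subset_Ioi_self
    have key : Tendsto (fun y => f y + ∫ t in y..x, glue f' g' t) (𝓝[>] 0)
        (𝓝 (0 + ∫ t in 0..x, glue f' g' t)) := by
      refine hf0.add ?_
      have hc : Continuous fun y => ∫ t in x..y, glue f' g' t :=
        intervalIntegral.continuous_primitive hint x
      have hc' : Continuous fun y => ∫ t in y..x, glue f' g' t := by
        simp_rw [intervalIntegral.integral_symm x]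
        exact hc.neg
      exact hc'.continuousWithinAt
    have key2 : Tendsto (fun y => f y + ∫ t in y..x, glue f' g' t) (𝓝[>] 0) (𝓝 (f x)) := by
      refine tendsto_const_nhds.congr' ?_
      filter_upwards [self_mem_nhdsWithin] with y hy
      have e : ∫ t in y..x, glue f' g' t = ∫ t in y..x, f' t :=
        intervalIntegral.integral_congr fun t ht =>
          glue_of_pos _ _ (ordConnected_Ioi.uIcc_subset hy (mem_Ioi.2 hx) ht)
      rw [e, ← hf.2.2 y hy x hx]; ring
    rw [glue_of_pos _ _ hx, tendsto_nhds_unique key2 key, zero_add]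
  have hneg : ∀ x, x < 0 → glue f g x = ∫ t in 0..x, glue f' g' t := fun x hx => by
    have key : Tendsto (fun y => g y + ∫ t in y..x, glue f' g' t) (𝓝[<] 0)
        (𝓝 (0 + ∫ t in 0..x, glue f' g' t)) := by
      refine hg0.add ?_
      have hc : Continuous fun y => ∫ t in x..y, glue f' g' t :=
        intervalIntegral.continuous_primitive hint x
      have hc' : Continuous fun y => ∫ t in y..x, glue f' g' t := by
        simp_rw [intervalIntegral.integral_symm x]
        exact hc.neg
      exact hc'.continuousWithinAt
    have key2 : Tendsto (fun y => g y + ∫ t in y..x, glue f' g' t) (𝓝[<] 0) (𝓝 (g x)) := by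
      refine tendsto_const_nhds.congr' ?_
      filter_upwards [self_mem_nhdsWithin] with y hy
      have e : ∫ t in y..x, glue f' g' t = ∫ t in y..x, g' t :=
        intervalIntegral.integral_congr fun t ht =>
          glue_of_neg _ _ (ordConnected_Iio.uIcc_subset hy (mem_Iio.2 hx) ht)
      rw [e, ← hg.2.2 y hy x hx]; ring
    rw [glue_of_neg _ _ hx, tendsto_nhds_unique key2 key, zero_add]
  have hall : ∀ x, glue f g x = ∫ t in 0..x, glue f' g' t := fun x => by
    rcases lt_trichotomy x 0 with h | h | h
    · exact hneg x h
    · subst h; simp [glue]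
    · exact hpos x h
  refine ⟨by simpa using memLp_glue hf.1 hg.1, by simpa using hd, fun x _ y _ => ?_⟩
  rw [hall, hall]
  exact intervalIntegral.integral_interval_sub_left (hint 0 y) (hint 0 x)

theorem HasJump.congr {d e : ℝ → ℂ} {o : ℝ} {c : ℂ} (h : HasJump d o c) (hde : d =ᶠ[𝓝 o] e) :
    HasJump e o c := by
  obtain ⟨a, b, ha, hb, hc⟩ := h
  exact ⟨a, b, ha.congr' (hde.filter_mono nhdsWithin_le_nhds),
    hb.congr' (hde.filter_mono nhdsWithin_le_nhds), hc⟩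

theorem opACirc_eq_opGraph (αp αm νp νm : ℝ) :
    opACirc αp αm νp νm = opGraph true αp αm νp νm := by
  ext ⟨U, F⟩
  constructor
  · rintro ⟨⟨v, d, s, h, hP, h0⟩, ⟨v', d', s', h', hM, h0'⟩⟩
    have h01 : (0 : ℝ) < 1 := one_pos
    refine ⟨fun p => glue (v p.1 p.2) (v' p.1 p.2), fun p => glue (d p.1 p.2) (d' p.1 p.2),
      fun p => glue (s p.1 p.2) (s' p.1 p.2), ⟨fun p => ⟨?_, ?_, ?_, ?_, ?_⟩, fun p => ?_,
      fun p => ?_⟩, fun m n => ?_, fun m n => ?_, fun p => ?_⟩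
    · exact hasH1Deriv_glue (h.memH1 _ _) (h'.memH1 _ _) (h0 _ _) (h0' _ _)
    · exact (h'.memH2 p.1 p.2 _ (by simp)).congr ordConnected_Iio
        (fun x hx => (glue_of_neg _ _ (lt_trans hx (by norm_num))).symm)
        (fun x hx => (glue_of_neg _ _ (lt_trans hx (by norm_num))).symm)
    · exact (h'.memH2 p.1 p.2 (Ioo (-1) 0) (by simp)).congr ordConnected_Ioo
        (fun x hx => (glue_of_neg _ _ hx.2).symm) (fun x hx => (glue_of_neg _ _ hx.2).symm)
    · exact (h.memH2 p.1 p.2 (Ioo 0 1) (by simp)).congr ordConnected_Ioo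
        (fun x hx => (glue_of_pos _ _ hx.1).symm) (fun x hx => (glue_of_pos _ _ hx.1).symm)
    · exact (h.memH2 p.1 p.2 _ (by simp)).congr ordConnected_Ioi
        (fun x hx => (glue_of_pos _ _ (lt_trans h01 hx)).symm)
        (fun x hx => (glue_of_pos _ _ (lt_trans h01 hx)).symm)
    · refine EventuallyEq.trans ?_ (hermiteCoeff_ae U p)
      refine ae_of_halves ?_ ?_
      · filter_upwards [h.rep p.1 p.2, ae_restrict_mem measurableSet_Ioi] with x h1 h2
        rw [glue_of_pos _ _ h2, h1]
      · filter_upwards [h'.rep p.1 p.2, ae_restrict_mem measurableSet_Iio] with x h1 h2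
        rw [glue_of_neg _ _ h2, h1]
    · refine EventuallyEq.trans ?_ (hermiteCoeff_ae F p)
      refine ae_of_halves ?_ ?_
      · filter_upwards [h.image p.1 p.2, ae_restrict_mem measurableSet_Ioi] with x h1 h2
        rw [glue_of_pos _ _ h2, glue_of_pos _ _ h2, h1]
      · filter_upwards [h'.image p.1 p.2, ae_restrict_mem measurableSet_Iio] with x h1 h2
        rw [glue_of_neg _ _ h2, glue_of_neg _ _ h2, h1]
    · simp only [glue_of_pos _ _ h01]
      refine (hP m n).congr ?_
      filter_upwards [Ioi_mem_nhds h01] with x hx using (glue_of_pos _ _ hx).symm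
    · simp only [glue_of_neg _ _ (show (-1 : ℝ) < 0 by norm_num)]
      refine (hM m n).congr ?_
      filter_upwards [Iio_mem_nhds (show (-1 : ℝ) < 0 by norm_num)] with x hx
        using (glue_of_neg _ _ hx).symm
    · simp [glue]
  · rintro ⟨v, d, s, h, hP, hM, h0⟩
    have hc : ∀ p (S : Set ℝ), Tendsto (v p) (𝓝[S] 0) (𝓝 0) := fun p S => by
      have := ((h.mode p).continuous.continuousWithinAt (s := S) (x := 0)).tendsto
      rwa [h0 p] at this
    refine ⟨⟨_, _, _, h.isAction (Ioi 0) _ fun p I hI => ?_, hP,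
      fun m n => hc (m, n) _⟩, ⟨_, _, _, h.isAction (Iio 0) _ fun p I hI => ?_, hM,
      fun m n => hc (m, n) _⟩⟩
    · rcases hI with rfl | rfl
      · exact (h.mode p).midRight
      · exact (h.mode p).right
    · rcases hI with rfl | rfl
      · exact (h.mode p).left
      · exact (h.mode p).midLeft

/-! ### The boundary form of the coupled system -/

/-- The coupling `√(m+1) a_{m+1} + √m a_{m-1}`. -/
def coupling (a : ℕ → ℂ) (m : ℕ) : ℂ :=
  ((√(m + 1 : ℝ) : ℝ) : ℂ) * a (m + 1) + ((√(m : ℝ) : ℝ) : ℂ) * a (m - 1)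

theorem conj_coupling (a : ℕ → ℂ) (m : ℕ) :
    (starRingEnd ℂ) (coupling a m) = coupling (fun k => (starRingEnd ℂ) (a k)) m := by
  simp [coupling]

/-- The coupling matrix is symmetric and tridiagonal, so the sum telescopes and only the corner at N
survives. For N = 0 the truncated index N - 1 is harmless since √0 = 0. -/
theorem sum_coupling_sub (a b : ℕ → ℂ) (N : ℕ) :
    ∑ m ∈ Finset.range N, (coupling a m * b m - a m * coupling b m) =
      ((√(N : ℝ) : ℝ) : ℂ) * (a N * b (N - 1) - a (N - 1) * b N) := by
  induction N with
  | zero => simp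
  | succ N ih =>
    rw [Finset.sum_range_succ, ih, coupling, coupling]
    push_cast
    ring

theorem norm_sum_coupling_sub_le (a b : ℕ → ℂ) (N : ℕ) :
    ‖∑ m ∈ Finset.range N, (coupling a m * b m - a m * coupling b m)‖ ≤
      √(N : ℝ) * ((‖a N‖ ^ 2 + ‖b N‖ ^ 2) + (‖a (N - 1)‖ ^ 2 + ‖b (N - 1)‖ ^ 2)) := by
  rw [sum_coupling_sub, norm_mul, Complex.norm_real, Real.norm_of_nonneg (Real.sqrt_nonneg _)]
  refine mul_le_mul_of_nonneg_left ((norm_sub_le _ _).trans ?_) (Real.sqrt_nonneg _)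
  rw [norm_mul, norm_mul]
  nlinarith [sq_nonneg (‖a N‖ - ‖b (N - 1)‖), sq_nonneg (‖a (N - 1)‖ - ‖b N‖),
    sq_nonneg ‖a N‖, sq_nonneg ‖b N‖, sq_nonneg ‖a (N - 1)‖, sq_nonneg ‖b (N - 1)‖]

/-- The square root of `m + n + 1`. -/
def rootIndex (p : ℕ × ℕ) : ℝ := √((p.1 : ℝ) + p.2 + 1)

theorem one_le_rootIndex (p : ℕ × ℕ) : 1 ≤ rootIndex p := by
  rw [rootIndex, Real.one_le_sqrt]
  have h1 : (0 : ℝ) ≤ p.1 := Nat.cast_nonneg _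
  have h2 : (0 : ℝ) ≤ p.2 := Nat.cast_nonneg _
  linarith

theorem rootIndex_sq (p : ℕ × ℕ) : rootIndex p ^ 2 = (p.1 : ℝ) + p.2 + 1 :=
  Real.sq_sqrt (by positivity)

theorem rCoeff_le (νp νm : ℝ) (p : ℕ × ℕ) :
    rCoeff νp νm p.1 p.2 ≤ (νp ^ 2 + νm ^ 2) * rootIndex p ^ 2 := by
  rw [rCoeff, rootIndex_sq]
  have h1 : (0 : ℝ) ≤ p.1 := Nat.cast_nonneg _
  have h2 : (0 : ℝ) ≤ p.2 := Nat.cast_nonneg _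
  nlinarith [mul_nonneg (sq_nonneg νp) h2, mul_nonneg (sq_nonneg νm) h1, sq_nonneg νp,
    sq_nonneg νm]

theorem rCoeff_nonneg (νp νm : ℝ) (p : ℕ × ℕ) : 0 ≤ rCoeff νp νm p.1 p.2 := by
  rw [rCoeff]; positivity

/-- The interval length 1/k is the natural scale when r is of order k². Writing s = r u - (-s + r
u), the terms in u contribute (4c² + 32) k and the remaining one at most 4k, hence the constant 4c²
+ 36. -/
theorem norm_sq_trace_le_of_interval {u s : ℝ → ℂ} (hu : MemLp u 2 volume) (hs : MemLp s 2 volume)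
    {A : ℂ} {k r c : ℝ} (hk : 1 ≤ k) (hr0 : 0 ≤ r) (hr : r ≤ c * k ^ 2) (J : Set ℝ)
    (hA : ‖A‖ ^ 2 ≤ 2 * (1 / k) ^ 3 * (∫ x in J, ‖s x‖ ^ 2) + 32 / (1 / k) * ∫ x in J, ‖u x‖ ^ 2) :
    ‖A‖ ^ 2 ≤ (4 * c ^ 2 + 36) * k *
      ((∫ x, ‖u x‖ ^ 2) + ∫ x, ‖-s x + (r : ℂ) * u x‖ ^ 2) := by
  have hk0 : 0 < k := by linarith
  have iu : Integrable fun x => ‖u x‖ ^ 2 := hu.norm.integrable_sq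
  have is : Integrable fun x => ‖s x‖ ^ 2 := hs.norm.integrable_sq
  have hf : Integrable fun x => ‖-s x + (r : ℂ) * u x‖ ^ 2 :=
    (hs.neg.add (hu.const_mul (r : ℂ))).norm.integrable_sq
  have h1 : ∫ x in J, ‖u x‖ ^ 2 ≤ ∫ x, ‖u x‖ ^ 2 :=
    setIntegral_le_integral iu (Eventually.of_forall fun x => by positivity)
  have h2 : ∫ x in J, ‖s x‖ ^ 2 ≤ ∫ x, ‖s x‖ ^ 2 :=
    setIntegral_le_integral is (Eventually.of_forall fun x => by positivity)
  have h3 : ∫ x, ‖s x‖ ^ 2 ≤ 2 * r ^ 2 * (∫ x, ‖u x‖ ^ 2) +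
      2 * ∫ x, ‖-s x + (r : ℂ) * u x‖ ^ 2 := by
    rw [← integral_const_mul, ← integral_const_mul, ← integral_add (iu.const_mul _)
      (hf.const_mul _)]
    refine integral_mono is ((iu.const_mul _).add (hf.const_mul _)) fun x => ?_
    have e : ‖s x‖ ≤ r * ‖u x‖ + ‖-s x + (r : ℂ) * u x‖ := by
      have : s x = (r : ℂ) * u x - (-s x + (r : ℂ) * u x) := by ring
      calc ‖s x‖ = ‖(r : ℂ) * u x - (-s x + (r : ℂ) * u x)‖ := by rw [← this]
        _ ≤ ‖(r : ℂ) * u x‖ + ‖-s x + (r : ℂ) * u x‖ := norm_sub_le _ _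
        _ = _ := by rw [norm_mul, Complex.norm_real, Real.norm_of_nonneg hr0]
    have := pow_le_pow_left₀ (norm_nonneg _) e 2
    simp only
    nlinarith [sq_nonneg (r * ‖u x‖ - ‖-s x + (r : ℂ) * u x‖)]
  set P := ∫ x, ‖u x‖ ^ 2
  set Q := ∫ x, ‖-s x + (r : ℂ) * u x‖ ^ 2
  have hP : 0 ≤ P := integral_nonneg fun x => by positivity
  have hQ : 0 ≤ Q := integral_nonneg fun x => by positivity
  have hr2 : r ^ 2 ≤ c ^ 2 * k ^ 4 := by
    have := pow_le_pow_left₀ hr0 hr 2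
    nlinarith
  have i0 : (1 / k) ^ 3 * k ^ 4 = k := by field_simp
  have i1 : (1 / k) ^ 3 ≤ k := by
    have : 1 / k ≤ 1 := (div_le_one hk0).2 hk
    exact (pow_le_one₀ (by positivity) this).trans hk
  have i2 : 32 / (1 / k) = 32 * k := by field_simp
  calc ‖A‖ ^ 2 ≤ 2 * (1 / k) ^ 3 * (2 * r ^ 2 * P + 2 * Q) + 32 / (1 / k) * P := by
        refine hA.trans (add_le_add ?_ ?_)
        · exact mul_le_mul_of_nonneg_left (h2.trans h3) (by positivity)
        · exact mul_le_mul_of_nonneg_left h1 (by positivity)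
    _ ≤ 2 * (1 / k) ^ 3 * (2 * (c ^ 2 * k ^ 4) * P + 2 * Q) + 32 / (1 / k) * P := by gcongr
    _ = (4 * c ^ 2 * k + 32 * k) * P + 4 * ((1 / k) ^ 3) * Q := by
        rw [i2]; linear_combination (4 * c ^ 2 * P) * i0
    _ ≤ (4 * c ^ 2 * k + 32 * k) * P + 4 * k * Q := by gcongr
    _ ≤ _ := by
        nlinarith [mul_nonneg hk0.le hP, mul_nonneg hk0.le hQ,
          mul_nonneg (mul_nonneg (sq_nonneg c) hk0.le) hQ]

theorem IsMode.norm_sq_one_le {u d s : ℝ → ℂ} (h : IsMode u d s) {k r c : ℝ} (hk : 1 ≤ k)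
    (hr0 : 0 ≤ r) (hr : r ≤ c * k ^ 2) : ‖u 1‖ ^ 2 ≤ (4 * c ^ 2 + 36) * k *
      ((∫ x, ‖u x‖ ^ 2) + ∫ x, ‖-s x + (r : ℂ) * u x‖ ^ 2) :=
  norm_sq_trace_le_of_interval h.memLp h.memLp_snd hk hr0 hr _
    (norm_sq_value_le (a := 1) (by positivity) (h.1.mono (subset_univ _))
      (h.right.mono Ioo_subset_Ioi_self) h.continuous.continuousWithinAt)

theorem IsMode.norm_sq_neg_one_le {u d s : ℝ → ℂ} (h : IsMode u d s) {k r c : ℝ} (hk : 1 ≤ k)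
    (hr0 : 0 ≤ r) (hr : r ≤ c * k ^ 2) : ‖u (-1)‖ ^ 2 ≤ (4 * c ^ 2 + 36) * k *
      ((∫ x, ‖u x‖ ^ 2) + ∫ x, ‖-s x + (r : ℂ) * u x‖ ^ 2) :=
  norm_sq_trace_le_of_interval h.memLp h.memLp_snd hk hr0 hr _
    (norm_sq_value_le_left (a := -1) (by positivity) (h.1.mono (subset_univ _))
      (h.left.mono Ioo_subset_Iio_self) h.continuous.continuousWithinAt)

theorem norm_sq_eq_of_ae {f : L2R} {g : ℝ → ℂ} (h : g =ᵐ[volume] f) :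
    ∫ x, ‖g x‖ ^ 2 = ‖f‖ ^ 2 := by
  rw [norm_sq_eq_integral]
  exact integral_congr_ae (by filter_upwards [h] with x hx; rw [hx])

theorem IsExpansion.summable_trace {νp νm : ℝ} {U F : L2R3} {v d s : ℕ × ℕ → ℝ → ℂ}
    (h : IsExpansion νp νm U F v d s) : Summable (fun p => ‖v p 1‖ ^ 2 / rootIndex p) ∧
      Summable (fun p => ‖v p (-1)‖ ^ 2 / rootIndex p) := by
  set c := νp ^ 2 + νm ^ 2
  have hs : Summable fun p => (4 * c ^ 2 + 36) * (‖coeff p U‖ ^ 2 + ‖coeff p F‖ ^ 2) :=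
    ((hasSum_norm_sq_coeff U).summable.add (hasSum_norm_sq_coeff F).summable).mul_left _
  have hk : ∀ p, 0 < rootIndex p := fun p => one_pos.trans_le (one_le_rootIndex p)
  constructor
  · refine Summable.of_nonneg_of_le (fun p => div_nonneg (by positivity) (hk p).le)
      (fun p => ?_) hs
    rw [div_le_iff₀ (hk p)]
    have := (h.mode p).norm_sq_one_le (one_le_rootIndex p) (rCoeff_nonneg νp νm p)
      (rCoeff_le νp νm p)
    rw [norm_sq_eq_of_ae (h.repr p), norm_sq_eq_of_ae (h.image p)] at this
    linarith
  · refine Summable.of_nonneg_of_le (fun p => div_nonneg (by positivity) (hk p).le)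
      (fun p => ?_) hs
    rw [div_le_iff₀ (hk p)]
    have := (h.mode p).norm_sq_neg_one_le (one_le_rootIndex p) (rCoeff_nonneg νp νm p)
      (rCoeff_le νp νm p)
    rw [norm_sq_eq_of_ae (h.repr p), norm_sq_eq_of_ae (h.image p)] at this
    linarith

/-- If β_N ≥ ε eventually, then ρ_N ≥ ε / N eventually, against the divergence of the harmonic
series. -/
theorem frequently_lt_of_le_mul {ρ β : ℕ → ℝ} (hρ : Summable ρ)
    (h : ∀ N, 1 ≤ N → β N ≤ N * ρ N) {ε : ℝ} (hε : 0 < ε) : ∃ᶠ N in atTop, β N < ε := by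
  rw [Filter.Frequently]
  intro hev
  simp only [not_lt] at hev
  obtain ⟨N₀, hN₀⟩ := eventually_atTop.1 hev
  have : Summable fun N : ℕ => ε * (N : ℝ)⁻¹ := by
    refine (summable_nat_add_iff (N₀ + 1)).1 ?_
    refine Summable.of_nonneg_of_le (fun N => by positivity) (fun N => ?_)
      ((summable_nat_add_iff (N₀ + 1)).2 hρ)
    have h1 := hN₀ (N + (N₀ + 1)) (by lia)
    have h2 := h (N + (N₀ + 1)) (by lia)
    have h3 : (0 : ℝ) < ((N + (N₀ + 1) : ℕ) : ℝ) := by positivity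
    rw [← div_eq_mul_inv, div_le_iff₀ h3]
    linarith
  exact Real.not_summable_natCast_inv ((summable_mul_left_iff hε.ne').1 this)

/-- The sum of a nonnegative double sequence `q` along the edge of the box of size `N`, in the
first index, is controlled by a summable sequence if `∑ q_{mn} (m + n + 1)^{-1/2}` is finite. -/
theorem exists_summable_edge {q : ℕ × ℕ → ℝ} (h0 : ∀ p, 0 ≤ q p)
    (hq : Summable fun p => q p / rootIndex p) :
    ∃ ρ : ℕ → ℝ, Summable ρ ∧ ∀ N : ℕ, 1 ≤ N →
      √(N : ℝ) * ∑ n ∈ Finset.range N, (q (N, n) + q (N - 1, n)) ≤ N * ρ N := by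
  set σ : ℕ → ℝ := fun m => ∑' n, q (m, n) / rootIndex (m, n)
  have hσ : Summable σ := hq.prod
  have hrow : ∀ m, Summable fun n => q (m, n) / rootIndex (m, n) := fun m => hq.prod_factor m
  have hk : ∀ p, 0 < rootIndex p := fun p => one_pos.trans_le (one_le_rootIndex p)
  have hσ' : Summable fun N => σ (N - 1) :=
    (summable_nat_add_iff 1).1 (by simpa using hσ)
  refine ⟨fun N => √2 * (σ N + σ (N - 1)), (hσ.add hσ').mul_left _, fun N hN => ?_⟩
  have hN0 : (0 : ℝ) < N := by exact_mod_cast hN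
  -- On the edge, m + n + 1 ≤ 2N, so removing the weight costs √(2N) times the row sum σ m. The
  -- prefactor √N of the boundary form completes this to a factor N.
  have edge : ∀ m, m ≤ N → ∑ n ∈ Finset.range N, q (m, n) ≤ √(2 * N) * σ m := by
    intro m hm
    have h1 : ∀ n ∈ Finset.range N, q (m, n) ≤ √(2 * N) * (q (m, n) / rootIndex (m, n)) := by
      intro n hn
      have hn' := Finset.mem_range.1 hn
      have : rootIndex (m, n) ≤ √(2 * N) := by
        rw [rootIndex]
        refine Real.sqrt_le_sqrt ?_
        have : m + n + 1 ≤ 2 * N := by lia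
        exact_mod_cast this
      calc q (m, n) = rootIndex (m, n) * (q (m, n) / rootIndex (m, n)) := by
            rw [mul_div_cancel₀ _ (hk (m, n)).ne']
        _ ≤ _ := mul_le_mul_of_nonneg_right this (div_nonneg (h0 _) (hk _).le)
    refine (Finset.sum_le_sum h1).trans ?_
    rw [← Finset.mul_sum]
    exact mul_le_mul_of_nonneg_left ((hrow m).sum_le_tsum _ fun n _ =>
      div_nonneg (h0 _) (hk _).le) (Real.sqrt_nonneg _)
  rw [Finset.sum_add_distrib]
  calc √(N : ℝ) * (∑ n ∈ Finset.range N, q (N, n) + ∑ n ∈ Finset.range N, q (N - 1, n))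
      ≤ √(N : ℝ) * (√(2 * N) * σ N + √(2 * N) * σ (N - 1)) := by
        gcongr
        · exact edge N le_rfl
        · exact edge (N - 1) (by lia)
    _ = (√(N : ℝ) * √N) * (√2 * (σ N + σ (N - 1))) := by
        rw [Real.sqrt_mul (by norm_num)]; ring
    _ = _ := by rw [Real.mul_self_sqrt hN0.le]

theorem inner_coeff_eq {f g : L2R} {u v : ℝ → ℂ} (hu : u =ᵐ[volume] f) (hv : v =ᵐ[volume] g) :
    inner ℂ f g = ∫ x, (starRingEnd ℂ) (u x) * v x := by
  rw [L2.inner_def]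
  refine integral_congr_ae ?_
  filter_upwards [hu, hv] with x h1 h2
  rw [h1, h2, RCLike.inner_apply, mul_comm]

/-- Green's formula for the coupled system: the contributions of the interface points `±1` cancel,
and only those of the origin remain. -/
theorem IsExpansion.inner_sub_eq {αp αm νp νm : ℝ} {U F V G : L2R3}
    {v d s w e t : ℕ × ℕ → ℝ → ℂ} (h : IsExpansion νp νm U F v d s)
    (hP : MatchingPlus αp (fun m n => v (m, n)) (fun m n => d (m, n)))
    (hM : MatchingMinus αm (fun m n => v (m, n)) (fun m n => d (m, n)))
    (h' : IsExpansion νp νm V G w e t)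
    (hP' : MatchingPlus αp (fun m n => w (m, n)) (fun m n => e (m, n)))
    (hM' : MatchingMinus αm (fun m n => w (m, n)) (fun m n => e (m, n)))
    {j k : ℕ × ℕ → ℂ} (hj : ∀ p, HasJump (d p) 0 (j p)) (hk : ∀ p, HasJump (e p) 0 (k p))
    (hz : Summable fun p => (starRingEnd ℂ) (j p) * w p 0 - (starRingEnd ℂ) (v p 0) * k p) :
    inner ℂ U G - inner ℂ F V =
      -∑' p, ((starRingEnd ℂ) (j p) * w p 0 - (starRingEnd ℂ) (v p 0) * k p) := by
  set z : ℕ × ℕ → ℂ := fun p => (starRingEnd ℂ) (j p) * w p 0 - (starRingEnd ℂ) (v p 0) * k p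
  set D : ℕ × ℕ → ℂ := fun p => inner ℂ (coeff p U) (coeff p G) - inner ℂ (coeff p F) (coeff p V)
  set κp : ℂ := ((αp / √2 : ℝ) : ℂ)
  set κm : ℂ := ((αm / √2 : ℝ) : ℂ)
  set cv : ℕ × ℕ → ℝ → ℂ := fun p x => (starRingEnd ℂ) (v p x)
  set Bp : ℕ → ℕ → ℂ := fun n m => coupling (fun l => cv (l, n) 1) m * w (m, n) 1 -
    cv (m, n) 1 * coupling (fun l => w (l, n) 1) m
  set Bm : ℕ → ℕ → ℂ := fun m n => coupling (fun l => cv (m, l) (-1)) n * w (m, n) (-1) -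
    cv (m, n) (-1) * coupling (fun l => w (m, l) (-1)) n
  have conjκ : ∀ a : ℝ, (starRingEnd ℂ) (a : ℂ) = a := Complex.conj_ofReal
  -- Green's formula for one mode; the real numbers r_p cancel in D, and z carries the terms of the
  -- origin.
  have hmode : ∀ m n, D (m, n) + z (m, n) = -(κm * Bm m n + κp * Bp n m) := by
    intro m n
    have g := (h.mode (m, n)).conj.integral_sub (h'.mode (m, n)) (hM m n).conj (hj (m, n)).conj
      (hP m n).conj (hM' m n) (hk (m, n)) (hP' m n)
    have hDe : D (m, n) = -∫ x, ((starRingEnd ℂ) (v (m, n) x) * t (m, n) x -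
        (starRingEnd ℂ) (s (m, n) x) * w (m, n) x) := by
      simp only [D]
      rw [inner_coeff_eq (h.repr (m, n)) (h'.image (m, n)),
        inner_coeff_eq (h.image (m, n)) (h'.repr (m, n)), ← MeasureTheory.integral_sub,
        ← integral_neg]
      · congr 1
        ext x
        rw [map_add, map_neg, map_mul, conjκ]; ring
      · exact memLp_mul_integrable (memLp_conj (h.mode (m, n)).memLp)
          ((h'.mode (m, n)).memLp_snd.neg.add ((h'.mode (m, n)).memLp.const_mul _))
      · exact memLp_mul_integrable (memLp_conj
          ((h.mode (m, n)).memLp_snd.neg.add ((h.mode (m, n)).memLp.const_mul _)))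
          (h'.mode (m, n)).memLp
    rw [hDe, g]
    simp only [z, Bm, Bp, cv, κp, κm, coupling, map_mul, map_add, conjκ]
    ring
  have hbox : Tendsto (fun N => Finset.range N ×ˢ Finset.range N) atTop
      (atTop : Filter (Finset (ℕ × ℕ))) := by
    refine tendsto_atTop_finset_of_monotone (fun a b hab => ?_) fun p => ⟨p.1 + p.2 + 1, ?_⟩
    · exact Finset.product_subset_product (Finset.range_mono hab) (Finset.range_mono hab)
    · simp only [Finset.mem_product, Finset.mem_range]; lia
  have hlim : Tendsto (fun N => ∑ p ∈ Finset.range N ×ˢ Finset.range N, (D p + z p)) atTop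
      (𝓝 ((inner ℂ U G - inner ℂ F V) + ∑' p, z p)) :=
    (((hasSum_inner_coeff U G).sub (hasSum_inner_coeff F V)).add hz.hasSum).comp hbox
  suffices hzero : (inner ℂ U G - inner ℂ F V) + ∑' p, z p = 0 from
    eq_neg_of_add_eq_zero_left hzero
  obtain ⟨ρ, hρ, hρb⟩ := exists_summable_edge (q := fun p => ‖cv p 1‖ ^ 2 + ‖w p 1‖ ^ 2)
    (fun p => by positivity) (by
      simp only [cv, RCLike.norm_conj, add_div]
      exact h.summable_trace.1.add h'.summable_trace.1)
  -- At x = -1 the coupling runs in the second index, so the edge estimate is applied with the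
  -- indices swapped.
  obtain ⟨τ, hτ, hτb⟩ := exists_summable_edge
    (q := fun p => ‖cv p.swap (-1)‖ ^ 2 + ‖w p.swap (-1)‖ ^ 2) (fun p => by positivity) (by
      simp only [cv, RCLike.norm_conj, add_div]
      have hsw : ∀ p : ℕ × ℕ, rootIndex p = rootIndex p.swap := fun p => by
        simp only [rootIndex, Prod.fst_swap, Prod.snd_swap]; congr 1; ring
      refine ((h.summable_trace.2.add h'.summable_trace.2).comp_injective
        Prod.swap_injective).congr fun p => ?_
      rw [hsw p]; rfl)
  set β : ℕ → ℝ := fun N => ‖∑ p ∈ Finset.range N ×ˢ Finset.range N, (D p + z p)‖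
  have hβ : ∀ N, 1 ≤ N → β N ≤ N * (‖κm‖ * τ N + ‖κp‖ * ρ N) := by
    intro N hN
    have e1 : ∑ p ∈ Finset.range N ×ˢ Finset.range N, (D p + z p) =
        -(κm * ∑ m ∈ Finset.range N, ∑ n ∈ Finset.range N, Bm m n +
          κp * ∑ n ∈ Finset.range N, ∑ m ∈ Finset.range N, Bp n m) := by
      rw [Finset.sum_product]
      simp only [hmode, Finset.sum_neg_distrib, Finset.sum_add_distrib, Finset.mul_sum]
      congr 2
      exact Finset.sum_comm
    have e2 : ‖∑ m ∈ Finset.range N, ∑ n ∈ Finset.range N, Bm m n‖ ≤ N * τ N := by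
      refine (norm_sum_le _ _).trans (le_trans ?_ (hτb N hN))
      rw [Finset.mul_sum]
      exact Finset.sum_le_sum fun m _ => norm_sum_coupling_sub_le _ _ N
    have e3 : ‖∑ n ∈ Finset.range N, ∑ m ∈ Finset.range N, Bp n m‖ ≤ N * ρ N := by
      refine (norm_sum_le _ _).trans (le_trans ?_ (hρb N hN))
      rw [Finset.mul_sum]
      exact Finset.sum_le_sum fun n _ => norm_sum_coupling_sub_le _ _ N
    simp only [β]
    rw [e1, norm_neg]
    calc _ ≤ ‖κm‖ * (N * τ N) + ‖κp‖ * (N * ρ N) := by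
          refine (norm_add_le _ _).trans ?_
          rw [norm_mul, norm_mul]
          gcongr
      _ = _ := by ring
  have hfreq := fun ε (hε : (0 : ℝ) < ε) =>
    frequently_lt_of_le_mul ((hτ.mul_left ‖κm‖).add (hρ.mul_left ‖κp‖)) hβ hε
  -- The box sums converge, so smallness along infinitely many N already forces the limit to vanish.
  rw [← norm_le_zero_iff]
  refine le_of_forall_gt_imp_ge_of_dense fun ε hε => ?_
  exact le_of_tendsto_of_frequently hlim.norm ((hfreq ε hε).mono fun N hN => hN.le)

theorem OriginCondition.hasJump {v d s : ℕ × ℕ → ℝ → ℂ} (h : OriginCondition false v d s)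
    (p : ℕ × ℕ) : HasJump (d p) 0 0 := by
  have hI : (Ioo (-1 : ℝ) 1) ∈ 𝓝 (0 : ℝ) := Ioo_mem_nhds (by norm_num) (by norm_num)
  exact hasJump_of_continuousAt
    ((((h p).isPrimitiveOn_Ioo).continuousOn ordConnected_Ioo).continuousAt hI)

/-- The operators are symmetric. -/
theorem opGraph_symmetric {dir : Bool} {αp αm νp νm : ℝ} {U F V G : L2R3}
    (h : (U, F) ∈ opGraph dir αp αm νp νm) (h' : (V, G) ∈ opGraph dir αp αm νp νm) :
    inner ℂ U G = inner ℂ F V := by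
  obtain ⟨v, d, s, h, hP, hM, h0⟩ := h
  obtain ⟨w, e, t, h', hP', hM', h0'⟩ := h'
  choose j hj using fun p => (h.mode p).exists_hasJump_zero
  choose k hk using fun p => (h'.mode p).exists_hasJump_zero
  -- Each origin term contains a value at 0 and a jump at 0; the Dirichlet condition kills the
  -- values, smoothness across 0 kills the jumps.
  have hz : (fun p => (starRingEnd ℂ) (j p) * w p 0 - (starRingEnd ℂ) (v p 0) * k p) = 0 := by
    ext p
    cases dir with
    | true => simp [h0 p, h0' p]
    | false => simp [(hj p).unique (h0.hasJump p), (hk p).unique (h0'.hasJump p)]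
  have := h.inner_sub_eq hP hM h' hP' hM' hj hk (by rw [hz]; exact summable_zero)
  have hz' : ∑' p, ((starRingEnd ℂ) (j p) * w p 0 - (starRingEnd ℂ) (v p 0) * k p) = 0 := by
    rw [hz]; exact tsum_zero
  rwa [hz', neg_zero, sub_eq_zero] at this

/-! ### Solutions of `-u'' + k² u = f` on the real line -/

theorem intervalIntegrable_of_memLp {f : ℝ → ℂ} (hf : MemLp f 2 volume) (a b : ℝ) :
    IntervalIntegrable f volume a b := by
  have hm := hf.mono_measure (Measure.restrict_le_self (s := uIcc a b))
  have : IsFiniteMeasure (volume.restrict (uIcc a b)) := ⟨by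
    simp only [Measure.restrict_apply_univ]; exact isCompact_uIcc.measure_lt_top⟩
  have : IntegrableOn f (uIcc a b) := hm.integrable one_le_two
  exact this.intervalIntegrable

theorem intervalIntegral_conj (f : ℝ → ℂ) (a b : ℝ) :
    ∫ t in a..b, (starRingEnd ℂ) (f t) = (starRingEnd ℂ) (∫ t in a..b, f t) := by
  simp only [intervalIntegral, integral_conj, map_sub]

theorem integrable_conj {μ : Measure ℝ} {f : ℝ → ℂ} (hf : Integrable f μ) :
    Integrable (fun x => (starRingEnd ℂ) (f x)) μ :=
  hf.mono (Complex.continuous_conj.comp_aestronglyMeasurable hf.1)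
    (Eventually.of_forall fun x => by simp)

theorem norm_cexp_mul_ofReal (k : ℂ) (t : ℝ) : ‖Complex.exp (k * t)‖ = Real.exp (k.re * t) := by
  rw [Complex.norm_exp]; simp

theorem hasDerivAt_cexp_mul (k : ℂ) (x : ℝ) :
    HasDerivAt (fun t : ℝ => Complex.exp (k * t)) (k * Complex.exp (k * x)) x := by
  have h1 : HasDerivAt (fun t : ℝ => k * (t : ℂ)) k x := by
    simpa using (Complex.ofRealCLM.hasDerivAt (x := x)).const_mul k
  exact h1.cexp.congr_deriv (mul_comm _ _)

/-- The equation `p' + k p = f` has a solution in `H¹(ℝ)`. -/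
theorem exists_hasH1Deriv_sub {k : ℂ} (hk : 0 < k.re) {f : ℝ → ℂ} (hf : MemLp f 2 volume) :
    ∃ p, HasH1Deriv univ p fun x => f x - k * p x := by
  set g : ℝ → ℂ := fun t => Complex.exp (k * t) * f t
  have hexp : ∀ x : ℝ, MemLp (fun t : ℝ => Complex.exp (k * t)) 2 (volume.restrict (Iic x)) := by
    intro x
    rw [memLp_two_iff_integrable_sq_norm (by fun_prop)]
    refine (integrableOn_exp_mul_Iic (a := 2 * k.re) (by positivity) x).congr
      (Eventually.of_forall fun t => ?_)
    simp only [norm_cexp_mul_ofReal, ← Real.exp_nat_mul]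
    push_cast; ring_nf
  have hgi : ∀ x : ℝ, IntegrableOn g (Iic x) := fun x =>
    memLp_mul_integrable (hexp x) (hf.mono_measure Measure.restrict_le_self)
  -- Variation of constants: p(x) is the integral over t ≤ x of e^{-k (x - t)} f(t).
  set P : ℝ → ℂ := fun x => ∫ t in Iic x, g t
  set p : ℝ → ℂ := fun x => Complex.exp (-k * x) * P x
  have hP : ∀ x y, P y - P x = ∫ t in x..y, g t := fun x y =>
    intervalIntegral.integral_Iic_sub_Iic (hgi x) (hgi y)
  have hgii : ∀ x y, IntervalIntegrable g volume x y := fun x y =>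
    ((hgi (max x y)).mono_set fun t ht => ht.2).intervalIntegrable
  have hp : ∀ x y, p y - p x = ∫ t in x..y, (f t - k * p t) := by
    intro x y
    have hc : Continuous fun t : ℝ => -k * Complex.exp (-k * t) := by fun_prop
    have := mul_sub_mul_eq_integral (f := fun t : ℝ => Complex.exp (-k * t)) (h := P)
      (hc.intervalIntegrable x y) (hgii x y)
      (fun z _ => (intervalIntegral.integral_eq_sub_of_hasDerivAt
        (fun t _ => hasDerivAt_cexp_mul (-k) t) (hc.intervalIntegrable x z)).symm)
      (fun z _ => hP x z)
    simp only [p]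
    rw [this]
    refine intervalIntegral.integral_congr fun t _ => ?_
    have e : Complex.exp (-k * t) * Complex.exp (k * t) = 1 := by
      rw [← Complex.exp_add]; simp
    simp only [g]
    linear_combination f t * e
  have hPc : Continuous P := by
    have := (intervalIntegral.continuous_primitive hgii 0).const_add (P 0)
    refine this.congr fun x => ?_
    rw [← hP 0 x]; ring
  have hpc : Continuous p := by fun_prop
  have hfsq : Integrable fun x => ‖f x‖ ^ 2 := hf.norm.integrable_sq
  set M : ℝ := 1 / (2 * k.re) + ∫ x, ‖f x‖ ^ 2
  have hpM : ∀ x, ‖p x‖ ≤ M := by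
    intro x
    have e1 : p x = ∫ t in Iic x, Complex.exp (-k * x) * g t := (integral_const_mul _ _).symm
    have hie : IntegrableOn (fun t : ℝ => Real.exp (-(2 * k.re) * x) * Real.exp (2 * k.re * t))
        (Iic x) := (integrableOn_exp_mul_Iic (a := 2 * k.re) (by positivity) x).const_mul _
    rw [e1]
    refine (norm_integral_le_integral_norm _).trans ?_
    calc ∫ t in Iic x, ‖Complex.exp (-k * x) * g t‖
        ≤ ∫ t in Iic x, (Real.exp (-(2 * k.re) * x) * Real.exp (2 * k.re * t) + ‖f t‖ ^ 2) := by
          refine integral_mono (((hgi x).const_mul _).norm) (hie.add hfsq.integrableOn) fun t => ?_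
          simp only [g, norm_mul, norm_cexp_mul_ofReal, Complex.neg_re]
          have e2 : Real.exp (-(2 * k.re) * x) * Real.exp (2 * k.re * t) =
              (Real.exp (-k.re * x) * Real.exp (k.re * t)) ^ 2 := by
            rw [← Real.exp_add, ← Real.exp_add, ← Real.exp_nat_mul]; push_cast; ring_nf
          rw [e2]
          nlinarith [sq_nonneg (Real.exp (-k.re * x) * Real.exp (k.re * t) - ‖f t‖),
            sq_nonneg (Real.exp (-k.re * x) * Real.exp (k.re * t)), sq_nonneg ‖f t‖]
      _ = 1 / (2 * k.re) + ∫ t in Iic x, ‖f t‖ ^ 2 := by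
          rw [integral_add hie hfsq.integrableOn, integral_const_mul,
            integral_exp_mul_Iic (by positivity), ← mul_div_assoc, ← Real.exp_add]
          simp
      _ ≤ M := by
          exact add_le_add_right
            (setIntegral_le_integral hfsq (Eventually.of_forall fun x => by positivity)) _
  have hM : 0 ≤ M := (norm_nonneg _).trans (hpM 0)
  -- Integrating the derivative of |p|², with p' = f - k p, gives |p(b)|² - |p(a)|² ≤ ‖f‖²/Re k - Re
  -- k ∫ |p|². The uniform bound M controls |p(a)|, so the local L² norms stay bounded as the
  -- interval grows.
  have henergy : ∀ a b : ℝ, a ≤ b →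
      ∫ x in a..b, ‖‖p x‖ ^ 2‖ ≤ ((1 / k.re) * (∫ x, ‖f x‖ ^ 2) + M ^ 2) / k.re := by
    intro a b hab
    have hfi : IntervalIntegrable f volume a b :=
      intervalIntegrable_of_memLp hf a b
    have hdi : IntervalIntegrable (fun x => f x - k * p x) volume a b :=
      hfi.sub ((hpc.const_mul k).intervalIntegrable a b)
    have hdi' : IntervalIntegrable (fun x => (starRingEnd ℂ) (f x - k * p x)) volume a b :=
      ⟨integrable_conj hdi.1, integrable_conj hdi.2⟩
    have hpc' : Continuous fun x => (starRingEnd ℂ) (p x) := Complex.continuous_conj.comp hpc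
    have h1 := mul_sub_mul_eq_integral (f := p) (h := fun x => (starRingEnd ℂ) (p x)) hdi hdi'
      (fun z _ => hp a z) (fun z _ => by
        rw [← map_sub, hp a z, intervalIntegral_conj])
    have hΦ : IntervalIntegrable (fun t => (f t - k * p t) * (starRingEnd ℂ) (p t) +
        p t * (starRingEnd ℂ) (f t - k * p t)) volume a b :=
      (hdi.mul_continuousOn hpc'.continuousOn).add (hdi'.continuousOn_mul hpc.continuousOn)
    have h2 := congrArg Complex.re h1
    have h3 : ∫ x in a..b, ((f x - k * p x) * (starRingEnd ℂ) (p x) +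
        p x * (starRingEnd ℂ) (f x - k * p x)).re =
      (∫ x in a..b, ((f x - k * p x) * (starRingEnd ℂ) (p x) +
        p x * (starRingEnd ℂ) (f x - k * p x))).re := intervalIntegral.intervalIntegral_re hΦ
    rw [← h3] at h2
    have h4 : ∀ z : ℂ, (z * (starRingEnd ℂ) z).re = ‖z‖ ^ 2 := fun z => by
      rw [Complex.mul_conj, Complex.ofReal_re, Complex.normSq_eq_norm_sq]
    rw [Complex.sub_re, h4, h4] at h2
    have i1 : IntervalIntegrable (fun x => ‖f x‖ ^ 2) volume a b := hfsq.intervalIntegrable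
    have i2 : IntervalIntegrable (fun x => ‖p x‖ ^ 2) volume a b :=
      (hpc.norm.pow 2).intervalIntegrable a b
    have h5 : ∫ x in a..b, ((f x - k * p x) * (starRingEnd ℂ) (p x) +
        p x * (starRingEnd ℂ) (f x - k * p x)).re ≤
        ∫ x in a..b, ((1 / k.re) * ‖f x‖ ^ 2 - k.re * ‖p x‖ ^ 2) := by
      refine intervalIntegral.integral_mono_on hab ⟨hΦ.1.re, hΦ.2.re⟩
        ((i1.const_mul _).sub (i2.const_mul _)) fun x _ => ?_
      have e : ((f x - k * p x) * (starRingEnd ℂ) (p x) +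
          p x * (starRingEnd ℂ) (f x - k * p x)).re =
          2 * (f x * (starRingEnd ℂ) (p x)).re - 2 * k.re * ‖p x‖ ^ 2 := by
        rw [← Complex.normSq_eq_norm_sq, Complex.normSq_apply]
        simp; ring
      rw [e]
      have h6 : (f x * (starRingEnd ℂ) (p x)).re ≤ ‖f x‖ * ‖p x‖ := by
        refine (Complex.re_le_norm _).trans ?_
        rw [norm_mul, RCLike.norm_conj]
      have h7 : 2 * (‖f x‖ * ‖p x‖) ≤ 1 / k.re * ‖f x‖ ^ 2 + k.re * ‖p x‖ ^ 2 := by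
        have : 0 ≤ (1 / k.re) * (‖f x‖ - k.re * ‖p x‖) ^ 2 := by positivity
        have e7 : (1 / k.re) * (‖f x‖ - k.re * ‖p x‖) ^ 2 = 1 / k.re * ‖f x‖ ^ 2 +
          k.re * ‖p x‖ ^ 2 - 2 * (‖f x‖ * ‖p x‖) := by field_simp; ring
        linarith
      linarith
    rw [intervalIntegral.integral_sub (i1.const_mul _) (i2.const_mul _),
      intervalIntegral.integral_const_mul, intervalIntegral.integral_const_mul] at h5
    have h8 : ∫ x in a..b, ‖f x‖ ^ 2 ≤ ∫ x, ‖f x‖ ^ 2 := by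
      rw [intervalIntegral.integral_of_le hab]
      exact setIntegral_le_integral hfsq (Eventually.of_forall fun x => by positivity)
    have h9 : ‖p a‖ ^ 2 ≤ M ^ 2 := pow_le_pow_left₀ (norm_nonneg _) (hpM a) 2
    rw [le_div_iff₀ hk]
    simp only [norm_pow, norm_norm]
    have h10 : (1 / k.re) * ∫ x in a..b, ‖f x‖ ^ 2 ≤ (1 / k.re) * ∫ x, ‖f x‖ ^ 2 := by gcongr
    nlinarith [sq_nonneg ‖p b‖]
  have hpL : MemLp p 2 volume := by
    rw [memLp_two_iff_integrable_sq_norm hpc.aestronglyMeasurable]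
    refine integrable_of_intervalIntegral_norm_bounded (l := atTop) (a := fun n : ℕ => -(n : ℝ))
      (b := fun n : ℕ => (n : ℝ)) _ (fun n => ?_) ?_ tendsto_natCast_atTop_atTop
      (Eventually.of_forall fun n => henergy _ _ ?_)
    · exact ((hpc.norm.pow 2).integrableOn_Icc).mono_set Ioc_subset_Icc_self
    · exact tendsto_neg_atTop_atBot.comp tendsto_natCast_atTop_atTop
    · have : (0 : ℝ) ≤ n := n.cast_nonneg
      linarith
  exact ⟨p, by simpa using hpL, by
    rw [Measure.restrict_univ]; exact hf.sub (hpL.const_mul k), fun x _ y _ => hp x y⟩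

theorem exists_hasH1Deriv_add {k : ℂ} (hk : 0 < k.re) {f : ℝ → ℂ} (hf : MemLp f 2 volume) :
    ∃ q, HasH1Deriv univ q fun x => k * q x - f x := by
  obtain ⟨p, hp⟩ := exists_hasH1Deriv_sub hk
    (hf.comp_measurePreserving (Measure.measurePreserving_neg volume))
  refine ⟨fun x => p (-x), ?_⟩
  have := hp.comp_neg
  rw [preimage_univ] at this
  refine this.congr ordConnected_univ (fun x _ => rfl) fun x _ => ?_
  simp

/-- The equation `-u'' + k² u = f` has a solution in `H²(ℝ)`. -/
theorem exists_solution_line {k : ℂ} (hk : 0 < k.re) {f : ℝ → ℂ} (hf : MemLp f 2 volume) :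
    ∃ u d, HasH1Deriv univ u d ∧ HasH1Deriv univ d fun x => k ^ 2 * u x - f x := by
  -- Factorization -∂² + k² = (-∂ + k)(∂ + k): first -q' + k q = f, then u' + k u = q.
  obtain ⟨q, hq⟩ := exists_hasH1Deriv_add hk hf
  obtain ⟨u, hu⟩ := exists_hasH1Deriv_sub hk (f := q) (by simpa using hq.1)
  refine ⟨u, fun x => q x - k * u x, hu, ?_⟩
  have := hq.add ordConnected_univ (hu.const_mul (-k))
  refine this.congr ordConnected_univ (fun x _ => ?_) fun x _ => ?_ <;> ring

/-! ### Decaying exponentials -/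

theorem integrable_exp_neg_abs {c : ℝ} (hc : 0 < c) (o : ℝ) :
    Integrable fun x : ℝ => Real.exp (-c * |x - o|) := by
  have h : Integrable fun x : ℝ => Real.exp (-c * |x|) := by
    rw [← integrableOn_univ, ← Iic_union_Ioi (a := (0 : ℝ))]
    refine IntegrableOn.union ?_ ?_
    · refine (integrableOn_exp_mul_Iic hc 0).congr_fun (fun x hx => ?_) measurableSet_Iic
      simp only [abs_of_nonpos (mem_Iic.1 hx)]; ring_nf
    · refine (integrableOn_exp_mul_Ioi (neg_lt_zero.2 hc) 0).congr_fun (fun x hx => ?_)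
        measurableSet_Ioi
      simp only [abs_of_pos (mem_Ioi.1 hx)]
  exact h.comp_sub_right o

/-- The function `exp (-k |x - o|)`. -/
def decay (k : ℂ) (o x : ℝ) : ℂ := Complex.exp (-k * |x - o|)

/-- The derivative of `decay` off the point `o`. -/
def decayDeriv (k : ℂ) (o x : ℝ) : ℂ := if o < x then -k * decay k o x else k * decay k o x

theorem continuous_decay (k : ℂ) (o : ℝ) : Continuous (decay k o) := by
  unfold decay; fun_prop

theorem memLp_decay {k : ℂ} (hk : 0 < k.re) (o : ℝ) : MemLp (decay k o) 2 volume := by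
  rw [memLp_two_iff_integrable_sq_norm (continuous_decay k o).aestronglyMeasurable]
  refine (integrable_exp_neg_abs (c := 2 * k.re) (by positivity) o).congr
    (Eventually.of_forall fun x => ?_)
  simp only [decay, norm_cexp_mul_ofReal, ← Real.exp_nat_mul, Complex.neg_re]
  push_cast; ring_nf

theorem memLp_decayDeriv {k : ℂ} (hk : 0 < k.re) (o : ℝ) : MemLp (decayDeriv k o) 2 volume := by
  refine (memLp_decay hk o).of_le_mul (c := ‖k‖) ?_ (Eventually.of_forall fun x => ?_)
  · have := (continuous_decay k o).measurable
    exact (Measurable.ite measurableSet_Ioi (this.const_mul _)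
      (this.const_mul _)).aestronglyMeasurable
  · unfold decayDeriv
    split_ifs <;> simp

theorem hasDerivAt_decay_right (k : ℂ) {o x : ℝ} (hx : o < x) :
    HasDerivAt (decay k o) (-k * decay k o x) x := by
  have h1 := (hasDerivAt_cexp_mul (-k) x).const_mul (Complex.exp (k * o))
  have e : ∀ y, o < y → decay k o y = Complex.exp (k * o) * Complex.exp (-k * y) := fun y hy => by
    rw [decay, abs_of_pos (sub_pos.2 hy), ← Complex.exp_add]; push_cast; ring_nf
  refine (h1.congr_of_eventuallyEq ?_).congr_deriv ?_
  · filter_upwards [Ioi_mem_nhds hx] with y hy using e y hy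
  · rw [e x hx]; ring

theorem hasDerivAt_decay_left (k : ℂ) {o x : ℝ} (hx : x < o) :
    HasDerivAt (decay k o) (k * decay k o x) x := by
  have h1 := (hasDerivAt_cexp_mul k x).const_mul (Complex.exp (-k * o))
  have e : ∀ y, y < o → decay k o y = Complex.exp (-k * o) * Complex.exp (k * y) := fun y hy => by
    rw [decay, abs_of_neg (sub_neg.2 hy), ← Complex.exp_add]; push_cast; ring_nf
  refine (h1.congr_of_eventuallyEq ?_).congr_deriv ?_
  · filter_upwards [Iio_mem_nhds hx] with y hy using e y hy
  · rw [e x hx]; ring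

theorem hasDerivAt_decay (k : ℂ) {o x : ℝ} (hx : x ≠ o) :
    HasDerivAt (decay k o) (decayDeriv k o x) x := by
  rcases lt_or_gt_of_ne hx with h | h
  · rw [decayDeriv, if_neg h.not_gt]; exact hasDerivAt_decay_left k h
  · rw [decayDeriv, if_pos h]; exact hasDerivAt_decay_right k h

theorem hasDerivAt_decayDeriv (k : ℂ) {o x : ℝ} (hx : x ≠ o) :
    HasDerivAt (decayDeriv k o) (k ^ 2 * decay k o x) x := by
  rcases lt_or_gt_of_ne hx with h | h
  · refine (((hasDerivAt_decay_left k h).const_mul k).congr_of_eventuallyEq ?_).congr_deriv (by ring)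
    filter_upwards [Iio_mem_nhds h] with y hy
    rw [decayDeriv, if_neg (not_lt_of_gt hy)]
  · refine (((hasDerivAt_decay_right k h).const_mul (-k)).congr_of_eventuallyEq ?_).congr_deriv
      (by ring)
    filter_upwards [Ioi_mem_nhds h] with y hy
    rw [decayDeriv, if_pos (mem_Ioi.1 hy)]

theorem hasH1Deriv_decay {k : ℂ} (hk : 0 < k.re) (o : ℝ) :
    HasH1Deriv univ (decay k o) (decayDeriv k o) := by
  refine ⟨by simpa using memLp_decay hk o, by simpa using memLp_decayDeriv hk o,
    fun x _ y _ => ?_⟩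
  refine (integral_eq_of_hasDerivAt_off_countable (decay k o) (decayDeriv k o)
    (countable_singleton o) (continuous_decay k o).continuousOn
    (fun z hz => hasDerivAt_decay k hz.2) ?_).symm
  exact intervalIntegrable_of_memLp (memLp_decayDeriv hk o) x y

theorem hasH1Deriv_decayDeriv {k : ℂ} (hk : 0 < k.re) {o : ℝ} {I : Set ℝ} (hI : I.OrdConnected)
    (ho : o ∉ I) : HasH1Deriv I (decayDeriv k o) fun x => k ^ 2 * decay k o x := by
  refine ⟨(memLp_decayDeriv hk o).mono_measure Measure.restrict_le_self,
    ((memLp_decay hk o).const_mul _).mono_measure Measure.restrict_le_self, fun x hx y hy => ?_⟩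
  refine (intervalIntegral.integral_eq_sub_of_hasDerivAt (fun z hz => hasDerivAt_decayDeriv k ?_)
    (((continuous_decay k o).const_mul _).intervalIntegrable _ _)).symm
  rintro rfl
  exact ho (hI.uIcc_subset hx hy hz)

theorem isMode_decay {k : ℂ} (hk : 0 < k.re) {o : ℝ} (ho : o = -1 ∨ o = 0 ∨ o = 1) :
    IsMode (decay k o) (decayDeriv k o) fun x => k ^ 2 * decay k o x := by
  refine ⟨hasH1Deriv_decay hk o, hasH1Deriv_decayDeriv hk ordConnected_Iio ?_,
    hasH1Deriv_decayDeriv hk ordConnected_Ioo ?_, hasH1Deriv_decayDeriv hk ordConnected_Ioo ?_,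
    hasH1Deriv_decayDeriv hk ordConnected_Ioi ?_⟩ <;>
  · rcases ho with rfl | rfl | rfl <;> norm_num

theorem decay_self (k : ℂ) (o : ℝ) : decay k o o = 1 := by simp [decay]

theorem hasJump_decayDeriv (k : ℂ) (o : ℝ) : HasJump (decayDeriv k o) o (-2 * k) := by
  have hc := fun S => ((continuous_decay k o).continuousWithinAt (s := S) (x := o)).tendsto
  simp only [decay_self] at hc
  refine ⟨-k * 1, k * 1, ((hc _).const_mul _).congr' ?_, ((hc _).const_mul _).congr' ?_, by ring⟩
  · filter_upwards [self_mem_nhdsWithin] with x hx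
    rw [decayDeriv, if_pos (mem_Ioi.1 hx)]
  · filter_upwards [self_mem_nhdsWithin] with x hx
    rw [decayDeriv, if_neg (not_lt_of_gt hx)]

theorem hasJump_decayDeriv_of_ne (k : ℂ) {o x : ℝ} (hx : x ≠ o) :
    HasJump (decayDeriv k o) x 0 :=
  hasJump_of_continuousAt (hasDerivAt_decayDeriv k hx).continuousAt

/-! ### Solutions for a single mode -/

theorem exists_sq_eq_of_im_ne_zero {z : ℂ} (hz : z.im ≠ 0) : ∃ k : ℂ, 0 < k.re ∧ k ^ 2 = z := by
  obtain ⟨k, hk⟩ := IsAlgClosed.exists_pow_nat_eq z (n := 2) (by norm_num)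
  have hre : k.re ≠ 0 := by
    intro h
    apply hz
    rw [← hk, sq, Complex.mul_im, h]; ring
  rcases lt_or_gt_of_ne hre with h | h
  · exact ⟨-k, by simpa using h, by rw [neg_sq, hk]⟩
  · exact ⟨k, h, hk⟩

/-- The condition at the point `0` for a single coefficient. -/
def OriginMode (dir : Bool) (u d s : ℝ → ℂ) : Prop :=
  match dir with
  | true => u 0 = 0
  | false => HasH1Deriv (Ioo (-1) 1) d s

theorem originCondition_of_originMode {dir : Bool} {v d s : ℕ × ℕ → ℝ → ℂ}
    (h : ∀ p, OriginMode dir (v p) (d p) (s p)) : OriginCondition dir v d s := by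
  cases dir <;> exact h

/-- `u` solves `-u'' + μ u = f`, and `u'` has the jumps `a` at `-1` and `b` at `1`. -/
structure IsModeSol (dir : Bool) (μ : ℂ) (f : ℝ → ℂ) (a b : ℂ) (u d s : ℝ → ℂ) : Prop where
  mode : IsMode u d s
  eq : ∀ x, -s x + μ * u x = f x
  jumpNeg : HasJump d (-1) a
  jumpPos : HasJump d 1 b
  origin : OriginMode dir u d s

namespace IsModeSol

variable {dir : Bool} {μ : ℂ} {f g : ℝ → ℂ} {a b a' b' : ℂ} {u d s u' d' s' : ℝ → ℂ}

theorem add (h : IsModeSol dir μ f a b u d s) (h' : IsModeSol dir μ g a' b' u' d' s') :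
    IsModeSol dir μ (fun x => f x + g x) (a + a') (b + b') (fun x => u x + u' x)
      (fun x => d x + d' x) (fun x => s x + s' x) where
  mode := h.mode.add h'.mode
  eq x := by rw [← h.eq x, ← h'.eq x]; ring
  jumpNeg := h.jumpNeg.add h'.jumpNeg
  jumpPos := h.jumpPos.add h'.jumpPos
  origin := by
    have h1 := h.origin
    have h2 := h'.origin
    cases dir with
    | true => simp only [OriginMode] at *; rw [h1, h2, add_zero]
    | false => exact HasH1Deriv.add ordConnected_Ioo h1 h2

theorem const_mul (c : ℂ) (h : IsModeSol dir μ f a b u d s) :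
    IsModeSol dir μ (fun x => c * f x) (c * a) (c * b) (fun x => c * u x)
      (fun x => c * d x) (fun x => c * s x) where
  mode := h.mode.const_mul c
  eq x := by rw [← h.eq x]; ring
  jumpNeg := h.jumpNeg.const_mul c
  jumpPos := h.jumpPos.const_mul c
  origin := by
    have h1 := h.origin
    cases dir with
    | true => simp only [OriginMode] at *; rw [h1, mul_zero]
    | false => exact HasH1Deriv.const_mul c h1

theorem memLp_rhs (h : IsModeSol dir μ f a b u d s) : MemLp f 2 volume := by
  have := h.mode.memLp_snd.neg.add (h.mode.memLp.const_mul μ)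
  exact this.ae_eq (Eventually.of_forall fun x => h.eq x)

/-- Subtracting u(0) e^{-k|x|} enforces the Dirichlet condition: this function solves the
homogeneous equation off 0 and has no jumps at ±1. -/
theorem exists_of_line {k : ℂ} (hk : 0 < k.re) (h : IsModeSol false (k ^ 2) f a b u d s)
    (dir : Bool) : ∃ u' d' s', IsModeSol dir (k ^ 2) f a b u' d' s' := by
  cases dir with
  | false => exact ⟨u, d, s, h⟩
  | true =>
    refine ⟨fun x => u x + -u 0 * decay k 0 x, fun x => d x + -u 0 * decayDeriv k 0 x,
      fun x => s x + -u 0 * (k ^ 2 * decay k 0 x), ?_, fun x => ?_, ?_, ?_, ?_⟩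
    · exact h.mode.add ((isMode_decay hk (by norm_num)).const_mul _)
    · rw [← h.eq x]; ring
    · simpa using h.jumpNeg.add
        ((hasJump_decayDeriv_of_ne k (o := 0) (x := -1) (by norm_num)).const_mul (-u 0))
    · simpa using h.jumpPos.add
        ((hasJump_decayDeriv_of_ne k (o := 0) (x := 1) (by norm_num)).const_mul (-u 0))
    · simp [OriginMode, decay_self]

end IsModeSol

theorem exists_isModeSol (dir : Bool) {k : ℂ} (hk : 0 < k.re) {f : ℝ → ℂ} (hf : MemLp f 2 volume) :
    ∃ u d s, IsModeSol dir (k ^ 2) f 0 0 u d s := by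
  obtain ⟨u, d, hu, hd⟩ := exists_solution_line hk hf
  refine IsModeSol.exists_of_line (u := u) (d := d) (s := fun x => k ^ 2 * u x - f x) hk
    ⟨?_, fun x => by ring, ?_, ?_, hd.mono (subset_univ _)⟩ dir
  · exact ⟨hu, hd.mono (subset_univ _), hd.mono (subset_univ _), hd.mono (subset_univ _),
      hd.mono (subset_univ _)⟩
  · exact hasJump_of_continuousAt hd.continuous.continuousAt
  · exact hasJump_of_continuousAt hd.continuous.continuousAt

theorem exists_isModeSol_neg (dir : Bool) {k : ℂ} (hk : 0 < k.re) :
    ∃ u d s, IsModeSol dir (k ^ 2) (fun _ => 0) 1 0 u d s := by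
  have h : IsModeSol false (k ^ 2) (fun _ => 0) (-2 * k) 0 (decay k (-1)) (decayDeriv k (-1))
      fun x => k ^ 2 * decay k (-1) x :=
    ⟨isMode_decay hk (by norm_num), fun x => by ring, hasJump_decayDeriv k (-1),
      hasJump_decayDeriv_of_ne k (by norm_num),
      hasH1Deriv_decayDeriv hk ordConnected_Ioo (by norm_num)⟩
  have hk0 : k ≠ 0 := by rintro rfl; simp at hk
  have h2 := h.const_mul (-2 * k)⁻¹
  rw [inv_mul_cancel₀ (by simpa using hk0), mul_zero] at h2
  exact IsModeSol.exists_of_line hk (by simpa using h2) dir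

theorem exists_isModeSol_pos (dir : Bool) {k : ℂ} (hk : 0 < k.re) :
    ∃ u d s, IsModeSol dir (k ^ 2) (fun _ => 0) 0 1 u d s := by
  have h : IsModeSol false (k ^ 2) (fun _ => 0) 0 (-2 * k) (decay k 1) (decayDeriv k 1)
      fun x => k ^ 2 * decay k 1 x :=
    ⟨isMode_decay hk (by norm_num), fun x => by ring, hasJump_decayDeriv_of_ne k (by norm_num),
      hasJump_decayDeriv k 1, hasH1Deriv_decayDeriv hk ordConnected_Ioo (by norm_num)⟩
  have hk0 : k ≠ 0 := by rintro rfl; simp at hk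
  have h2 := h.const_mul (-2 * k)⁻¹
  rw [inv_mul_cancel₀ (by simpa using hk0), mul_zero] at h2
  exact IsModeSol.exists_of_line hk (by simpa using h2) dir

/-! ### The truncated system -/

/-- The restriction of a sequence to the indices below `N`. -/
def trunc (N : ℕ) (a : ℕ → ℂ) (l : ℕ) : ℂ := if l < N then a l else 0

/-- Truncated entries vanish at N, so the corner term of the telescoping sum disappears: truncation
keeps the coupling exactly symmetric. -/
theorem sum_coupling_trunc (a b : ℕ → ℂ) (N : ℕ) : ∑ m ∈ Finset.range N,
    (coupling (trunc N a) m * b m - a m * coupling (trunc N b) m) = 0 := by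
  have : ∀ m ∈ Finset.range N, coupling (trunc N a) m * b m - a m * coupling (trunc N b) m =
      coupling (trunc N a) m * trunc N b m - trunc N a m * coupling (trunc N b) m := by
    intro m hm
    have hm' := Finset.mem_range.1 hm
    simp only [trunc, if_pos hm']
  rw [Finset.sum_congr rfl this, sum_coupling_sub]
  simp [trunc]

/-- The jumps in the truncated system. -/
structure IsTruncated (αp αm : ℝ) (N : ℕ) (u : ℕ × ℕ → ℝ → ℂ) (a b : ℕ × ℕ → ℂ) : Prop where
  pos : ∀ m n, m < N → n < N →
    b (m, n) = ((αp / √2 : ℝ) : ℂ) * coupling (trunc N fun l => u (l, n) 1) m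
  neg : ∀ m n, m < N → n < N →
    a (m, n) = ((αm / √2 : ℝ) : ℂ) * coupling (trunc N fun l => u (m, l) (-1)) n

theorem conj_coupling_trunc (N : ℕ) (a : ℕ → ℂ) (m : ℕ) :
    (starRingEnd ℂ) (coupling (trunc N a) m) =
      coupling (trunc N fun l => (starRingEnd ℂ) (a l)) m := by
  rw [conj_coupling]
  congr 1
  ext l
  simp only [trunc]
  split_ifs <;> simp

/-- Green's formula for u with its conjugate, summed over the box, has no boundary contribution, by
symmetry of the truncated coupling. What remains is the imaginary part of the equation paired with
u, in which the real r_p drop out; hence a bound independent of N. -/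
theorem IsTruncated.energy {dir : Bool} {αp αm : ℝ} {Λ : ℂ} {N : ℕ} {μ : ℕ × ℕ → ℂ}
    (hμ : ∀ p, (μ p).im = -Λ.im) {f u d s : ℕ × ℕ → ℝ → ℂ} {a b : ℕ × ℕ → ℂ}
    (h : ∀ p, IsModeSol dir (μ p) (f p) (a p) (b p) (u p) (d p) (s p))
    (ht : IsTruncated αp αm N u a b) :
    Λ.im ^ 2 * ∑ p ∈ Finset.range N ×ˢ Finset.range N, ∫ x, ‖u p x‖ ^ 2 ≤
      ∑ p ∈ Finset.range N ×ˢ Finset.range N, ∫ x, ‖f p x‖ ^ 2 := by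
  set g : ℕ × ℕ → ℝ → ℂ := fun p x =>
    (starRingEnd ℂ) (u p x) * s p x - (starRingEnd ℂ) (s p x) * u p x
  have hgi : ∀ p, Integrable (g p) := fun p =>
    (memLp_mul_integrable (memLp_conj (h p).mode.memLp) (h p).mode.memLp_snd).sub
      (memLp_mul_integrable (memLp_conj (h p).mode.memLp_snd) (h p).mode.memLp)
  have hmode : ∀ p, ∫ x, g p x =
      ((starRingEnd ℂ) (a p) * u p (-1) - (starRingEnd ℂ) (u p (-1)) * a p) +
      ((starRingEnd ℂ) (b p) * u p 1 - (starRingEnd ℂ) (u p 1) * b p) := by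
    intro p
    obtain ⟨j, hj⟩ := (h p).mode.exists_hasJump_zero
    have := (h p).mode.conj.integral_sub (h p).mode (h p).jumpNeg.conj hj.conj (h p).jumpPos.conj
      (h p).jumpNeg hj (h p).jumpPos
    simp only [g]
    rw [this]
    have h0 : (starRingEnd ℂ) j * u p 0 - (starRingEnd ℂ) (u p 0) * j = 0 := by
      have ho := (h p).origin
      cases dir with
      | true => simp only [OriginMode] at ho; rw [ho]; simp
      | false =>
        have hI : (Ioo (-1 : ℝ) 1) ∈ 𝓝 (0 : ℝ) := Ioo_mem_nhds (by norm_num) (by norm_num)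
        have hj0 : HasJump (d p) 0 0 := hasJump_of_continuousAt
          (((HasH1Deriv.isPrimitiveOn_Ioo ho).continuousOn ordConnected_Ioo).continuousAt hI)
        rw [hj.unique hj0]; simp
    rw [h0]; ring
  have hsum : ∑ p ∈ Finset.range N ×ˢ Finset.range N, ∫ x, g p x = 0 := by
    simp only [hmode, Finset.sum_add_distrib]
    rw [Finset.sum_product, Finset.sum_product_right]
    have e1 : ∀ m ∈ Finset.range N, ∑ n ∈ Finset.range N,
        ((starRingEnd ℂ) (a (m, n)) * u (m, n) (-1) -
          (starRingEnd ℂ) (u (m, n) (-1)) * a (m, n)) = 0 := by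
      intro m hm
      have := sum_coupling_trunc (fun l => (starRingEnd ℂ) (u (m, l) (-1)))
        (fun l => u (m, l) (-1)) N
      rw [← mul_zero ((αm / √2 : ℝ) : ℂ), ← this, Finset.mul_sum]
      refine Finset.sum_congr rfl fun n hn => ?_
      rw [ht.neg m n (Finset.mem_range.1 hm) (Finset.mem_range.1 hn), map_mul,
        conj_coupling_trunc, Complex.conj_ofReal]
      ring
    have e2 : ∀ n ∈ Finset.range N, ∑ m ∈ Finset.range N,
        ((starRingEnd ℂ) (b (m, n)) * u (m, n) 1 -
          (starRingEnd ℂ) (u (m, n) 1) * b (m, n)) = 0 := by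
      intro n hn
      have := sum_coupling_trunc (fun l => (starRingEnd ℂ) (u (l, n) 1)) (fun l => u (l, n) 1) N
      rw [← mul_zero ((αp / √2 : ℝ) : ℂ), ← this, Finset.mul_sum]
      refine Finset.sum_congr rfl fun m hm => ?_
      rw [ht.pos m n (Finset.mem_range.1 hm) (Finset.mem_range.1 hn), map_mul,
        conj_coupling_trunc, Complex.conj_ofReal]
      ring
    rw [Finset.sum_eq_zero e1, Finset.sum_eq_zero e2, add_zero]
  -- Im g = 2 (Im μ |u|² - Im(conj u · f)) with Im μ = -Im Λ; the cross term is absorbed by 2 |Im Λ|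
  -- |u| |f| ≤ (Im Λ)² |u|² + |f|².
  have hpt : ∀ p x, Λ.im ^ 2 * ‖u p x‖ ^ 2 - ‖f p x‖ ^ 2 ≤ -Λ.im * (g p x).im := by
    intro p x
    have e : (g p x).im = 2 * (-Λ.im * ‖u p x‖ ^ 2 - ((starRingEnd ℂ) (u p x) * f p x).im) := by
      have hs : s p x = μ p * u p x - f p x := by rw [← (h p).eq x]; ring
      simp only [g]
      rw [hs, ← hμ p, ← Complex.normSq_eq_norm_sq, Complex.normSq_apply]
      simp
      ring
    have h6 : |((starRingEnd ℂ) (u p x) * f p x).im| ≤ ‖u p x‖ * ‖f p x‖ := by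
      refine (Complex.abs_im_le_norm _).trans ?_
      rw [norm_mul, RCLike.norm_conj]
    have h7 : -(|Λ.im| * (‖u p x‖ * ‖f p x‖)) ≤
        Λ.im * ((starRingEnd ℂ) (u p x) * f p x).im := by
      have := neg_abs_le (Λ.im * ((starRingEnd ℂ) (u p x) * f p x).im)
      rw [abs_mul] at this
      have := mul_le_mul_of_nonneg_left h6 (abs_nonneg Λ.im)
      linarith
    rw [e]
    nlinarith [sq_nonneg (|Λ.im| * ‖u p x‖ - ‖f p x‖), sq_abs Λ.im]
  have hu : ∀ p, Integrable fun x => ‖u p x‖ ^ 2 := fun p => (h p).mode.memLp.norm.integrable_sq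
  have hf : ∀ p, Integrable fun x => ‖f p x‖ ^ 2 := fun p => (h p).memLp_rhs.norm.integrable_sq
  have hle : ∀ p, Λ.im ^ 2 * (∫ x, ‖u p x‖ ^ 2) - ∫ x, ‖f p x‖ ^ 2 ≤
      -Λ.im * (∫ x, g p x).im := by
    intro p
    have him : (∫ x, g p x).im = ∫ x, (g p x).im :=
      (integral_im (𝕜 := ℂ) (hgi p)).symm
    rw [him, ← integral_const_mul, ← integral_const_mul, ← integral_sub ((hu p).const_mul _) (hf p)]
    exact integral_mono (((hu p).const_mul _).sub (hf p)) ((hgi p).im.const_mul _) (hpt p)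
  have := Finset.sum_le_sum fun p (_ : p ∈ Finset.range N ×ˢ Finset.range N) => hle p
  rw [Finset.sum_sub_distrib, ← Finset.mul_sum, ← Finset.mul_sum, ← Complex.im_sum, hsum] at this
  simp only [Complex.zero_im, mul_zero] at this
  linarith

theorem eq_zero_of_integral_norm_sq_eq_zero {u : ℝ → ℂ} (hc : Continuous u)
    (hu : MemLp u 2 volume) (h : ∫ x, ‖u x‖ ^ 2 = 0) : u = 0 := by
  rw [integral_eq_zero_iff_of_nonneg (fun x => by positivity) hu.norm.integrable_sq] at h
  refine (Continuous.ae_eq_iff_eq volume hc continuous_zero).1 ?_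
  filter_upwards [h] with x hx
  simpa using hx

theorem coupling_add (a b : ℕ → ℂ) (m : ℕ) :
    coupling (fun l => a l + b l) m = coupling a m + coupling b m := by
  simp only [coupling]; ring

theorem coupling_trunc_add (N : ℕ) (a b : ℕ → ℂ) (m : ℕ) :
    coupling (trunc N fun l => a l + b l) m = coupling (trunc N a) m + coupling (trunc N b) m := by
  rw [← coupling_add]; congr 1; ext l; simp only [trunc]; split_ifs <;> simp

theorem coupling_trunc_mul (N : ℕ) (c : ℂ) (a : ℕ → ℂ) (m : ℕ) :
    coupling (trunc N fun l => c * a l) m = c * coupling (trunc N a) m := by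
  simp only [coupling, trunc]; split_ifs <;> ring

/-- Extension by zero from the box. -/
def extend {N : ℕ} (c : Fin N × Fin N → ℂ) (p : ℕ × ℕ) : ℂ :=
  if h : p.1 < N ∧ p.2 < N then c (⟨p.1, h.1⟩, ⟨p.2, h.2⟩) else 0

theorem extend_add {N : ℕ} (c c' : Fin N × Fin N → ℂ) (p : ℕ × ℕ) :
    extend (c + c') p = extend c p + extend c' p := by
  simp only [extend]; split_ifs <;> simp

theorem extend_smul {N : ℕ} (z : ℂ) (c : Fin N × Fin N → ℂ) (p : ℕ × ℕ) :
    extend (z • c) p = z * extend c p := by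
  simp only [extend]; split_ifs <;> simp

theorem extend_of_lt {N : ℕ} (c : Fin N × Fin N → ℂ) {m n : ℕ} (hm : m < N) (hn : n < N) :
    extend c (m, n) = c (⟨m, hm⟩, ⟨n, hn⟩) := dif_pos ⟨hm, hn⟩

/-- Pairs of families indexed by the box `[0, N)²`. -/
abbrev BoxPair (N : ℕ) : Type := (Fin N × Fin N → ℂ) × (Fin N × Fin N → ℂ)

/-- The truncated coupled system is solvable. -/
theorem exists_isTruncated {dir : Bool} (αp αm : ℝ) {Λ : ℂ} (hΛ : Λ.im ≠ 0) (N : ℕ)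
    {μ : ℕ × ℕ → ℂ} (hμ : ∀ p, (μ p).im = -Λ.im) (v : ℕ × ℕ → ℝ → ℂ)
    {u d s u' d' s' : ℕ × ℕ → ℝ → ℂ}
    (h : ∀ p, IsModeSol dir (μ p) (fun _ => 0) 1 0 (u p) (d p) (s p))
    (h' : ∀ p, IsModeSol dir (μ p) (fun _ => 0) 0 1 (u' p) (d' p) (s' p)) :
    ∃ a b : ℕ × ℕ → ℂ, (∀ p, ¬(p.1 < N ∧ p.2 < N) → a p = 0 ∧ b p = 0) ∧
      IsTruncated αp αm N (fun p x => v p x + (a p * u p x + b p * u' p x)) a b := by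
  let w : BoxPair N → ℕ × ℕ → ℝ → ℂ := fun c p x => extend c.1 p * u p x + extend c.2 p * u' p x
  have w_add : ∀ c c' p x, w (c + c') p x = w c p x + w c' p x := fun c c' p x => by
    simp only [w, Prod.fst_add, Prod.snd_add, extend_add]; ring
  have w_smul : ∀ (z : ℂ) c p x, w (z • c) p x = z * w c p x := fun z c p x => by
    simp only [w, Prod.smul_fst, Prod.smul_snd, extend_smul]; ring
  let K₁ : (ℕ × ℕ → ℝ → ℂ) → Fin N × Fin N → ℂ := fun y q =>
    ((αm / √2 : ℝ) : ℂ) * coupling (trunc N fun l => y (q.1, l) (-1)) q.2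
  let K₂ : (ℕ × ℕ → ℝ → ℂ) → Fin N × Fin N → ℂ := fun y q =>
    ((αp / √2 : ℝ) : ℂ) * coupling (trunc N fun l => y (l, q.2) 1) q.1
  -- The jumps c are the unknowns, w c is the response of the modes, and the truncated system reads
  -- T c = (K₁ v, K₂ v). In finite dimensions injectivity suffices, and it follows from the energy
  -- bound with zero source.
  let T : BoxPair N →ₗ[ℂ] BoxPair N :=
    { toFun := fun c => (c.1 - K₁ (w c), c.2 - K₂ (w c))
      map_add' := fun c c' => by
        ext q
        · simp only [K₁, w_add, coupling_trunc_add, Prod.fst_add, Pi.sub_apply, Pi.add_apply]; ring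
        · simp only [K₂, w_add, coupling_trunc_add, Prod.snd_add, Pi.sub_apply, Pi.add_apply]; ring
      map_smul' := fun z c => by
        ext q
        · simp only [K₁, w_smul, coupling_trunc_mul, Prod.smul_fst, Pi.sub_apply, Pi.smul_apply,
            smul_eq_mul, RingHom.id_apply]; ring
        · simp only [K₂, w_smul, coupling_trunc_mul, Prod.smul_snd, Pi.sub_apply, Pi.smul_apply,
            smul_eq_mul, RingHom.id_apply]; ring }
  have hinj : Function.Injective T := by
    rw [← LinearMap.ker_eq_bot, LinearMap.ker_eq_bot']
    intro c hc
    have hc1 : c.1 = K₁ (w c) := sub_eq_zero.1 (congrArg Prod.fst hc)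
    have hc2 : c.2 = K₂ (w c) := sub_eq_zero.1 (congrArg Prod.snd hc)
    have hsol : ∀ p, IsModeSol dir (μ p) (fun _ => 0) (extend c.1 p) (extend c.2 p) (w c p)
        (fun x => extend c.1 p * d p x + extend c.2 p * d' p x)
        (fun x => extend c.1 p * s p x + extend c.2 p * s' p x) := fun p => by
      simpa using ((h p).const_mul (extend c.1 p)).add ((h' p).const_mul (extend c.2 p))
    have htr : IsTruncated αp αm N (w c) (extend c.1) (extend c.2) :=
      ⟨fun m n hm hn => by rw [extend_of_lt _ hm hn]; exact congrFun hc2 _,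
        fun m n hm hn => by rw [extend_of_lt _ hm hn]; exact congrFun hc1 _⟩
    have hen := htr.energy hμ hsol
    simp only [norm_zero, ne_eq, OfNat.ofNat_ne_zero, not_false_eq_true, zero_pow,
      integral_zero, Finset.sum_const_zero] at hen
    have hle : ∑ p ∈ Finset.range N ×ˢ Finset.range N, ∫ x, ‖w c p x‖ ^ 2 ≤ 0 := by
      by_contra hcon
      have := mul_pos (pow_pos (abs_pos.2 hΛ) 2) (not_le.1 hcon)
      rw [sq_abs] at this
      linarith
    have hw : ∀ m n, m < N → n < N → w c (m, n) = 0 := by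
      intro m n hm hn
      refine eq_zero_of_integral_norm_sq_eq_zero (hsol _).mode.continuous (hsol _).mode.memLp ?_
      have h0 : ∀ p ∈ Finset.range N ×ˢ Finset.range N, 0 ≤ ∫ x, ‖w c p x‖ ^ 2 := fun p _ =>
        integral_nonneg fun x => by positivity
      exact (Finset.sum_eq_zero_iff_of_nonneg h0).1 (le_antisymm hle (Finset.sum_nonneg h0)) (m, n)
        (by simp [hm, hn])
    ext q
    · rw [hc1]
      have : (trunc N fun l => w c (q.1, l) (-1)) = fun _ => 0 := by
        ext l
        simp only [trunc]
        split_ifs with hl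
        · rw [hw _ _ q.1.2 hl]; rfl
        · rfl
      simp only [K₁, this, coupling]; simp
    · rw [hc2]
      have : (trunc N fun l => w c (l, q.2) 1) = fun _ => 0 := by
        ext l
        simp only [trunc]
        split_ifs with hl
        · rw [hw _ _ hl q.2.2]; rfl
        · rfl
      simp only [K₂, this, coupling]; simp
  obtain ⟨c, hc⟩ := LinearMap.injective_iff_surjective.1 hinj (K₁ v, K₂ v)
  have hc1 : c.1 = K₁ v + K₁ (w c) := sub_eq_iff_eq_add.1 (congrArg Prod.fst hc)
  have hc2 : c.2 = K₂ v + K₂ (w c) := sub_eq_iff_eq_add.1 (congrArg Prod.snd hc)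
  refine ⟨extend c.1, extend c.2, fun p hp => ⟨dif_neg hp, dif_neg hp⟩, fun m n hm hn => ?_,
    fun m n hm hn => ?_⟩
  · rw [extend_of_lt _ hm hn, coupling_trunc_add, mul_add]
    exact congrFun hc2 _
  · rw [extend_of_lt _ hm hn, coupling_trunc_add, mul_add]
    exact congrFun hc1 _

/-! ### Solvability of the coupled system -/

theorem integral_norm_sq_add_le {f u : ℝ → ℂ} (hf : MemLp f 2 volume) (hu : MemLp u 2 volume)
    (c : ℂ) : ∫ x, ‖f x + c * u x‖ ^ 2 ≤
      2 * (∫ x, ‖f x‖ ^ 2) + 2 * ‖c‖ ^ 2 * ∫ x, ‖u x‖ ^ 2 := by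
  have i1 : Integrable fun x => ‖f x‖ ^ 2 := hf.norm.integrable_sq
  have i2 : Integrable fun x => ‖u x‖ ^ 2 := hu.norm.integrable_sq
  rw [← integral_const_mul, ← integral_const_mul,
    ← integral_add (i1.const_mul _) (i2.const_mul _)]
  refine integral_mono (hf.add (hu.const_mul c)).norm.integrable_sq
    ((i1.const_mul _).add (i2.const_mul _)) fun x => ?_
  have h1 : ‖f x + c * u x‖ ≤ ‖f x‖ + ‖c‖ * ‖u x‖ := (norm_add_le _ _).trans_eq (by rw [norm_mul])
  have h2 : ‖f x + c * u x‖ ^ 2 ≤ (‖f x‖ + ‖c‖ * ‖u x‖) ^ 2 :=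
    pow_le_pow_left₀ (norm_nonneg _) h1 2
  nlinarith [sq_nonneg (‖f x‖ - ‖c‖ * ‖u x‖)]

theorem norm_coupling_le {a : ℕ → ℂ} {t : ℕ → ℝ} (h : ∀ l, ‖a l‖ ≤ t l) (m : ℕ) :
    ‖coupling a m‖ ≤ √(m + 1 : ℝ) * t (m + 1) + √(m : ℝ) * t (m - 1) := by
  rw [coupling]
  refine (norm_add_le _ _).trans ?_
  rw [norm_mul, norm_mul, Complex.norm_real, Complex.norm_real,
    Real.norm_of_nonneg (Real.sqrt_nonneg _), Real.norm_of_nonneg (Real.sqrt_nonneg _)]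
  have := h (m + 1)
  have := h (m - 1)
  gcongr

theorem coupling_trunc_of_lt {N m : ℕ} (h : m + 1 < N) (a : ℕ → ℂ) :
    coupling (trunc N a) m = coupling a m := by
  rw [coupling, coupling, trunc, trunc, if_pos h, if_pos (by omega)]

/-- A priori bound for the solutions of the truncated systems. -/
theorem IsTruncated.exists_bound {dir : Bool} (αp αm νp νm : ℝ) {Λ : ℂ} (hΛ : Λ.im ≠ 0)
    {f : ℕ × ℕ → ℝ → ℂ} (hf : Summable fun p => ∫ x, ‖f p x‖ ^ 2) :
    ∃ B : ℕ × ℕ → ℝ, (∀ p, 0 ≤ B p) ∧ ∀ (N : ℕ) (u d s : ℕ × ℕ → ℝ → ℂ) (a b : ℕ × ℕ → ℂ),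
      (∀ p, IsModeSol dir ((rCoeff νp νm p.1 p.2 : ℂ) - Λ) (f p) (a p) (b p) (u p) (d p) (s p)) →
      IsTruncated αp αm N u a b →
      (∑ p ∈ Finset.range N ×ˢ Finset.range N, ∫ x, ‖u p x‖ ^ 2 ≤
        (∑' p, ∫ x, ‖f p x‖ ^ 2) / Λ.im ^ 2) ∧
      ∀ m n, m < N → n < N → ‖a (m, n)‖ ≤ B (m, n) ∧ ‖b (m, n)‖ ≤ B (m, n) := by
  have hΛ2 : 0 < Λ.im ^ 2 := by positivity
  have hf0 : ∀ p, 0 ≤ ∫ x, ‖f p x‖ ^ 2 := fun p => integral_nonneg fun x => by positivity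
  set T := ∑' p, ∫ x, ‖f p x‖ ^ 2
  have hT0 : 0 ≤ T := tsum_nonneg hf0
  set S := T / Λ.im ^ 2
  have hS0 : 0 ≤ S := by positivity
  set c := νp ^ 2 + νm ^ 2
  -- Bound for the traces at ±1: S bounds ‖u_p‖² and 2T + 2|Λ|² S bounds ‖L_p u_p‖² in the trace
  -- inequality. The jumps, being couplings of neighbouring traces, are then bounded for each p
  -- uniformly in N.
  set t : ℕ × ℕ → ℝ := fun p =>
    √((4 * c ^ 2 + 36) * rootIndex p * (S + (2 * T + 2 * ‖Λ‖ ^ 2 * S)))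
  have ht0 : ∀ p, 0 ≤ t p := fun p => Real.sqrt_nonneg _
  refine ⟨fun p => |αp / √2| * (√(p.1 + 1 : ℝ) * t (p.1 + 1, p.2) + √(p.1 : ℝ) * t (p.1 - 1, p.2)) +
    |αm / √2| * (√(p.2 + 1 : ℝ) * t (p.1, p.2 + 1) + √(p.2 : ℝ) * t (p.1, p.2 - 1)), fun p => ?_, ?_⟩
  · have := ht0 (p.1 + 1, p.2)
    have := ht0 (p.1 - 1, p.2)
    have := ht0 (p.1, p.2 + 1)
    have := ht0 (p.1, p.2 - 1)
    positivity
  intro N u d s a b h htr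
  have hen : ∑ p ∈ Finset.range N ×ˢ Finset.range N, ∫ x, ‖u p x‖ ^ 2 ≤ S := by
    have h1 := htr.energy (Λ := Λ) (fun p => by simp) h
    rw [le_div_iff₀ hΛ2, mul_comm]
    exact h1.trans (hf.sum_le_tsum _ fun p _ => hf0 p)
  have hu0 : ∀ p, 0 ≤ ∫ x, ‖u p x‖ ^ 2 := fun p => integral_nonneg fun x => by positivity
  have hu : ∀ m n, m < N → n < N → ∫ x, ‖u (m, n) x‖ ^ 2 ≤ S := fun m n hm hn =>
    (Finset.single_le_sum (f := fun p => ∫ x, ‖u p x‖ ^ 2) (fun p _ => hu0 p)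
      (Finset.mem_product.2 ⟨Finset.mem_range.2 hm, Finset.mem_range.2 hn⟩)).trans hen
  have hLu : ∀ p, ∫ x, ‖-s p x + ((rCoeff νp νm p.1 p.2 : ℝ) : ℂ) * u p x‖ ^ 2 ≤
      2 * T + 2 * ‖Λ‖ ^ 2 * ∫ x, ‖u p x‖ ^ 2 := fun p => by
    have e : ∀ x, -s p x + ((rCoeff νp νm p.1 p.2 : ℝ) : ℂ) * u p x = f p x + Λ * u p x :=
      fun x => by rw [← (h p).eq x]; ring
    simp only [e]
    refine (integral_norm_sq_add_le (h p).memLp_rhs (h p).mode.memLp Λ).trans ?_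
    have := hf.le_tsum p fun q _ => hf0 q
    gcongr
  have key : ∀ m n (A : ℂ), m < N → n < N → ‖A‖ ^ 2 ≤ (4 * c ^ 2 + 36) * rootIndex (m, n) *
      ((∫ x, ‖u (m, n) x‖ ^ 2) +
        ∫ x, ‖-s (m, n) x + ((rCoeff νp νm m n : ℝ) : ℂ) * u (m, n) x‖ ^ 2) → ‖A‖ ≤ t (m, n) := by
    intro m n A hm hn hA
    refine Real.le_sqrt_of_sq_le (hA.trans ?_)
    have h1 := hu m n hm hn
    have h2 := hLu (m, n)
    have h3 := one_le_rootIndex (m, n)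
    have h4 : 2 * T + 2 * ‖Λ‖ ^ 2 * (∫ x, ‖u (m, n) x‖ ^ 2) ≤ 2 * T + 2 * ‖Λ‖ ^ 2 * S := by gcongr
    gcongr
    exact h2.trans h4
  refine ⟨hen, fun m n hm hn => ⟨?_, ?_⟩⟩
  · rw [htr.neg m n hm hn, norm_mul, Complex.norm_real, Real.norm_eq_abs]
    have h1 : ‖coupling (trunc N fun l => u (m, l) (-1)) n‖ ≤ _ :=
      norm_coupling_le (t := fun l => t (m, l)) (fun l => ?_) n
    · have h2 := ht0 (m + 1, n)
      have h3 := ht0 (m - 1, n)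
      have h4 : 0 ≤ |αp / √2| * (√(m + 1 : ℝ) * t (m + 1, n) + √(m : ℝ) * t (m - 1, n)) := by
        positivity
      have h5 := mul_le_mul_of_nonneg_left h1 (abs_nonneg (αm / √2))
      linarith
    · rw [trunc]
      split_ifs with hl
      · exact key m l _ hm hl ((h (m, l)).mode.norm_sq_neg_one_le (one_le_rootIndex _)
          (rCoeff_nonneg νp νm (m, l)) (rCoeff_le νp νm (m, l)))
      · rw [norm_zero]; exact ht0 _
  · rw [htr.pos m n hm hn, norm_mul, Complex.norm_real, Real.norm_eq_abs]
    have h1 : ‖coupling (trunc N fun l => u (l, n) 1) m‖ ≤ _ :=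
      norm_coupling_le (t := fun l => t (l, n)) (fun l => ?_) m
    · have h2 := ht0 (m, n + 1)
      have h3 := ht0 (m, n - 1)
      have h4 : 0 ≤ |αm / √2| * (√(n + 1 : ℝ) * t (m, n + 1) + √(n : ℝ) * t (m, n - 1)) := by
        positivity
      have h5 := mul_le_mul_of_nonneg_left h1 (abs_nonneg (αp / √2))
      linarith
    · rw [trunc]
      split_ifs with hl
      · exact key l n _ hl hn ((h (l, n)).mode.norm_sq_one_le (one_le_rootIndex _)
          (rCoeff_nonneg νp νm (l, n)) (rCoeff_le νp νm (l, n)))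
      · rw [norm_zero]; exact ht0 _

/-- The operators `A_α - Λ` and `A°_α - Λ` are surjective. -/
theorem exists_mem_opGraph (dir : Bool) (αp αm νp νm : ℝ) {Λ : ℂ} (hΛ : Λ.im ≠ 0) (F : L2R3) :
    ∃ U, (U, F + Λ • U) ∈ opGraph dir αp αm νp νm := by
  have hr : ∀ p : ℕ × ℕ, ((rCoeff νp νm p.1 p.2 : ℂ) - Λ).im ≠ 0 := fun p => by simpa using hΛ
  choose k hk hk2 using fun p => exists_sq_eq_of_im_ne_zero (hr p)
  choose u₀ d₀ s₀ h₀ using fun p => exists_isModeSol dir (hk p) (Lp.memLp (coeff p F))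
  choose u₁ d₁ s₁ h₁ using fun p => exists_isModeSol_neg dir (hk p)
  choose u₂ d₂ s₂ h₂ using fun p => exists_isModeSol_pos dir (hk p)
  simp only [hk2] at h₀ h₁ h₂
  set w : ℕ × ℕ → ℂ × ℂ → ℝ → ℂ := fun p z x => u₀ p x + (z.1 * u₁ p x + z.2 * u₂ p x)
  have hsol : ∀ p (z : ℂ × ℂ), IsModeSol dir ((rCoeff νp νm p.1 p.2 : ℂ) - Λ) (coeff p F) z.1 z.2
      (w p z) (fun x => d₀ p x + (z.1 * d₁ p x + z.2 * d₂ p x))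
      (fun x => s₀ p x + (z.1 * s₁ p x + z.2 * s₂ p x)) := fun p z => by
    simpa using (h₀ p).add (((h₁ p).const_mul z.1).add ((h₂ p).const_mul z.2))
  choose a b hz ht using fun N =>
    exists_isTruncated αp αm hΛ N (fun p => by simp) u₀ h₁ h₂
  have hFs : HasSum (fun p => ∫ x, ‖coeff p F x‖ ^ 2) (‖F‖ ^ 2) := by
    simpa only [norm_sq_eq_integral] using hasSum_norm_sq_coeff F
  obtain ⟨B, hB0, hB⟩ := IsTruncated.exists_bound (dir := dir) αp αm νp νm hΛ hFs.summable
  rw [hFs.tsum_eq] at hB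
  have hB' := fun N => hB N _ _ _ _ _ (fun p => hsol p (a N p, b N p)) (ht N)
  -- The jumps of all truncated solutions lie in one product of closed balls, which is compact and
  -- metrizable since the index set is countable; a subsequence converges for every p. Outside the
  -- box the jumps are zero.
  obtain ⟨c, -, φ, hφ, hc⟩ : ∃ c ∈ Set.univ.pi fun p => Metric.closedBall (0 : ℂ × ℂ) (B p),
      ∃ φ : ℕ → ℕ, StrictMono φ ∧
        Tendsto ((fun N p => (a N p, b N p)) ∘ φ) atTop (𝓝 c) := by
    refine (isCompact_univ_pi fun p => isCompact_closedBall _ _).tendsto_subseq fun N p _ => ?_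
    rw [mem_closedBall_zero_iff, Prod.norm_def, max_le_iff]
    by_cases hp : p.1 < N ∧ p.2 < N
    · exact (hB' N).2 p.1 p.2 hp.1 hp.2
    · rw [(hz N p hp).1, (hz N p hp).2, norm_zero]; exact ⟨hB0 p, hB0 p⟩
  have hc' : ∀ p, Tendsto (fun N => (a (φ N) p, b (φ N) p)) atTop (𝓝 (c p)) :=
    fun p => (tendsto_pi_nhds.1 hc) p
  have hbig : ∀ M, ∀ᶠ N in atTop, M < φ N := fun M => hφ.tendsto_atTop.eventually_gt_atTop M
  have hwc : ∀ p x, Tendsto (fun N => w p (a (φ N) p, b (φ N) p) x) atTop (𝓝 (w p (c p) x)) := by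
    intro p x
    have hcont : Continuous fun z : ℂ × ℂ => w p z x := by fun_prop
    exact (hcont.tendsto _).comp (hc' p)
  -- The coupling at (m, n) involves only two neighbours; once N exceeds their indices, truncation
  -- is invisible, and the matching condition passes to the limit.
  have hpos : ∀ m n, (c (m, n)).2 =
      ((αp / √2 : ℝ) : ℂ) * coupling (fun l => w (l, n) (c (l, n)) 1) m := by
    intro m n
    refine tendsto_nhds_unique ((continuous_snd.tendsto _).comp (hc' (m, n))) ?_
    have h1 : Tendsto (fun N => ((αp / √2 : ℝ) : ℂ) *
        coupling (fun l => w (l, n) (a (φ N) (l, n), b (φ N) (l, n)) 1) m) atTop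
        (𝓝 (((αp / √2 : ℝ) : ℂ) * coupling (fun l => w (l, n) (c (l, n)) 1) m)) :=
      (((hwc _ 1).const_mul _).add ((hwc _ 1).const_mul _)).const_mul _
    refine h1.congr' ?_
    filter_upwards [hbig (m + 1), hbig n] with N hm hn
    rw [Function.comp_apply, (ht (φ N)).pos m n (by omega) hn, coupling_trunc_of_lt hm]
  have hneg : ∀ m n, (c (m, n)).1 =
      ((αm / √2 : ℝ) : ℂ) * coupling (fun l => w (m, l) (c (m, l)) (-1)) n := by
    intro m n
    refine tendsto_nhds_unique ((continuous_fst.tendsto _).comp (hc' (m, n))) ?_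
    have h1 : Tendsto (fun N => ((αm / √2 : ℝ) : ℂ) *
        coupling (fun l => w (m, l) (a (φ N) (m, l), b (φ N) (m, l)) (-1)) n) atTop
        (𝓝 (((αm / √2 : ℝ) : ℂ) * coupling (fun l => w (m, l) (c (m, l)) (-1)) n)) :=
      (((hwc _ (-1)).const_mul _).add ((hwc _ (-1)).const_mul _)).const_mul _
    refine h1.congr' ?_
    filter_upwards [hbig (n + 1), hbig m] with N hn hm
    rw [Function.comp_apply, (ht (φ N)).neg m n hm (by omega), coupling_trunc_of_lt hn]
  set W : ℕ × ℕ → ℂ × ℂ → L2R := fun p z => (h₀ p).mode.memLp.toLp +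
    (z.1 • (h₁ p).mode.memLp.toLp + z.2 • (h₂ p).mode.memLp.toLp)
  have hW : ∀ p z, w p z =ᵐ[volume] W p z := by
    intro p z
    filter_upwards [Lp.coeFn_add (h₀ p).mode.memLp.toLp
        (z.1 • (h₁ p).mode.memLp.toLp + z.2 • (h₂ p).mode.memLp.toLp),
      Lp.coeFn_add (z.1 • (h₁ p).mode.memLp.toLp) (z.2 • (h₂ p).mode.memLp.toLp),
      Lp.coeFn_smul z.1 (h₁ p).mode.memLp.toLp, Lp.coeFn_smul z.2 (h₂ p).mode.memLp.toLp,
      (h₀ p).mode.memLp.coeFn_toLp, (h₁ p).mode.memLp.coeFn_toLp,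
      (h₂ p).mode.memLp.coeFn_toLp] with x e1 e2 e3 e4 e5 e6 e7
    simp only [W, w]
    rw [e1, Pi.add_apply, e2, Pi.add_apply, e3, e4, Pi.smul_apply, Pi.smul_apply, e5, e6, e7,
      smul_eq_mul, smul_eq_mul]
  -- A finite set of indices eventually lies in the box, where the uniform energy bound applies
  -- before the limit is taken.
  have hsum : Summable fun p => ‖W p (c p)‖ ^ 2 := by
    refine summable_of_sum_le (c := ‖F‖ ^ 2 / Λ.im ^ 2) (fun p => by positivity) fun T => ?_
    have hlim : Tendsto (fun N => ∑ p ∈ T, ‖W p (a (φ N) p, b (φ N) p)‖ ^ 2) atTop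
        (𝓝 (∑ p ∈ T, ‖W p (c p)‖ ^ 2)) := by
      refine tendsto_finsetSum _ fun p _ => ?_
      have hcont : Continuous fun z : ℂ × ℂ => ‖W p z‖ ^ 2 := by fun_prop
      exact (hcont.tendsto _).comp (hc' p)
    refine le_of_tendsto hlim ?_
    have hT : ∀ᶠ N in atTop, ∀ p ∈ T, p.1 < φ N ∧ p.2 < φ N :=
      (Filter.eventually_all_finset T).2 fun p _ => (hbig p.1).and (hbig p.2)
    filter_upwards [hT] with N hN
    refine le_trans ?_ (hB' (φ N)).1
    have e : ∀ p, ‖W p (a (φ N) p, b (φ N) p)‖ ^ 2 =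
        ∫ x, ‖w p (a (φ N) p, b (φ N) p) x‖ ^ 2 := fun p => (norm_sq_eq_of_ae (hW p _)).symm
    simp only [e]
    exact Finset.sum_le_sum_of_subset_of_nonneg
      (fun p hp => Finset.mem_product.2 ⟨Finset.mem_range.2 (hN p hp).1,
        Finset.mem_range.2 (hN p hp).2⟩) fun p _ _ => integral_nonneg fun x => by positivity
  obtain ⟨U, hU⟩ := exists_coeff_eq _ hsum
  refine ⟨U, fun p => w p (c p), _, _, ⟨fun p => (hsol p (c p)).mode, fun p => ?_, fun p => ?_⟩,
    fun m n => ?_, fun m n => ?_, originCondition_of_originMode fun p => (hsol p (c p)).origin⟩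
  · rw [hU]; exact hW p _
  · rw [map_add, map_smul, hU]
    filter_upwards [Lp.coeFn_add (coeff p F) (Λ • W p (c p)), Lp.coeFn_smul Λ (W p (c p)),
      hW p (c p)] with x e1 e2 e3
    rw [e1, Pi.add_apply, e2, Pi.smul_apply, ← e3, ← (hsol p (c p)).eq x, smul_eq_mul]
    ring
  · exact Eq.subst (motive := fun z => HasJump _ 1 z) (hpos m n) (hsol (m, n) (c (m, n))).jumpPos
  · exact Eq.subst (motive := fun z => HasJump _ (-1) z) (hneg m n) (hsol (m, n) (c (m, n))).jumpNeg

/-! ### The resolvents -/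

/-- The primitive of g agrees almost everywhere with a constant, by continuity everywhere on I, and
its derivative is g almost everywhere. This makes the data of an expansion independent of the
representatives. -/
theorem HasH1Deriv.ae_eq_zero {I : Set ℝ} (ho : IsOpen I) (hI : I.OrdConnected) {u g : ℝ → ℂ}
    (h : HasH1Deriv I u g) (hu : u =ᵐ[volume.restrict I] 0) : g =ᵐ[volume.restrict I] 0 := by
  rcases I.eq_empty_or_nonempty with rfl | ⟨c, hc⟩
  · rw [Measure.restrict_empty]; exact ae_zero.symm ▸ Filter.eventually_bot
  have hg : LocallyIntegrable (I.indicator g) volume :=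
    (((memLp_indicator_iff_restrict ho.measurableSet).2 h.2.1).locallyIntegrable one_le_two)
  have hG : ∀ x ∈ I, ∫ t in c..x, I.indicator g t = u x - u c := fun x hx => by
    rw [h.2.2 c hc x hx]
    refine intervalIntegral.integral_congr fun t ht => ?_
    exact indicator_of_mem (hI.uIcc_subset hc hx ht) g
  have hcont : ContinuousOn (fun x => ∫ t in c..x, I.indicator g t) I :=
    (intervalIntegral.continuous_primitive
      (fun a b => (hg.integrableOn_isCompact isCompact_uIcc).intervalIntegrable) c).continuousOn
  have hconst : EqOn (fun x => ∫ t in c..x, I.indicator g t) (fun _ => -u c) I := by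
    refine Measure.eqOn_open_of_ae_eq (μ := volume) ?_ ho hcont continuousOn_const
    filter_upwards [hu, ae_restrict_mem ho.measurableSet] with x hx hxI
    rw [hG x hxI, hx]; simp
  filter_upwards [ae_restrict_of_ae (LocallyIntegrable.ae_hasDerivAt_integral hg),
    ae_restrict_mem ho.measurableSet] with x hx hxI
  have h1 := hx c
  have h2 : HasDerivAt (fun x => ∫ t in c..x, I.indicator g t) 0 x :=
    (hasDerivAt_const x (-u c)).congr_of_eventuallyEq
      (Filter.eventuallyEq_of_mem (ho.mem_nhds hxI) hconst)
  rw [indicator_of_mem hxI] at h1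
  exact h1.unique h2

theorem IsMode.ae_eq_zero {u d s : ℝ → ℂ} (h : IsMode u d s) (hu : u =ᵐ[volume] 0) :
    s =ᵐ[volume] 0 := by
  have hd : d =ᵐ[volume] 0 := by
    simpa using h.memH1.ae_eq_zero isOpen_univ ordConnected_univ (by simpa using hu)
  have key : ∀ I : Set ℝ, IsOpen I → I.OrdConnected → HasH1Deriv I d s →
      s =ᵐ[volume.restrict I] 0 := fun I ho hI hs => hs.ae_eq_zero ho hI (ae_restrict_of_ae hd)
  have : s =ᵐ[volume.restrict (Iio (-1)) + volume.restrict (Ioo (-1) 0) +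
      volume.restrict (Ioo 0 1) + volume.restrict (Ioi 1)] 0 := by
    simp only [Filter.EventuallyEq, ae_add_measure_iff]
    exact ⟨⟨⟨key _ isOpen_Iio ordConnected_Iio h.left,
      key _ isOpen_Ioo ordConnected_Ioo h.midLeft⟩,
      key _ isOpen_Ioo ordConnected_Ioo h.midRight⟩,
      key _ isOpen_Ioi ordConnected_Ioi h.right⟩
  rwa [← volume_restrict_pieces] at this

theorem coeff_add_ae {U V : L2R3} {p : ℕ × ℕ} {u v : ℝ → ℂ} (hu : u =ᵐ[volume] coeff p U)
    (hv : v =ᵐ[volume] coeff p V) : (fun x => u x + v x) =ᵐ[volume] coeff p (U + V) := by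
  rw [map_add]
  filter_upwards [hu, hv, Lp.coeFn_add (coeff p U) (coeff p V)] with x h1 h2 h3
  rw [h1, h2, h3, Pi.add_apply]

theorem coeff_smul_ae {U : L2R3} {p : ℕ × ℕ} {u : ℝ → ℂ} (hu : u =ᵐ[volume] coeff p U) (c : ℂ) :
    (fun x => c * u x) =ᵐ[volume] coeff p (c • U) := by
  rw [map_smul]
  filter_upwards [hu, Lp.coeFn_smul c (coeff p U)] with x h1 h2
  rw [h1, h2, Pi.smul_apply, smul_eq_mul]

section

variable {dir : Bool} {αp αm νp νm : ℝ}

theorem opGraph_add {U F V G : L2R3} (h : (U, F) ∈ opGraph dir αp αm νp νm)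
    (h' : (V, G) ∈ opGraph dir αp αm νp νm) : (U + V, F + G) ∈ opGraph dir αp αm νp νm := by
  obtain ⟨v, d, s, h, hP, hM, h0⟩ := h
  obtain ⟨w, e, t, h', hP', hM', h0'⟩ := h'
  refine ⟨fun p x => v p x + w p x, fun p x => d p x + e p x, fun p x => s p x + t p x,
    ⟨fun p => (h.mode p).add (h'.mode p), fun p => coeff_add_ae (h.repr p) (h'.repr p),
      fun p => ?_⟩, fun m n => ?_, fun m n => ?_, ?_⟩
  · refine Filter.EventuallyEq.trans ?_ (coeff_add_ae (h.image p) (h'.image p))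
    exact Eventually.of_forall fun x => by ring
  · convert (hP m n).add (hP' m n) using 1; ring
  · convert (hM m n).add (hM' m n) using 1; ring
  · cases dir with
    | true => exact fun p => by simp only [h0 p, h0' p, add_zero]
    | false => exact fun p => (h0 p).add ordConnected_Ioo (h0' p)

theorem opGraph_smul {U F : L2R3} (c : ℂ) (h : (U, F) ∈ opGraph dir αp αm νp νm) :
    (c • U, c • F) ∈ opGraph dir αp αm νp νm := by
  obtain ⟨v, d, s, h, hP, hM, h0⟩ := h
  refine ⟨fun p x => c * v p x, fun p x => c * d p x, fun p x => c * s p x,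
    ⟨fun p => (h.mode p).const_mul c, fun p => coeff_smul_ae (h.repr p) c,
      fun p => ?_⟩, fun m n => ?_, fun m n => ?_, ?_⟩
  · refine Filter.EventuallyEq.trans ?_ (coeff_smul_ae (h.image p) c)
    exact Eventually.of_forall fun x => by ring
  · convert (hP m n).const_mul c using 1; ring
  · convert (hM m n).const_mul c using 1; ring
  · cases dir with
    | true => exact fun p => by simp only [h0 p, mul_zero]
    | false => exact fun p => (h0 p).const_mul c

theorem opGraph_sub {U F V G : L2R3} (h : (U, F) ∈ opGraph dir αp αm νp νm)
    (h' : (V, G) ∈ opGraph dir αp αm νp νm) : (U - V, F - G) ∈ opGraph dir αp αm νp νm := by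
  simpa [sub_eq_add_neg] using opGraph_add h (opGraph_smul (-1) h')

theorem opGraph_eq_zero {F : L2R3} (h : (0, F) ∈ opGraph dir αp αm νp νm) : F = 0 := by
  obtain ⟨v, d, s, h, -, -, -⟩ := h
  refine eq_zero_of_coeff_eq_zero fun p => ?_
  have hv : v p =ᵐ[volume] 0 := by
    refine (h.repr p).trans ?_
    rw [map_zero]; exact Lp.coeFn_zero ℂ 2 volume
  refine Lp.ext ?_
  filter_upwards [h.image p, hv, (h.mode p).ae_eq_zero hv, Lp.coeFn_zero ℂ 2 volume]
    with x h1 h2 h3 h4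
  rw [← h1, h2, h3, h4]; simp

/-- Symmetry of (U, F + Λ U) with itself makes ⟨U, F + Λ U⟩ real, that is, Im Λ ‖U‖² = -Im ⟨U, F⟩.
-/
theorem norm_le_of_mem_opGraph {Λ : ℂ} {U F : L2R3}
    (h : (U, F + Λ • U) ∈ opGraph dir αp αm νp νm) : |Λ.im| * ‖U‖ ≤ ‖F‖ := by
  have h1 := opGraph_symmetric h h
  rw [inner_add_right, inner_add_left, inner_smul_right, inner_smul_left,
    ← inner_conj_symm F U, inner_self_eq_norm_sq_to_K] at h1
  have h2 := congrArg Complex.im h1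
  simp only [Complex.add_im, Complex.mul_im, Complex.conj_im, Complex.conj_re,
    Complex.coe_algebraMap, ← Complex.ofReal_pow, Complex.ofReal_re, Complex.ofReal_im] at h2
  have h3 : Λ.im * ‖U‖ ^ 2 = -(inner ℂ U F : ℂ).im := by linarith
  have h4 : |Λ.im| * ‖U‖ ^ 2 ≤ ‖U‖ * ‖F‖ := by
    rw [← abs_of_nonneg (sq_nonneg ‖U‖), ← abs_mul, h3, abs_neg]
    exact (Complex.abs_im_le_norm _).trans (norm_inner_le_norm U F)
  rcases eq_or_ne ‖U‖ 0 with h5 | h5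
  · rw [h5, mul_zero]; exact norm_nonneg _
  · refine le_of_mul_le_mul_right ?_ (lt_of_le_of_ne (norm_nonneg U) h5.symm)
    nlinarith

theorem eq_of_mem_opGraph {Λ : ℂ} (hΛ : Λ.im ≠ 0) {U V F : L2R3}
    (h : (U, F + Λ • U) ∈ opGraph dir αp αm νp νm)
    (h' : (V, F + Λ • V) ∈ opGraph dir αp αm νp νm) : U = V := by
  have h1 := opGraph_sub h h'
  have e : F + Λ • U - (F + Λ • V) = 0 + Λ • (U - V) := by rw [smul_sub]; abel
  rw [e] at h1
  have h2 := norm_le_of_mem_opGraph h1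
  rw [norm_zero] at h2
  have h3 : ‖U - V‖ ≤ 0 := by
    by_contra hcon
    have := mul_pos (abs_pos.2 hΛ) (not_le.1 hcon)
    linarith
  exact sub_eq_zero.1 (norm_le_zero_iff.1 h3)

variable (dir αp αm νp νm)

/-- The resolvent `(A - Λ)⁻¹` exists for nonreal `Λ`. -/
theorem exists_resolvent {Λ : ℂ} (hΛ : Λ.im ≠ 0) : ∃ R : L2R3 →L[ℂ] L2R3,
    ∀ F, (R F, F + Λ • R F) ∈ opGraph dir αp αm νp νm := by
  choose R hR using exists_mem_opGraph dir αp αm νp νm hΛ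
  let L : L2R3 →ₗ[ℂ] L2R3 :=
    { toFun := R
      map_add' := fun F G => eq_of_mem_opGraph hΛ (hR (F + G)) (by
        have := opGraph_add (hR F) (hR G)
        rwa [add_add_add_comm, ← smul_add] at this)
      map_smul' := fun c F => eq_of_mem_opGraph hΛ (hR (c • F)) (by
        have := opGraph_smul c (hR F)
        rwa [smul_add, smul_comm c Λ] at this) }
  refine ⟨L.mkContinuous |Λ.im|⁻¹ fun F => ?_, hR⟩
  rw [inv_mul_eq_div, le_div_iff₀' (abs_pos.2 hΛ)]
  exact norm_le_of_mem_opGraph (hR F)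

/-- The resolvent `(A - Λ)⁻¹`. -/
def resolvent (Λ : ℂ) : L2R3 →L[ℂ] L2R3 :=
  if hΛ : Λ.im ≠ 0 then (exists_resolvent dir αp αm νp νm hΛ).choose else 0

theorem resolvent_mem {Λ : ℂ} (hΛ : Λ.im ≠ 0) (F : L2R3) :
    (resolvent dir αp αm νp νm Λ F, F + Λ • resolvent dir αp αm νp νm Λ F) ∈
      opGraph dir αp αm νp νm := by
  rw [resolvent, dif_pos hΛ]
  exact (exists_resolvent dir αp αm νp νm hΛ).choose_spec F

theorem isResolventAt_resolvent {Λ : ℂ} (hΛ : Λ.im ≠ 0) :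
    IsResolventAt (opGraph dir αp αm νp νm) Λ (resolvent dir αp αm νp νm Λ) := by
  refine ⟨fun F G h => ?_, fun U F => ⟨fun h => ?_, fun h => ?_⟩⟩
  · have h1 := opGraph_sub (resolvent_mem dir αp αm νp νm hΛ F)
      (resolvent_mem dir αp αm νp νm hΛ G)
    rw [h, sub_self, add_sub_add_right_eq_sub] at h1
    exact sub_eq_zero.1 (opGraph_eq_zero h1)
  · refine eq_of_mem_opGraph hΛ (resolvent_mem dir αp αm νp νm hΛ _) ?_
    rwa [sub_add_cancel]
  · have := resolvent_mem dir αp αm νp νm hΛ (F - Λ • U)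
    rwa [h, sub_add_cancel] at this

theorem inner_resolvent {Λ : ℂ} (hΛ : Λ.im ≠ 0) (F G : L2R3) :
    inner ℂ (resolvent dir αp αm νp νm Λ F) G =
      inner ℂ F (resolvent dir αp αm νp νm (starRingEnd ℂ Λ) G) := by
  have h := opGraph_symmetric (resolvent_mem dir αp αm νp νm hΛ F)
    (resolvent_mem dir αp αm νp νm (Λ := starRingEnd ℂ Λ) (by simpa using hΛ) G)
  rw [inner_add_right, inner_add_left, inner_smul_right, inner_smul_left] at h
  exact add_right_cancel h

end

/-! ### A criterion for the trace class -/

section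

variable {H : Type*} [NormedAddCommGroup H] [InnerProductSpace ℂ H]

/-- The sums `∑ |⟨T e_i, V e_i⟩|` over finite parts of an orthonormal basis `(e_i)`, with a
contraction `V`, are bounded by `C`. -/
def HasTraceBound (T : H →L[ℂ] H) (C : ℝ) : Prop :=
  ∀ (w : Set H) (b : HilbertBasis w ℂ H) (V : H →L[ℂ] H), ‖V‖ ≤ 1 → ∀ s : Finset w,
    ∑ i ∈ s, ‖(inner ℂ (T (b i)) (V (b i)) : ℂ)‖ ≤ C

theorem HasTraceBound.add {S T : H →L[ℂ] H} {B C : ℝ} (h : HasTraceBound S B)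
    (h' : HasTraceBound T C) : HasTraceBound (S + T) (B + C) := fun w b V hV s => by
  refine le_trans ?_ (add_le_add (h w b V hV s) (h' w b V hV s))
  rw [← Finset.sum_add_distrib]
  refine Finset.sum_le_sum fun i _ => ?_
  rw [_root_.add_apply, inner_add_left]
  exact norm_add_le _ _

theorem HasTraceBound.neg {T : H →L[ℂ] H} {C : ℝ} (h : HasTraceBound T C) :
    HasTraceBound (-T) C := fun w b V hV s => by
  simpa only [_root_.neg_apply, inner_neg_left, norm_neg] using h w b V hV s

variable [CompleteSpace H]

/-- A bounded operator `T` has a modulus of the form `W T` with a contraction `W`. -/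
theorem exists_contraction_mul_eq_abs (T : H →L[ℂ] H) :
    ∃ W : H →L[ℂ] H, ‖W‖ ≤ 1 ∧ ∀ x, W (T x) = CFC.abs T x := by
  -- Since |T|² = T* T, the map T x ↦ |T| x is a well-defined isometry on the range of T. It extends
  -- to the closure, and W is the extension preceded by the orthogonal projection.
  have hnorm : ∀ x, ‖CFC.abs T x‖ = ‖T x‖ := fun x => by
    have hsa : IsSelfAdjoint (CFC.abs T) := (CFC.abs_nonneg T).isSelfAdjoint
    have h1 : inner ℂ (CFC.abs T x) (CFC.abs T x) = (inner ℂ (T x) (T x) : ℂ) := by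
      have h2 : CFC.abs T (CFC.abs T x) = (star T) (T x) := by
        rw [← mul_apply_eq_comp, CFC.abs_mul_abs, mul_apply_eq_comp]
      rw [← ContinuousLinearMap.adjoint_inner_right, hsa.adjoint_eq, h2,
        ContinuousLinearMap.star_eq_adjoint, ContinuousLinearMap.adjoint_inner_right]
    rw [inner_self_eq_norm_sq_to_K, inner_self_eq_norm_sq_to_K] at h1
    have h3 : ‖CFC.abs T x‖ ^ 2 = ‖T x‖ ^ 2 := by exact_mod_cast h1
    exact (sq_eq_sq₀ (norm_nonneg _) (norm_nonneg _)).1 h3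
  let K : Submodule ℂ H := (LinearMap.range T.toLinearMap).topologicalClosure
  have hT : ∀ x, T x ∈ K := fun x =>
    Submodule.le_topologicalClosure _ (LinearMap.mem_range_self T.toLinearMap x)
  let e : H →ₗ[ℂ] K := T.toLinearMap.codRestrict K hT
  have hd : DenseRange e := by
    intro y
    have hy : (y : H) ∈ closure (range T) := y.2
    rw [mem_closure_iff_seq_limit] at hy ⊢
    obtain ⟨z, hz, hlim⟩ := hy
    choose x hx using hz
    refine ⟨fun n => e (x n), fun n => mem_range_self _, ?_⟩
    rw [tendsto_subtype_rng]
    exact hlim.congr fun n => (hx n).symm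
  have hle : ∀ x, ‖(CFC.abs T).toLinearMap x‖ ≤ 1 * ‖e x‖ := fun x => by
    rw [one_mul]; exact (hnorm x).le
  have : CompleteSpace K := (Submodule.isClosed_topologicalClosure _).completeSpace_coe
  refine ⟨((CFC.abs T).toLinearMap.extendOfNorm e).comp K.orthogonalProjectionOnto, ?_, fun x => ?_⟩
  · refine ContinuousLinearMap.opNorm_le_bound _ zero_le_one fun x => ?_
    refine (LinearMap.norm_extendOfNorm_apply_le hd 1 hle _).trans ?_
    rw [one_mul, one_mul]
    exact K.norm_orthogonalProjectionOnto_apply_le x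
  · have h1 : K.orthogonalProjectionOnto (T x) = e x :=
      Submodule.orthogonalProjectionOnto_mem_subspace_eq_self (e x)
    rw [ContinuousLinearMap.comp_apply, h1]
    exact LinearMap.extendOfNorm_eq hd ⟨1, hle⟩ x

/-- With |T| = W T one has ⟨e, |T| e⟩ = ⟨W* e, T e⟩, so the arbitrary contraction V in
`HasTraceBound` is taken to be W*. Allowing every V keeps the bound additive in T, which fails for a
direct treatment of |T|. -/
theorem HasTraceBound.isTraceClass {T : H →L[ℂ] H} {C : ℝ} (h : HasTraceBound T C) :
    IsTraceClass T := by
  intro w b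
  obtain ⟨W, hW, hWT⟩ := exists_contraction_mul_eq_abs T
  have habs : ∀ i, 0 ≤ (inner ℂ (b i) (CFC.abs T (b i)) : ℂ).re := fun i =>
    (ContinuousLinearMap.nonneg_iff_isPositive _ |>.1 (CFC.abs_nonneg T)).re_inner_nonneg_right (b i)
  refine summable_of_sum_le (c := C) habs fun s => ?_
  refine le_trans (Finset.sum_le_sum fun i _ => ?_)
    (h w b (ContinuousLinearMap.adjoint W) (by simpa using hW) s)
  rw [← hWT, ContinuousLinearMap.adjoint_inner_right, ← norm_inner_symm]
  exact Complex.re_le_norm _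

/-- The functional is represented by a vector y of norm at most A, so φ ∘ V is represented by V* y,
and Bessel's inequality applies. -/
theorem sum_norm_sq_functional_le {φ : H →ₗ[ℂ] ℂ} {A : ℝ} (hA : 0 ≤ A)
    (hφ : ∀ x, ‖φ x‖ ≤ A * ‖x‖) {w : Set H} (b : HilbertBasis w ℂ H) {V : H →L[ℂ] H}
    (hV : ‖V‖ ≤ 1) (s : Finset w) : ∑ i ∈ s, ‖φ (V (b i))‖ ^ 2 ≤ A ^ 2 := by
  let φ' : StrongDual ℂ H := φ.mkContinuous A hφ
  set y := (InnerProductSpace.toDual ℂ H).symm φ'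
  have hy : ‖y‖ ≤ A := by
    simp only [y, LinearIsometryEquiv.norm_map]
    exact φ.mkContinuous_norm_le hA hφ
  have h1 : ∀ i, ‖φ (V (b i))‖ =
      ‖(inner ℂ (b i) (ContinuousLinearMap.adjoint V y) : ℂ)‖ := fun i => by
    rw [ContinuousLinearMap.adjoint_inner_right, ← norm_inner_symm]
    simp only [y, InnerProductSpace.toDual_symm_apply]
    rfl
  simp only [h1]
  refine (b.orthonormal.sum_inner_products_le _).trans ?_
  refine pow_le_pow_left₀ (norm_nonneg _) ?_ 2
  refine (ContinuousLinearMap.le_opNorm _ _).trans ?_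
  rw [LinearIsometryEquiv.norm_map]
  exact (mul_le_of_le_one_left (norm_nonneg _) hV).trans hy

/-- T is a sum of rank-one operators. After interchanging the sums, Cauchy–Schwarz in the basis
index and Bessel's inequality bound the p-th term by A p * B p. -/
theorem hasTraceBound_of_tsum {ι : Type*} {T : H →L[ℂ] H} {φ ψ : ι → H →ₗ[ℂ] ℂ} {A B : ι → ℝ}
    (hA : ∀ p, 0 ≤ A p) (hB : ∀ p, 0 ≤ B p) (hφ : ∀ p x, ‖φ p x‖ ≤ A p * ‖x‖)
    (hψ : ∀ p x, ‖ψ p x‖ ≤ B p * ‖x‖) (hs : Summable fun p => A p * B p)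
    (hT : ∀ x y, inner ℂ (T x) y = ∑' p, (starRingEnd ℂ) (φ p x) * ψ p y) :
    HasTraceBound T (∑' p, A p * B p) := by
  intro w b V hV s
  have hle : ∀ p x y, ‖(starRingEnd ℂ) (φ p x) * ψ p y‖ ≤ A p * B p * (‖x‖ * ‖y‖) := by
    intro p x y
    rw [norm_mul, RCLike.norm_conj]
    refine (mul_le_mul (hφ p x) (hψ p y) (norm_nonneg _)
      (mul_nonneg (hA p) (norm_nonneg _))).trans_eq ?_
    ring
  have hsum : ∀ x y, Summable fun p => ‖(starRingEnd ℂ) (φ p x) * ψ p y‖ := fun x y =>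
    Summable.of_nonneg_of_le (fun p => norm_nonneg _) (fun p => hle p x y) (hs.mul_right _)
  calc ∑ i ∈ s, ‖(inner ℂ (T (b i)) (V (b i)) : ℂ)‖
      ≤ ∑ i ∈ s, ∑' p, ‖(starRingEnd ℂ) (φ p (b i)) * ψ p (V (b i))‖ := by
        refine Finset.sum_le_sum fun i _ => ?_
        rw [hT]
        exact norm_tsum_le_tsum_norm (hsum _ _)
    _ = ∑' p, ∑ i ∈ s, ‖(starRingEnd ℂ) (φ p (b i)) * ψ p (V (b i))‖ :=
        (Summable.tsum_finsetSum fun i _ => hsum _ _).symm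
    _ ≤ ∑' p, A p * B p := by
        refine Summable.tsum_le_tsum (fun p => ?_) (summable_sum fun i _ => hsum _ _) hs
        have h1 := sum_norm_sq_functional_le (hA p) (hφ p) b (V := 1)
          ContinuousLinearMap.norm_id_le s
        have h2 := sum_norm_sq_functional_le (hB p) (hψ p) b hV s
        simp only [norm_mul, RCLike.norm_conj]
        refine (Real.sum_mul_le_sqrt_mul_sqrt s _ _).trans ?_
        exact mul_le_mul ((Real.sqrt_le_left (hA p)).2 h1) ((Real.sqrt_le_left (hB p)).2 h2)
          (Real.sqrt_nonneg _) (hA p)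

end

/-! ### Weighted estimates near the origin -/

/-- The square of the weight `exp (-κ x) - exp (-κ)` on the interval `(0, 1)`. -/
def weightSq (κ x : ℝ) : ℝ := (Real.exp (-(κ * x)) - Real.exp (-κ)) ^ 2

theorem continuous_weightSq (κ : ℝ) : Continuous (weightSq κ) := by
  unfold weightSq; fun_prop

theorem weightSq_nonneg (κ x : ℝ) : 0 ≤ weightSq κ x := sq_nonneg _

theorem weightSq_one (κ : ℝ) : weightSq κ 1 = 0 := by simp [weightSq]

theorem weightSq_le_one {κ x : ℝ} (hκ : 0 ≤ κ) (hx : x ∈ Ioo (0 : ℝ) 1) : weightSq κ x ≤ 1 := by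
  have h1 : Real.exp (-(κ * x)) ≤ 1 := Real.exp_le_one_iff.2 (by nlinarith [hx.1])
  have h2 : Real.exp (-κ) ≤ Real.exp (-(κ * x)) := Real.exp_le_exp.2 (by nlinarith [hx.2])
  have h3 := Real.exp_pos (-κ)
  unfold weightSq
  nlinarith

theorem hasDerivAt_weightSq (κ x : ℝ) : HasDerivAt (weightSq κ)
    (2 * (Real.exp (-(κ * x)) - Real.exp (-κ)) * -(κ * Real.exp (-(κ * x)))) x := by
  have h1 : HasDerivAt (fun x : ℝ => -(κ * x)) (-κ) x := by
    simpa using ((hasDerivAt_id' x).const_mul κ).fun_neg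
  have h2 := (h1.exp.sub_const (Real.exp (-κ))).pow 2
  refine h2.congr_deriv ?_
  push_cast
  ring

theorem integrable_weightSq_mul (κ : ℝ) {f : ℝ → ℂ} (hf : MemLp f 2 (volume.restrict (Ioo 0 1))) :
    Integrable (fun x => weightSq κ x * ‖f x‖ ^ 2) (volume.restrict (Ioo 0 1)) := by
  obtain ⟨C, hC⟩ := isCompact_Icc.exists_bound_of_continuousOn
    ((continuous_weightSq κ).continuousOn (s := Icc (0 : ℝ) 1))
  refine hf.norm.integrable_sq.bdd_mul (c := C)
    (continuous_weightSq κ).aestronglyMeasurable ?_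
  exact (ae_restrict_iff' measurableSet_Ioo).2 (Eventually.of_forall fun x hx =>
      hC x (Ioo_subset_Icc_self hx))

/-- Here E is the weight, -q its derivative, e₀ = e^{-κ}, and a, b, c stand for |u'|, |u|, |f|. Of
the term r E² b², the spectral parameter consumes at most r/8, the derivative of the weight r/8 and
the source r/4, leaving r/2. As q = κ (E + e₀) is not a multiple of E, an error with e₀² remains. -/
theorem weighted_pointwise {r q l a b c E e₀ κ x y : ℝ} (hr : 0 < r) (hl : 8 * l ≤ r)
    (hκ : 16 * κ ^ 2 ≤ r) (hq : q = κ * (E + e₀)) (hx : |x| ≤ a * b) (hy : y ≤ c * b) :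
    r / 2 * (E ^ 2 * b ^ 2) - r⁻¹ * (E ^ 2 * c ^ 2) - r / 8 * e₀ ^ 2 * b ^ 2 ≤
      2 * E * -q * x + E ^ 2 * ((r - l) * b ^ 2 - y) + E ^ 2 * a ^ 2 := by
  have h1 : -(E ^ 2 * a ^ 2 + q ^ 2 * b ^ 2) ≤ 2 * E * -q * x := by
    have h2 : |E * q * x| ≤ |E * q| * (a * b) := by
      rw [abs_mul]; exact mul_le_mul_of_nonneg_left hx (abs_nonneg _)
    have h3 : |E * q| = |E| * |q| := abs_mul _ _
    rw [h3] at h2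
    nlinarith [le_abs_self (E * q * x), sq_nonneg (|E| * a - |q| * b), sq_abs E, sq_abs q]
  have h2 : q ^ 2 * b ^ 2 ≤ r / 8 * (E ^ 2 + e₀ ^ 2) * b ^ 2 := by
    refine mul_le_mul_of_nonneg_right ?_ (sq_nonneg b)
    have h3 : (E + e₀) ^ 2 ≤ 2 * (E ^ 2 + e₀ ^ 2) := by nlinarith [sq_nonneg (E - e₀)]
    calc q ^ 2 = κ ^ 2 * (E + e₀) ^ 2 := by rw [hq]; ring
      _ ≤ r / 16 * (2 * (E ^ 2 + e₀ ^ 2)) := by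
        refine mul_le_mul (by linarith) h3 (sq_nonneg _) (by linarith)
      _ = _ := by ring
  have h3 : y ≤ r⁻¹ * c ^ 2 + r / 4 * b ^ 2 := by
    refine hy.trans ?_
    have h4 : r⁻¹ * c ^ 2 + r / 4 * b ^ 2 - c * b = r⁻¹ * (c - r / 2 * b) ^ 2 := by
      field_simp; ring
    have : 0 ≤ r⁻¹ * (c - r / 2 * b) ^ 2 := by positivity
    linarith
  have h4 := mul_le_mul_of_nonneg_left h3 (sq_nonneg E)
  have h5 := mul_le_mul_of_nonneg_right hl (mul_nonneg (sq_nonneg E) (sq_nonneg b))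
  nlinarith

/-- The equation is multiplied by the squared weight times conj u and integrated over (0, 1). The
weight vanishes at 1, so the unknown data at the interface do not enter; only the boundary term at 0
stays. -/
theorem weighted_energy_half {u d s f : ℝ → ℂ} {κ r : ℝ} {Λ A D : ℂ}
    (hu : HasH1Deriv (Ioo 0 1) u d) (hd : HasH1Deriv (Ioo 0 1) d s)
    (hf : MemLp f 2 (volume.restrict (Ioo 0 1)))
    (heq : ∀ᵐ x ∂volume.restrict (Ioo (0 : ℝ) 1), -s x + (r : ℂ) * u x = f x + Λ * u x)
    (hA : Tendsto u (𝓝[>] 0) (𝓝 A)) (hD : Tendsto d (𝓝[>] 0) (𝓝 D)) (hr : 0 < r)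
    (hΛ : 8 * ‖Λ‖ ≤ r) (hκ : 16 * κ ^ 2 ≤ r) :
    r / 2 * (∫ x in Ioo 0 1, weightSq κ x * ‖u x‖ ^ 2) +
        weightSq κ 0 * (D * (starRingEnd ℂ) A).re ≤
      r⁻¹ * (∫ x in Ioo 0 1, weightSq κ x * ‖f x‖ ^ 2) +
        r / 8 * Real.exp (-κ) ^ 2 * ∫ x in Ioo 0 1, ‖u x‖ ^ 2 := by
  set E : ℝ → ℝ := fun x => Real.exp (-(κ * x)) - Real.exp (-κ)
  set q : ℝ → ℝ := fun x => κ * Real.exp (-(κ * x))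
  have hφ : ∀ x : ℝ, HasDerivAt (fun x : ℝ => ((weightSq κ x : ℝ) : ℂ))
      ((2 * E x * -q x : ℝ) : ℂ) x := fun x => (hasDerivAt_weightSq κ x).ofReal_comp
  have hφ' : Continuous fun x : ℝ => ((2 * E x * -q x : ℝ) : ℂ) := by
    simp only [E, q]; fun_prop
  have hφc : Continuous fun x : ℝ => ((weightSq κ x : ℝ) : ℂ) :=
    Complex.continuous_ofReal.comp (continuous_weightSq κ)
  have hP := (hd.smooth_mul hφ hφ').mul ordConnected_Ioo hu.conj
  obtain ⟨-, A', -, hA'⟩ := hu.exists_limits_Ioo one_pos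
  obtain ⟨-, D', -, hD'⟩ := hd.exists_limits_Ioo one_pos
  have hint := hP.integral_Ioo one_pos
    (((hφc.continuousWithinAt (s := Ioi 0)).tendsto.mul hD).mul
      ((Complex.continuous_conj.tendsto A).comp hA))
    (((hφc.continuousWithinAt (s := Iio 1)).tendsto.mul hD').mul
      ((Complex.continuous_conj.tendsto A').comp hA'))
  rw [weightSq_one, Complex.ofReal_zero, zero_mul, zero_mul, zero_sub] at hint
  have hre := congrArg Complex.re hint
  have hre2 := integral_re (𝕜 := ℂ) hP.1
  simp only [RCLike.re_to_complex] at hre2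
  rw [← hre2, Complex.neg_re, mul_assoc, Complex.re_ofReal_mul] at hre
  have i1 := integrable_weightSq_mul κ hu.1
  have i2 := integrable_weightSq_mul κ hf
  have i3 : Integrable (fun x => ‖u x‖ ^ 2) (volume.restrict (Ioo 0 1)) := hu.1.norm.integrable_sq
  have hle := integral_mono_ae (((i1.const_mul (r / 2)).sub (i2.const_mul r⁻¹)).sub
    (i3.const_mul (r / 8 * Real.exp (-κ) ^ 2))) hP.1.re (by
      filter_upwards [heq] with x hx
      have hs : s x = (r : ℂ) * u x - f x - Λ * u x := by linear_combination -hx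
      have hpt := weighted_pointwise (r := r) (q := q x) (l := Λ.re) (a := ‖d x‖) (b := ‖u x‖)
        (c := ‖f x‖) (E := E x) (e₀ := Real.exp (-κ)) (κ := κ)
        (x := (d x * (starRingEnd ℂ) (u x)).re) (y := (f x * (starRingEnd ℂ) (u x)).re) hr
        (by linarith [Complex.re_le_norm Λ]) hκ (by simp only [E, q]; ring)
        ((Complex.abs_re_le_norm _).trans_eq (by rw [norm_mul, RCLike.norm_conj]))
        ((Complex.re_le_norm _).trans_eq (by rw [norm_mul, RCLike.norm_conj]))
      refine le_trans (le_of_eq ?_) (hpt.trans (le_of_eq ?_))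
      · simp only [Pi.sub_apply, weightSq, E]
      · rw [RCLike.re_to_complex, hs]
        have hw : weightSq κ x = E x ^ 2 := rfl
        rw [hw, ← Complex.normSq_eq_norm_sq, ← Complex.normSq_eq_norm_sq, Complex.normSq_apply,
          Complex.normSq_apply]
        simp only [Complex.add_re, Complex.mul_re, Complex.sub_re, Complex.mul_im, Complex.add_im,
          Complex.sub_im, Complex.ofReal_re, Complex.ofReal_im, Complex.conj_re, Complex.conj_im]
        ring)
  rw [integral_sub' ((i1.const_mul (r / 2)).sub (i2.const_mul r⁻¹))
    (i3.const_mul (r / 8 * Real.exp (-κ) ^ 2)), integral_sub' (i1.const_mul (r / 2))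
    (i2.const_mul r⁻¹), integral_const_mul, integral_const_mul, integral_const_mul] at hle
  simp only [RCLike.re_to_complex] at hle
  linarith

/-- The weighted square norm near the origin. -/
def localNormSq (κ : ℝ) (f : ℝ → ℂ) : ℝ :=
  (∫ x in Ioo 0 1, weightSq κ x * ‖f x‖ ^ 2) + ∫ x in Ioo 0 1, weightSq κ x * ‖f (-x)‖ ^ 2

theorem memLp_comp_neg {f : ℝ → ℂ} (hf : MemLp f 2 volume) : MemLp (fun x => f (-x)) 2 volume :=
  hf.comp_measurePreserving (Measure.measurePreserving_neg volume)

theorem setIntegral_add_comp_neg_le {f : ℝ → ℂ} (hf : MemLp f 2 volume) :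
    (∫ x in Ioo 0 1, ‖f x‖ ^ 2) + (∫ x in Ioo 0 1, ‖f (-x)‖ ^ 2) ≤ ∫ x, ‖f x‖ ^ 2 := by
  have hi : Integrable fun x => ‖f x‖ ^ 2 := hf.norm.integrable_sq
  rw [setIntegral_Ioo_comp_neg (fun x => ‖f x‖ ^ 2), ← setIntegral_union ?_ measurableSet_Ioo
    hi.integrableOn hi.integrableOn]
  · exact setIntegral_le_integral hi (Eventually.of_forall fun x => by positivity)
  · rw [Set.disjoint_left]; intro x h h'; simp only [mem_Ioo] at h h'; linarith [h.1, h'.2]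

theorem localNormSq_nonneg (κ : ℝ) (f : ℝ → ℂ) : 0 ≤ localNormSq κ f :=
  add_nonneg (integral_nonneg fun x => mul_nonneg (weightSq_nonneg _ _) (by positivity))
    (integral_nonneg fun x => mul_nonneg (weightSq_nonneg _ _) (by positivity))

theorem localNormSq_le {κ : ℝ} (hκ : 0 ≤ κ) {f : ℝ → ℂ} (hf : MemLp f 2 volume) :
    localNormSq κ f ≤ ∫ x, ‖f x‖ ^ 2 := by
  refine le_trans ?_ (setIntegral_add_comp_neg_le hf)
  have key : ∀ g : ℝ → ℂ, MemLp g 2 volume →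
      ∫ x in Ioo 0 1, weightSq κ x * ‖g x‖ ^ 2 ≤ ∫ x in Ioo 0 1, ‖g x‖ ^ 2 := fun g hg => by
    refine integral_mono_ae (integrable_weightSq_mul κ (hg.restrict _))
      (hg.restrict _).norm.integrable_sq ?_
    filter_upwards [ae_restrict_mem measurableSet_Ioo] with x hx
    exact mul_le_of_le_one_left (by positivity) (weightSq_le_one hκ hx)
  exact add_le_add (key f hf) (key _ (memLp_comp_neg hf))

theorem ae_comp_neg {P : ℝ → Prop} (h : ∀ᵐ x, P x) : ∀ᵐ x : ℝ, P (-x) :=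
  (Measure.measurePreserving_neg (volume : Measure ℝ)).quasiMeasurePreserving.ae h

/-- The two halves are added after reflecting the left one. Their boundary terms combine to Re(j ·
conj u(0)), which vanishes under either origin condition. -/
theorem IsMode.weighted_energy {u d s f : ℝ → ℂ} (h : IsMode u d s) {κ r : ℝ} {Λ j : ℂ}
    (hf : MemLp f 2 volume) (heq : ∀ᵐ x, -s x + (r : ℂ) * u x = f x + Λ * u x)
    (hj : HasJump d 0 j) (h0 : u 0 = 0 ∨ j = 0) (hr : 0 < r) (hΛ : 8 * ‖Λ‖ ≤ r)
    (hκ : 16 * κ ^ 2 ≤ r) :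
    localNormSq κ u ≤ 2 * r⁻¹ ^ 2 * localNormSq κ f +
      Real.exp (-κ) ^ 2 / 4 * ∫ x, ‖u x‖ ^ 2 := by
  obtain ⟨D, D', hD, hD', rfl⟩ := hj
  have h1 := weighted_energy_half (κ := κ) (h.1.mono (subset_univ _)) h.midRight (hf.restrict _)
    (ae_restrict_of_ae heq) h.continuous.continuousWithinAt hD hr hΛ hκ
  have hu' := (h.1.mono (subset_univ (Ioo (-1) 0))).comp_neg_Ioo
  have hd' := h.midLeft.comp_neg_Ioo.neg
  simp only [neg_zero, neg_neg] at hu' hd'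
  have hD2 := (tendsto_comp_neg_right hD').neg
  rw [neg_zero] at hD2
  have h2 := weighted_energy_half (κ := κ) hu' hd' ((memLp_comp_neg hf).restrict _)
    (ae_restrict_of_ae (ae_comp_neg heq))
    (h.continuous.comp continuous_neg).continuousWithinAt hD2 hr hΛ hκ
  have h3 : (D * (starRingEnd ℂ) (u 0)).re + (-D' * (starRingEnd ℂ) (u 0)).re = 0 := by
    rw [← Complex.add_re, ← add_mul, ← sub_eq_add_neg]
    rcases h0 with h0 | h0 <;> simp [h0]
  simp only [Function.comp_apply, neg_zero] at h2
  have h4 := setIntegral_add_comp_neg_le h.memLp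
  have h5 : r / 2 * localNormSq κ u ≤ r⁻¹ * localNormSq κ f +
      r / 8 * Real.exp (-κ) ^ 2 * ∫ x, ‖u x‖ ^ 2 := by
    have h6 : (0 : ℝ) ≤ r / 8 * Real.exp (-κ) ^ 2 := by positivity
    have h7 := mul_le_mul_of_nonneg_left h4 h6
    unfold localNormSq
    linear_combination h1 + h2 + h7 - weightSq κ 0 * h3
  have h6 := mul_le_mul_of_nonneg_left h5 (show 0 ≤ 2 * r⁻¹ by positivity)
  have e : 2 * r⁻¹ * (r / 2 * localNormSq κ u) = localNormSq κ u := by field_simp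
  rw [e] at h6
  refine h6.trans (le_of_eq ?_)
  field_simp
  ring

/-! ### Traces at the origin -/

/-- With κ = δ k one has κ x ≤ δ/2 on this interval, and e^{-κ} ≤ e^{-δ}; so the weight is bounded
below uniformly in k ≥ 1. -/
theorem sub_sq_le_weightSq {δ k x : ℝ} (hδ : 0 ≤ δ) (hk : 1 ≤ k) (hx : x ∈ Ioo 0 (1 / (2 * k))) :
    (Real.exp (-(δ / 2)) - Real.exp (-δ)) ^ 2 ≤ weightSq (δ * k) x := by
  have hk0 : 0 < k := by linarith
  have h1 : k * x ≤ 1 / 2 := by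
    have := hx.2.le
    rw [le_div_iff₀ (by positivity)] at this
    linarith
  refine pow_le_pow_left₀ (sub_nonneg.2 (Real.exp_le_exp.2 (by linarith))) ?_ 2
  refine sub_le_sub (Real.exp_le_exp.2 ?_) (Real.exp_le_exp.2 ?_)
  · nlinarith
  · nlinarith

/-- The constant in the trace inequalities. -/
def traceConst (c δ : ℝ) (Λ : ℂ) : ℝ :=
  (2 * (c + ‖Λ‖) ^ 2 + 576) / (Real.exp (-(δ / 2)) - Real.exp (-δ)) ^ 2

theorem traceConst_nonneg (c δ : ℝ) (Λ : ℂ) : 0 ≤ traceConst c δ Λ := by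
  unfold traceConst; positivity

theorem setIntegral_le_weighted {g : ℝ → ℂ} (hg : MemLp g 2 (volume.restrict (Ioo 0 1))) {δ k : ℝ}
    (hδ : 0 < δ) (hk : 1 ≤ k) :
    (Real.exp (-(δ / 2)) - Real.exp (-δ)) ^ 2 * (∫ x in Ioo 0 (1 / (2 * k)), ‖g x‖ ^ 2) ≤
      ∫ x in Ioo 0 1, weightSq (δ * k) x * ‖g x‖ ^ 2 := by
  have hsub : Ioo (0 : ℝ) (1 / (2 * k)) ⊆ Ioo 0 1 := by
    refine Ioo_subset_Ioo_right ?_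
    rw [div_le_one (by linarith)]; linarith
  have hw := integrable_weightSq_mul (δ * k) hg
  have hg2 : Integrable (fun x => ‖g x‖ ^ 2) (volume.restrict (Ioo 0 (1 / (2 * k)))) :=
    (hg.mono_measure (Measure.restrict_mono hsub le_rfl)).norm.integrable_sq
  rw [← integral_const_mul]
  refine (integral_mono_ae (hg2.const_mul _) (hw.mono_measure (Measure.restrict_mono hsub le_rfl))
    ?_).trans (setIntegral_mono_set hw ?_ (Eventually.of_forall hsub))
  · filter_upwards [ae_restrict_mem measurableSet_Ioo] with x hx
    exact mul_le_mul_of_nonneg_right (sub_sq_le_weightSq hδ.le hk hx) (by positivity)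
  · exact Eventually.of_forall fun x => mul_nonneg (weightSq_nonneg _ _) (by positivity)

/-- The trace inequalities on an interval of length 1/(2k), where the weight is bounded below. The
powers of k come from s = (r - Λ) u - f with r of order k², and 576 is 72/h³ at h = 1/(2k), divided
by k³. -/
theorem half_trace_le {u d s f : ℝ → ℂ} {c δ k r : ℝ} {Λ A D : ℂ}
    (hu : HasH1Deriv (Ioo 0 1) u d) (hd : HasH1Deriv (Ioo 0 1) d s)
    (hf : MemLp f 2 (volume.restrict (Ioo 0 1)))
    (heq : ∀ᵐ x ∂volume.restrict (Ioo (0 : ℝ) 1), -s x + (r : ℂ) * u x = f x + Λ * u x)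
    (hA : Tendsto u (𝓝[>] 0) (𝓝 A)) (hD : Tendsto d (𝓝[>] 0) (𝓝 D)) (hδ : 0 < δ) (hk : 1 ≤ k)
    (hr0 : 0 ≤ r) (hr : r ≤ c * k ^ 2) :
    ‖A‖ ^ 2 ≤ traceConst c δ Λ * (k * (∫ x in Ioo 0 1, weightSq (δ * k) x * ‖u x‖ ^ 2) +
        k⁻¹ ^ 3 * ∫ x in Ioo 0 1, weightSq (δ * k) x * ‖f x‖ ^ 2) ∧
      ‖D‖ ^ 2 ≤ traceConst c δ Λ * (k ^ 3 * (∫ x in Ioo 0 1, weightSq (δ * k) x * ‖u x‖ ^ 2) +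
        k⁻¹ * ∫ x in Ioo 0 1, weightSq (δ * k) x * ‖f x‖ ^ 2) := by
  have hk0 : 0 < k := by linarith
  set h := 1 / (2 * k) with hh
  have hh0 : 0 < h := by positivity
  have hsub : Ioo (0 : ℝ) (0 + h) ⊆ Ioo 0 1 := by
    refine Ioo_subset_Ioo_right ?_
    rw [zero_add, hh, div_le_one (by linarith)]; linarith
  have hP := setIntegral_le_weighted hu.1 hδ hk
  have hQ := setIntegral_le_weighted hf hδ hk
  have hA' := norm_sq_value_le hh0 (hu.mono hsub) (hd.mono hsub) hA
  have hD' := norm_sq_deriv_le hh0 (hu.mono hsub) (hd.mono hsub) hD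
  simp only [zero_add] at hA' hD' hsub
  set P := ∫ x in Ioo 0 h, ‖u x‖ ^ 2
  set Q := ∫ x in Ioo 0 h, ‖f x‖ ^ 2
  set S := ∫ x in Ioo 0 h, ‖s x‖ ^ 2
  set P' := ∫ x in Ioo 0 1, weightSq (δ * k) x * ‖u x‖ ^ 2
  set Q' := ∫ x in Ioo 0 1, weightSq (δ * k) x * ‖f x‖ ^ 2
  set B := 2 * (c + ‖Λ‖) ^ 2 with hB
  set e := (Real.exp (-(δ / 2)) - Real.exp (-δ)) ^ 2 with he
  have he0 : 0 < e := by
    refine pow_pos (sub_pos.2 (Real.exp_lt_exp.2 ?_)) 2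
    linarith
  have hP0 : 0 ≤ P := integral_nonneg fun x => by positivity
  have hQ0 : 0 ≤ Q := integral_nonneg fun x => by positivity
  have hB0 : 0 ≤ B := by positivity
  have hm := Measure.restrict_mono hsub (le_refl (volume : Measure ℝ))
  have iu : Integrable (fun x => ‖u x‖ ^ 2) (volume.restrict (Ioo 0 h)) :=
    (hu.1.mono_measure hm).norm.integrable_sq
  have if' : Integrable (fun x => ‖f x‖ ^ 2) (volume.restrict (Ioo 0 h)) :=
    (hf.mono_measure hm).norm.integrable_sq
  have is : Integrable (fun x => ‖s x‖ ^ 2) (volume.restrict (Ioo 0 h)) :=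
    (hd.2.1.mono_measure hm).norm.integrable_sq
  have hk2 : 1 ≤ k ^ 2 := one_le_pow₀ hk
  have hS : S ≤ B * k ^ 4 * P + 2 * Q := by
    simp only [S, P, Q]
    rw [← integral_const_mul, ← integral_const_mul,
      ← integral_add (iu.const_mul _) (if'.const_mul _)]
    refine integral_mono_ae is ((iu.const_mul _).add (if'.const_mul _)) ?_
    filter_upwards [ae_restrict_of_ae_restrict_of_subset hsub heq] with x hx
    have e1 : s x = ((r : ℂ) - Λ) * u x - f x := by linear_combination -hx
    have h1 : ‖(r : ℂ) - Λ‖ ≤ (c + ‖Λ‖) * k ^ 2 := by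
      refine (norm_sub_le _ _).trans ?_
      rw [Complex.norm_real, Real.norm_of_nonneg hr0]
      nlinarith [norm_nonneg Λ]
    have h2 : ‖s x‖ ≤ (c + ‖Λ‖) * k ^ 2 * ‖u x‖ + ‖f x‖ := by
      rw [e1]
      refine (norm_sub_le _ _).trans ?_
      rw [norm_mul]
      gcongr
    have h3 : ‖s x‖ ^ 2 ≤ ((c + ‖Λ‖) * k ^ 2 * ‖u x‖ + ‖f x‖) ^ 2 :=
      pow_le_pow_left₀ (norm_nonneg _) h2 2
    rw [hB]
    nlinarith [sq_nonneg ((c + ‖Λ‖) * k ^ 2 * ‖u x‖ - ‖f x‖)]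
  have hconst : ∀ a b : ℝ, 0 ≤ a → 0 ≤ b →
      (B + 576) * (a * P + b * Q) ≤ traceConst c δ Λ * (a * P' + b * Q') := by
    intro a b ha hb
    have h1 : e * (a * P + b * Q) ≤ a * P' + b * Q' := by
      linear_combination a * hP + b * hQ
    have h2 := mul_le_mul_of_nonneg_left h1 (show 0 ≤ (B + 576) / e by positivity)
    refine le_trans (le_of_eq ?_) h2
    field_simp
  have k1 : h = k⁻¹ / 2 := by rw [hh]; field_simp
  have k2 : k⁻¹ * k = 1 := inv_mul_cancel₀ hk0.ne'
  have ki : 0 < k⁻¹ := inv_pos.2 hk0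
  refine ⟨le_trans ?_ (hconst k (k⁻¹ ^ 3) hk0.le (by positivity)),
    le_trans ?_ (hconst (k ^ 3) k⁻¹ (by positivity) ki.le)⟩
  · refine hA'.trans ((add_le_add_left (mul_le_mul_of_nonneg_left hS (by positivity)) _).trans ?_)
    have e1 : 32 / h = 64 * k := by rw [hh]; field_simp; norm_num
    have e2 : 2 * h ^ 3 * (B * k ^ 4 * P + 2 * Q) = B / 4 * k * P + k⁻¹ ^ 3 / 2 * Q := by
      rw [hh]; field_simp; ring
    rw [e1, e2]
    have h1 : 0 ≤ k * P := by positivity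
    have h2 : 0 ≤ k⁻¹ ^ 3 * Q := by positivity
    have h3 := mul_nonneg hB0 h1
    have h4 := mul_nonneg hB0 h2
    linarith
  · refine hD'.trans ((add_le_add_left (mul_le_mul_of_nonneg_left hS (by positivity)) _).trans ?_)
    have e1 : 72 / h ^ 3 = 576 * k ^ 3 := by rw [hh]; field_simp; norm_num
    have e2 : 2 * h * (B * k ^ 4 * P + 2 * Q) = B * k ^ 3 * P + 2 * k⁻¹ * Q := by
      rw [hh]; field_simp
    rw [e1, e2]
    have h1 : 0 ≤ k ^ 3 * P := by positivity
    have h2 : 0 ≤ k⁻¹ * Q := by positivity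
    have h4 := mul_nonneg hB0 h2
    linarith

theorem IsMode.origin_trace_le {u d s f : ℝ → ℂ} (h : IsMode u d s) {c δ k r : ℝ} {Λ j : ℂ}
    (hf : MemLp f 2 volume) (heq : ∀ᵐ x, -s x + (r : ℂ) * u x = f x + Λ * u x)
    (hj : HasJump d 0 j) (hδ : 0 < δ) (hk : 1 ≤ k) (hr0 : 0 ≤ r)
    (hr : r ≤ c * k ^ 2) :
    ‖u 0‖ ^ 2 ≤ traceConst c δ Λ *
        (k * localNormSq (δ * k) u + k⁻¹ ^ 3 * localNormSq (δ * k) f) ∧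
      ‖j‖ ^ 2 ≤ 2 * traceConst c δ Λ *
        (k ^ 3 * localNormSq (δ * k) u + k⁻¹ * localNormSq (δ * k) f) := by
  obtain ⟨D, D', hD, hD', rfl⟩ := hj
  have h1 := half_trace_le (h.1.mono (subset_univ _)) h.midRight (hf.restrict _)
    (ae_restrict_of_ae heq) h.continuous.continuousWithinAt hD hδ hk hr0 hr
  have hu' := (h.1.mono (subset_univ (Ioo (-1) 0))).comp_neg_Ioo
  have hd' := h.midLeft.comp_neg_Ioo.neg
  simp only [neg_zero, neg_neg] at hu' hd'
  have hD2 := (tendsto_comp_neg_right hD').neg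
  rw [neg_zero] at hD2
  have h2 := half_trace_le hu' hd' ((memLp_comp_neg hf).restrict _)
    (ae_restrict_of_ae (ae_comp_neg heq))
    (h.continuous.comp continuous_neg).continuousWithinAt hD2 hδ hk hr0 hr
  have hk0 : 0 < k := by linarith
  have hT := traceConst_nonneg c δ Λ
  have key : ∀ g : ℝ → ℂ, 0 ≤ ∫ x in Ioo 0 1, weightSq (δ * k) x * ‖g x‖ ^ 2 := fun g =>
    integral_nonneg fun x => mul_nonneg (weightSq_nonneg _ _) (by positivity)
  refine ⟨h1.1.trans (mul_le_mul_of_nonneg_left (add_le_add ?_ ?_) hT), ?_⟩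
  · exact mul_le_mul_of_nonneg_left (le_add_of_nonneg_right (key _)) hk0.le
  · exact mul_le_mul_of_nonneg_left (le_add_of_nonneg_right (key _)) (by positivity)
  · have h3 := norm_sub_le D D'
    have h4 := h1.2
    have h5 := h2.2
    rw [norm_neg] at h5
    have h6 : ‖D - D'‖ ^ 2 ≤ 2 * ‖D‖ ^ 2 + 2 * ‖D'‖ ^ 2 := by
      have := pow_le_pow_left₀ (norm_nonneg _) h3 2
      nlinarith [sq_nonneg (‖D‖ - ‖D'‖)]
    unfold localNormSq
    linear_combination h6 + 2 * h4 + 2 * h5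

/-! ### Decay of the coefficients near the origin -/

theorem localNormSq_congr {κ : ℝ} {f g : ℝ → ℂ} (h : f =ᵐ[volume] g) :
    localNormSq κ f = localNormSq κ g := by
  unfold localNormSq
  congr 1
  · exact integral_congr_ae (by filter_upwards [ae_restrict_of_ae h] with x hx; rw [hx])
  · exact integral_congr_ae (by
      filter_upwards [ae_restrict_of_ae (ae_comp_neg h)] with x hx; rw [hx])

/-- The exponent of the weight, relative to `√(m + n + 1)`. -/
def decayRate (νp νm : ℝ) : ℝ := min νp νm / 4

theorem decayRate_pos {νp νm : ℝ} (hp : 0 < νp) (hm : 0 < νm) : 0 < decayRate νp νm := by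
  unfold decayRate; positivity

/-- This is the requirement 16 κ² ≤ r of the weighted energy estimate with κ = δ k; the factor 1/4
in `decayRate` is chosen for it. -/
theorem decayRate_le_rCoeff {νp νm : ℝ} (hp : 0 < νp) (hm : 0 < νm) (p : ℕ × ℕ) :
    16 * (decayRate νp νm * rootIndex p) ^ 2 ≤ rCoeff νp νm p.1 p.2 := by
  have h1 : min νp νm ^ 2 ≤ νp ^ 2 := pow_le_pow_left₀ (le_min hp.le hm.le) (min_le_left _ _) 2
  have h2 : min νp νm ^ 2 ≤ νm ^ 2 := pow_le_pow_left₀ (le_min hp.le hm.le) (min_le_right _ _) 2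
  have h3 : (0 : ℝ) ≤ p.1 := Nat.cast_nonneg _
  have h4 : (0 : ℝ) ≤ p.2 := Nat.cast_nonneg _
  rw [mul_pow, rootIndex_sq, rCoeff, decayRate]
  nlinarith

/-- The operator `T` makes the local norms of the coefficients near the origin decay like the
power `-4 n` of `√(m + n + 1)`. -/
def HasLocalDecay (νp νm : ℝ) (n : ℕ) (T : L2R3 →L[ℂ] L2R3) : Prop :=
  ∃ C, 0 ≤ C ∧ ∀ p F, localNormSq (decayRate νp νm * rootIndex p) (coeff p (T F)) ≤
    C * (rootIndex p)⁻¹ ^ (4 * n) * ‖F‖ ^ 2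

theorem localNormSq_coeff_le {νp νm : ℝ} (hp : 0 < νp) (hm : 0 < νm) (T : L2R3 →L[ℂ] L2R3)
    (p : ℕ × ℕ) (F : L2R3) :
    localNormSq (decayRate νp νm * rootIndex p) (coeff p (T F)) ≤ ‖T‖ ^ 2 * ‖F‖ ^ 2 := by
  have h1 := one_le_rootIndex p
  refine (localNormSq_le (mul_nonneg (decayRate_pos hp hm).le (by linarith)) (Lp.memLp _)).trans ?_
  rw [← norm_sq_eq_integral, ← mul_pow]
  exact pow_le_pow_left₀ (norm_nonneg _) ((norm_coeff_le _ p).trans (T.le_opNorm F)) 2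

theorem hasLocalDecay_zero {νp νm : ℝ} (hp : 0 < νp) (hm : 0 < νm) (T : L2R3 →L[ℂ] L2R3) :
    HasLocalDecay νp νm 0 T :=
  ⟨‖T‖ ^ 2, by positivity, fun p F => by simpa using localNormSq_coeff_le hp hm T p F⟩

theorem IsExpansion.equation {νp νm : ℝ} {Λ : ℂ} {U F : L2R3} {v d s : ℕ × ℕ → ℝ → ℂ}
    (h : IsExpansion νp νm U (F + Λ • U) v d s) (p : ℕ × ℕ) :
    ∀ᵐ x, -s p x + ((rCoeff νp νm p.1 p.2 : ℝ) : ℂ) * v p x = coeff p F x + Λ * v p x := by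
  filter_upwards [h.image p, coeff_add_ae (Filter.EventuallyEq.refl _ (coeff p F))
    (coeff_smul_ae (h.repr p) Λ)] with x h1 h2
  rw [h1, ← h2]

theorem OriginCondition.zero_or {dir : Bool} {v d s : ℕ × ℕ → ℝ → ℂ}
    (h : OriginCondition dir v d s) {p : ℕ × ℕ} {j : ℂ} (hj : HasJump (d p) 0 j) :
    v p 0 = 0 ∨ j = 0 := by
  cases dir with
  | true => exact Or.inl (h p)
  | false => exact Or.inr (hj.unique (h.hasJump p))

/-- The error of the energy estimate must be as small as the gain. Three resolvents ask for the
power 4 · 3 = 12, taken from one term of the exponential series. -/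
theorem exp_neg_sq_le {δ k : ℝ} (hδ : 0 < δ) (hk : 0 < k) :
    Real.exp (-(δ * k)) ^ 2 ≤ (Nat.factorial 12) / (2 * δ) ^ 12 * k⁻¹ ^ 12 := by
  have h1 := Real.pow_div_factorial_le_exp (2 * δ * k) (by positivity) 12
  have h2 : Real.exp (-(δ * k)) ^ 2 = (Real.exp (2 * δ * k))⁻¹ := by
    rw [← Real.exp_neg, ← Real.exp_nat_mul]; congr 1; push_cast; ring
  rw [h2]
  refine (inv_anti₀ (by positivity) h1).trans_eq ?_
  rw [inv_div, mul_pow _ k, inv_pow]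
  field_simp

/-- The weighted energy estimate gains r⁻², of order k⁻⁴, over the source T F; its exponential error
is controlled by the operator norm of the product. The origin condition may differ from those of the
resolvents inside T. -/
theorem HasLocalDecay.resolvent {νp νm : ℝ} (hp : 0 < νp) (hm : 0 < νm) (dir : Bool) (αp αm : ℝ)
    {Λ : ℂ} (hΛ : Λ.im ≠ 0) {n : ℕ} (hn : n ≤ 2) {T : L2R3 →L[ℂ] L2R3}
    (hT : HasLocalDecay νp νm n T) :
    HasLocalDecay νp νm (n + 1) (resolvent dir αp αm νp νm Λ * T) := by
  obtain ⟨C, hC0, hC⟩ := hT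
  set δ := decayRate νp νm
  have hδ : 0 < δ := decayRate_pos hp hm
  set R := Smilansky.resolvent dir αp αm νp νm Λ
  set E : ℝ := (Nat.factorial 12) / (2 * δ) ^ 12
  set X : ℝ := ‖Λ‖ / (2 * δ ^ 2)
  refine ⟨2 * (16 * δ ^ 2)⁻¹ ^ 2 * C + E / 4 * ‖R * T‖ ^ 2 + X ^ (2 * (n + 1)) * ‖R * T‖ ^ 2,
    by positivity, fun p F => ?_⟩
  set k := rootIndex p
  have hk : 1 ≤ k := one_le_rootIndex p
  have hk0 : 0 < k := by linarith
  have hki : 0 < k⁻¹ := inv_pos.2 hk0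
  have hki1 : k⁻¹ ≤ 1 := inv_le_one_of_one_le₀ hk
  have hrk := decayRate_le_rCoeff hp hm p
  set r := rCoeff νp νm p.1 p.2
  have hr : 0 < r := lt_of_lt_of_le (by positivity) hrk
  rw [add_mul, add_mul, add_mul, add_mul]
  have t1 : 0 ≤ 2 * (16 * δ ^ 2)⁻¹ ^ 2 * C * k⁻¹ ^ (4 * (n + 1)) * ‖F‖ ^ 2 := by positivity
  have t2 : 0 ≤ E / 4 * ‖R * T‖ ^ 2 * k⁻¹ ^ (4 * (n + 1)) * ‖F‖ ^ 2 := by positivity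
  have t3 : 0 ≤ X ^ (2 * (n + 1)) * ‖R * T‖ ^ 2 * k⁻¹ ^ (4 * (n + 1)) * ‖F‖ ^ 2 := by positivity
  rcases le_or_gt (8 * ‖Λ‖) r with hcase | hcase
  · obtain ⟨v, d, s, h, -, -, h0⟩ := resolvent_mem dir αp αm νp νm hΛ (T F)
    obtain ⟨j, hj⟩ := (h.mode p).exists_hasJump_zero
    have hen := (h.mode p).weighted_energy (κ := δ * k) (Lp.memLp _) (h.equation p) hj
      (h0.zero_or hj) hr hcase hrk
    rw [localNormSq_congr (h.repr p), norm_sq_eq_of_ae (h.repr p)] at hen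
    have h1 : r⁻¹ ≤ (16 * δ ^ 2)⁻¹ * k⁻¹ ^ 2 := by
      refine (inv_anti₀ (by positivity) hrk).trans_eq ?_
      change ((16 : ℝ) * (δ * k) ^ 2)⁻¹ = _
      ring
    have h2 : Real.exp (-(δ * k)) ^ 2 ≤ E * k⁻¹ ^ (4 * (n + 1)) :=
      (exp_neg_sq_le hδ hk0).trans (mul_le_mul_of_nonneg_left
        (pow_le_pow_of_le_one hki.le hki1 (by omega)) (by positivity))
    have h3 : ‖coeff p (R (T F))‖ ^ 2 ≤ ‖R * T‖ ^ 2 * ‖F‖ ^ 2 := by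
      rw [← mul_pow]
      exact pow_le_pow_left₀ (norm_nonneg _) ((norm_coeff_le _ p).trans ((R * T).le_opNorm F)) 2
    have h4 : 2 * r⁻¹ ^ 2 * localNormSq (δ * k) (coeff p (T F)) ≤
        2 * (16 * δ ^ 2)⁻¹ ^ 2 * C * k⁻¹ ^ (4 * (n + 1)) * ‖F‖ ^ 2 := by
      calc 2 * r⁻¹ ^ 2 * localNormSq (δ * k) (coeff p (T F))
          ≤ 2 * ((16 * δ ^ 2)⁻¹ * k⁻¹ ^ 2) ^ 2 * (C * k⁻¹ ^ (4 * n) * ‖F‖ ^ 2) := by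
            have h5 := hC p F
            have h6 := localNormSq_nonneg (δ * k) (coeff p (T F))
            gcongr
        _ = _ := by ring
    have h5 : Real.exp (-(δ * k)) ^ 2 / 4 * ‖coeff p (R (T F))‖ ^ 2 ≤
        E / 4 * ‖R * T‖ ^ 2 * k⁻¹ ^ (4 * (n + 1)) * ‖F‖ ^ 2 := by
      calc Real.exp (-(δ * k)) ^ 2 / 4 * ‖coeff p (R (T F))‖ ^ 2
          ≤ E * k⁻¹ ^ (4 * (n + 1)) / 4 * (‖R * T‖ ^ 2 * ‖F‖ ^ 2) := by gcongr
        _ = _ := by ring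
    have h6 := hen.trans (add_le_add h4 h5)
    exact h6.trans (le_add_of_nonneg_right t3)
  -- Only modes with 16 δ² k² ≤ r < 8‖Λ‖ remain. There k is bounded, so any power of k⁻¹ is bounded
  -- below and the third part of the constant suffices.
  · have h1 : k ^ 2 ≤ X := by
      simp only [X]
      rw [le_div_iff₀ (by positivity)]
      nlinarith
    have h2 : 1 ≤ X * k⁻¹ ^ 2 := by
      have : k ^ 2 * k⁻¹ ^ 2 = 1 := by rw [← mul_pow, mul_inv_cancel₀ hk0.ne', one_pow]
      rw [← this]
      exact mul_le_mul_of_nonneg_right h1 (by positivity)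
    have h3 : 1 ≤ X ^ (2 * (n + 1)) * k⁻¹ ^ (4 * (n + 1)) := by
      have h4 := one_le_pow₀ h2 (n := 2 * (n + 1))
      rwa [mul_pow, ← pow_mul, show 2 * (2 * (n + 1)) = 4 * (n + 1) by ring] at h4
    have h4 := localNormSq_coeff_le hp hm (R * T) p F
    have h5 := mul_le_mul_of_nonneg_left h3 (show 0 ≤ ‖R * T‖ ^ 2 * ‖F‖ ^ 2 by positivity)
    refine h4.trans ?_
    linarith

theorem hasLocalDecay_resolvent_pow {νp νm : ℝ} (hp : 0 < νp) (hm : 0 < νm) (dir : Bool)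
    (αp αm : ℝ) {Λ : ℂ} (hΛ : Λ.im ≠ 0) {n : ℕ} (hn : n ≤ 3) :
    HasLocalDecay νp νm n (resolvent dir αp αm νp νm Λ ^ n) := by
  induction n with
  | zero => exact hasLocalDecay_zero hp hm _
  | succ n ih =>
    rw [pow_succ']
    exact (ih (by omega)).resolvent hp hm dir αp αm hΛ (by omega)

/-- Decay of the traces at the origin. -/
theorem exists_origin_bound {νp νm : ℝ} (hp : 0 < νp) (hm : 0 < νm) (dir : Bool) (αp αm : ℝ)
    {Λ : ℂ} (hΛ : Λ.im ≠ 0) {n : ℕ} (hn : n ≤ 2) {T : L2R3 →L[ℂ] L2R3}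
    (hT : HasLocalDecay νp νm n T) : ∃ C, 0 ≤ C ∧ ∀ (F : L2R3) (v d s : ℕ × ℕ → ℝ → ℂ),
      IsExpansion νp νm (resolvent dir αp αm νp νm Λ (T F))
        (T F + Λ • resolvent dir αp αm νp νm Λ (T F)) v d s →
      ∀ p j, HasJump (d p) 0 j →
        ‖v p 0‖ ^ 2 ≤ C * (rootIndex p)⁻¹ ^ (4 * n + 3) * ‖F‖ ^ 2 ∧
        ‖j‖ ^ 2 ≤ C * (rootIndex p)⁻¹ ^ (4 * n + 1) * ‖F‖ ^ 2 := by
  obtain ⟨C', hC0', hC'⟩ := hT.resolvent hp hm dir αp αm hΛ hn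
  obtain ⟨C, hC0, hC⟩ := hT
  set δ := decayRate νp νm
  have hδ : 0 < δ := decayRate_pos hp hm
  set c := νp ^ 2 + νm ^ 2
  have hM := traceConst_nonneg c δ Λ
  set M := traceConst c δ Λ
  refine ⟨2 * M * (C' + C), by positivity, fun F v d s h p j hj => ?_⟩
  have hk := one_le_rootIndex p
  have htr := (h.mode p).origin_trace_le (Lp.memLp _) (h.equation p) hj hδ hk
    (rCoeff_nonneg νp νm p) (rCoeff_le νp νm p)
  rw [localNormSq_congr (h.repr p)] at htr
  have hCp' := hC' p F
  have hCp := hC p F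
  rw [mul_apply_eq_comp] at hCp'
  set k := rootIndex p
  have hk0 : 0 < k := by linarith
  have kk : k * k⁻¹ = 1 := mul_inv_cancel₀ hk0.ne'
  have hki : 0 < k⁻¹ := inv_pos.2 hk0
  set W := localNormSq (δ * k) (coeff p (resolvent dir αp αm νp νm Λ (T F)))
  set Y := localNormSq (δ * k) (coeff p (T F))
  constructor
  · refine htr.1.trans ?_
    -- The two contributions balance: k · k^{-4(n+1)} and k⁻³ · k^{-4n} are both k^{-(4n+3)}. For
    -- the jump below, both give k^{-(4n+1)}.
    have h1 : k * W + k⁻¹ ^ 3 * Y ≤ (C' + C) * (k⁻¹ ^ (4 * n + 3) * ‖F‖ ^ 2) := by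
      calc k * W + k⁻¹ ^ 3 * Y ≤ k * (C' * k⁻¹ ^ (4 * (n + 1)) * ‖F‖ ^ 2) +
            k⁻¹ ^ 3 * (C * k⁻¹ ^ (4 * n) * ‖F‖ ^ 2) := by gcongr
        _ = _ := by linear_combination (C' * k⁻¹ ^ (4 * n + 3) * ‖F‖ ^ 2) * kk
    have h2 := mul_le_mul_of_nonneg_left h1 hM
    have h3 : 0 ≤ M * ((C' + C) * (k⁻¹ ^ (4 * n + 3) * ‖F‖ ^ 2)) := by positivity
    linarith
  · refine htr.2.trans ?_
    have h1 : k ^ 3 * W + k⁻¹ * Y ≤ (C' + C) * (k⁻¹ ^ (4 * n + 1) * ‖F‖ ^ 2) := by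
      calc k ^ 3 * W + k⁻¹ * Y ≤ k ^ 3 * (C' * k⁻¹ ^ (4 * (n + 1)) * ‖F‖ ^ 2) +
            k⁻¹ * (C * k⁻¹ ^ (4 * n) * ‖F‖ ^ 2) := by gcongr
        _ = _ := by
          have e : k ^ 3 * k⁻¹ ^ 3 = 1 := by rw [← mul_pow, kk, one_pow]
          linear_combination (C' * k⁻¹ ^ (4 * n + 1) * ‖F‖ ^ 2) * e
    have h2 := mul_le_mul_of_nonneg_left h1 (show 0 ≤ 2 * M by positivity)
    linarith

/-! ### The difference of the resolvents -/

theorem eq_zero_of_ae_eq_zero_of_tendsto {d : ℝ → ℂ} (hd : d =ᵐ[volume] 0) {A : ℂ}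
    (l : Filter ℝ) (hl : ∀ t ∈ l, volume t ≠ 0) (hA : Tendsto d l (𝓝 A)) : A = 0 := by
  by_contra hne
  have h1 : ∀ᶠ x in l, d x ≠ 0 := hA.eventually_ne hne
  refine hl _ h1 ?_
  rw [Filter.EventuallyEq, ae_iff] at hd
  exact hd

theorem volume_ne_zero_of_mem_nhdsGT {o : ℝ} {t : Set ℝ} (ht : t ∈ 𝓝[>] o) : volume t ≠ 0 := by
  obtain ⟨b, hb, hsub⟩ := (mem_nhdsGT_iff_exists_Ioo_subset).1 ht
  refine (lt_of_lt_of_le ?_ (measure_mono hsub)).ne'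
  rw [Real.volume_Ioo, ENNReal.ofReal_pos]
  exact sub_pos.2 hb

theorem volume_ne_zero_of_mem_nhdsLT {o : ℝ} {t : Set ℝ} (ht : t ∈ 𝓝[<] o) : volume t ≠ 0 := by
  obtain ⟨b, hb, hsub⟩ := (mem_nhdsLT_iff_exists_Ioo_subset).1 ht
  refine (lt_of_lt_of_le ?_ (measure_mono hsub)).ne'
  rw [Real.volume_Ioo, ENNReal.ofReal_pos]
  exact sub_pos.2 hb

/-- A function which vanishes almost everywhere has vanishing traces. -/
theorem IsMode.traces_eq_zero {u d s : ℝ → ℂ} (h : IsMode u d s) (hu : u =ᵐ[volume] 0) {o : ℝ}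
    {j : ℂ} (hj : HasJump d o j) : u o = 0 ∧ j = 0 := by
  have hd : d =ᵐ[volume] 0 := by
    simpa using h.memH1.ae_eq_zero isOpen_univ ordConnected_univ (by simpa using hu)
  refine ⟨congrFun ((Continuous.ae_eq_iff_eq volume h.continuous continuous_zero).1 hu) o, ?_⟩
  obtain ⟨a, b, ha, hb, rfl⟩ := hj
  rw [eq_zero_of_ae_eq_zero_of_tendsto hd _ (fun t => volume_ne_zero_of_mem_nhdsGT) ha,
    eq_zero_of_ae_eq_zero_of_tendsto hd _ (fun t => volume_ne_zero_of_mem_nhdsLT) hb, sub_zero]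

section

variable (dir : Bool) (αp αm νp νm : ℝ) {Λ : ℂ}

/-- The traces at the origin of the coefficients of the resolvent are linear. -/
theorem exists_originFunctionals (hΛ : Λ.im ≠ 0) : ∃ φ ψ : ℕ × ℕ → L2R3 →ₗ[ℂ] ℂ,
    ∀ F, ∃ v d s : ℕ × ℕ → ℝ → ℂ,
      IsExpansion νp νm (resolvent dir αp αm νp νm Λ F)
        (F + Λ • resolvent dir αp αm νp νm Λ F) v d s ∧
      MatchingPlus αp (fun m n => v (m, n)) (fun m n => d (m, n)) ∧
      MatchingMinus αm (fun m n => v (m, n)) (fun m n => d (m, n)) ∧ OriginCondition dir v d s ∧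
      ∀ p, φ p F = v p 0 ∧ HasJump (d p) 0 (ψ p F) := by
  choose v d s h hP hM h0 using fun F => resolvent_mem dir αp αm νp νm hΛ F
  choose j hj using fun F p => ((h F).mode p).exists_hasJump_zero
  -- The chosen expansions need not be linear as functions, but the defect represents the zero
  -- element of L², and a mode that vanishes almost everywhere has zero traces.
  have hadd : ∀ p F G, v (F + G) p 0 = v F p 0 + v G p 0 ∧ j (F + G) p = j F p + j G p := by
    intro p F G
    have h1 := (((h F).mode p).add ((h G).mode p)).add (((h (F + G)).mode p).const_mul (-1))
    have h2 := h1.traces_eq_zero (by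
      filter_upwards [coeff_add_ae ((h F).repr p) ((h G).repr p), (h (F + G)).repr p] with x e1 e2
      simp only [map_add] at e1 e2
      rw [e1, e2]; simp) (((hj F p).add (hj G p)).add ((hj (F + G) p).const_mul (-1)))
    exact ⟨by linear_combination -h2.1, by linear_combination -h2.2⟩
  have hsmul : ∀ p (c : ℂ) F, v (c • F) p 0 = c * v F p 0 ∧ j (c • F) p = c * j F p := by
    intro p c F
    have h1 := (((h F).mode p).const_mul c).add (((h (c • F)).mode p).const_mul (-1))
    have h2 := h1.traces_eq_zero (by
      filter_upwards [coeff_smul_ae ((h F).repr p) c, (h (c • F)).repr p] with x e1 e2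
      simp only [map_smul] at e1 e2
      rw [e1, e2]; simp) (((hj F p).const_mul c).add ((hj (c • F) p).const_mul (-1)))
    exact ⟨by linear_combination -h2.1, by linear_combination -h2.2⟩
  exact ⟨fun p => ⟨⟨fun F => v F p 0, fun F G => (hadd p F G).1⟩, fun c F => (hsmul p c F).1⟩,
    fun p => ⟨⟨fun F => j F p, fun F G => (hadd p F G).2⟩, fun c F => (hsmul p c F).2⟩,
    fun F => ⟨v F, d F, s F, h F, hP F, hM F, h0 F, fun p => ⟨rfl, hj F p⟩⟩⟩

end

/-- From (m + 1)(n + 1) ≤ (m + n + 1)², the term (m + n + 1)⁻³ is at most (m + 1)^{-3/2} (n +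
1)^{-3/2}, a product of summable sequences. -/
theorem summable_rootIndex_inv_pow : Summable fun p : ℕ × ℕ => (rootIndex p)⁻¹ ^ 6 := by
  have h1 : Summable fun n : ℕ => ((n : ℝ) + 1) ^ (-(3 / 2) : ℝ) := by
    have := (summable_nat_add_iff 1).2 (Real.summable_nat_rpow (p := -(3 / 2)).2 (by norm_num))
    simpa using this
  have h2 := h1.mul_of_nonneg h1 (fun n => by positivity) (fun n => by positivity)
  refine Summable.of_nonneg_of_le (fun p => by have := one_le_rootIndex p; positivity)
    (fun p => ?_) h2
  have hm : (0 : ℝ) ≤ p.1 := Nat.cast_nonneg _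
  have hn : (0 : ℝ) ≤ p.2 := Nat.cast_nonneg _
  rw [← Real.mul_rpow (by positivity) (by positivity), inv_pow, Real.rpow_neg (by positivity)]
  refine inv_anti₀ (by positivity) ?_
  have e : rootIndex p ^ 6 = (((p.1 : ℝ) + p.2 + 1) ^ 2) ^ (3 / 2 : ℝ) := by
    rw [← Real.rpow_natCast _ 2, ← Real.rpow_mul (by positivity),
      show rootIndex p ^ 6 = (rootIndex p ^ 2) ^ 3 by ring, rootIndex_sq, ← Real.rpow_natCast _ 3]
    norm_num
  rw [e]
  refine Real.rpow_le_rpow (by positivity) ?_ (by norm_num)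
  nlinarith [mul_nonneg hm hn]

theorem inner_resolvent_pow (dir : Bool) (αp αm νp νm : ℝ) {Λ : ℂ} (hΛ : Λ.im ≠ 0) (n : ℕ)
    (F G : L2R3) : inner ℂ ((resolvent dir αp αm νp νm Λ ^ n) F) G =
      inner ℂ F ((resolvent dir αp αm νp νm (starRingEnd ℂ Λ) ^ n) G) := by
  induction n generalizing F with
  | zero => simp
  | succ n ih =>
    rw [pow_succ, mul_apply_eq_comp, ih, inner_resolvent dir αp αm νp νm hΛ, pow_succ',
      mul_apply_eq_comp]

/-- The factor R^a is moved to the right-hand vector as a power of the resolvent at conj Λ. Green's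
formula then writes the form of R - R₀ as a sum of products of a trace of one solution and a jump of
the other, and the a + b outer resolvents supply the decay. -/
theorem hasTraceBound_resolvent_sub {αp αm νp νm : ℝ} (hp : 0 < νp) (hm : 0 < νm) {Λ : ℂ}
    (hΛ : Λ.im ≠ 0) {a b : ℕ} (hab : a + b = 2) :
    ∃ C, HasTraceBound (resolvent false αp αm νp νm Λ ^ a *
      (resolvent false αp αm νp νm Λ - resolvent true αp αm νp νm Λ) *
        resolvent true αp αm νp νm Λ ^ b) C := by
  have hΛ' : ((starRingEnd ℂ) Λ).im ≠ 0 := by simpa using hΛ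
  set R := resolvent false αp αm νp νm Λ
  set R₀ := resolvent true αp αm νp νm Λ
  set R' := resolvent false αp αm νp νm (starRingEnd ℂ Λ)
  set R₀' := resolvent true αp αm νp νm (starRingEnd ℂ Λ)
  obtain ⟨C, hC0, hC⟩ := exists_origin_bound hp hm false αp αm hΛ (n := b) (by omega)
    (hasLocalDecay_resolvent_pow hp hm true αp αm hΛ (n := b) (by omega))
  obtain ⟨C', hC0', hC'⟩ := exists_origin_bound hp hm true αp αm hΛ' (n := a) (by omega)
    (hasLocalDecay_resolvent_pow hp hm false αp αm hΛ' (n := a) (by omega))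
  obtain ⟨φ, _, hφ⟩ := exists_originFunctionals false αp αm νp νm hΛ
  obtain ⟨_, ψ, hψ⟩ := exists_originFunctionals true αp αm νp νm hΛ'
  set A : ℕ × ℕ → ℝ := fun p => √(C * (rootIndex p)⁻¹ ^ (4 * b + 3))
  set B : ℕ × ℕ → ℝ := fun p => √(C' * (rootIndex p)⁻¹ ^ (4 * a + 1))
  have hki : ∀ p, 0 < (rootIndex p)⁻¹ := fun p =>
    inv_pos.2 (zero_lt_one.trans_le (one_le_rootIndex p))
  have hsq : ∀ {x y z : ℝ}, 0 ≤ y → 0 ≤ z → x ^ 2 ≤ y * z ^ 2 → x ≤ √y * z := by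
    intro x y z hy hz h
    refine (Real.le_sqrt_of_sq_le h).trans_eq ?_
    rw [Real.sqrt_mul hy, Real.sqrt_sq hz]
  have hA : ∀ p F, ‖φ p ((R₀ ^ b) F)‖ ≤ A p * ‖F‖ := fun p F => by
    obtain ⟨v, d, s, h, -, -, -, h0⟩ := hφ ((R₀ ^ b) F)
    obtain ⟨j, hj⟩ := (h.mode p).exists_hasJump_zero
    have hki := hki p
    rw [(h0 p).1]
    exact hsq (by positivity) (norm_nonneg F) (hC F v d s h p j hj).1
  have hB : ∀ p F, ‖ψ p ((R' ^ a) F)‖ ≤ B p * ‖F‖ := fun p F => by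
    obtain ⟨v, d, s, h, -, -, -, h0⟩ := hψ ((R' ^ a) F)
    have hki := hki p
    exact hsq (by positivity) (norm_nonneg F) (hC' F v d s h p _ (h0 p).2).2
  have hAB : ∀ p, A p * B p = √(C * C') * (rootIndex p)⁻¹ ^ 6 := fun p => by
    have hki := hki p
    simp only [A, B]
    rw [← Real.sqrt_mul (by positivity)]
    have e : C * (rootIndex p)⁻¹ ^ (4 * b + 3) * (C' * (rootIndex p)⁻¹ ^ (4 * a + 1)) =
        C * C' * ((rootIndex p)⁻¹ ^ 6) ^ 2 := by
      have e2 : (rootIndex p)⁻¹ ^ (4 * b + 3) * (rootIndex p)⁻¹ ^ (4 * a + 1) =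
          ((rootIndex p)⁻¹ ^ 6) ^ 2 := by
        -- The exponents add up to (4b + 3) + (4a + 1) = 12 because a + b = 2.
        rw [← pow_add, ← pow_mul]; congr 1; omega
      rw [← e2]; ring
    rw [e, Real.sqrt_mul (by positivity), Real.sqrt_sq (by positivity)]
  have hsum : Summable fun p => A p * B p := by
    simp only [hAB]; exact summable_rootIndex_inv_pow.mul_left _
  refine ⟨_, hasTraceBound_of_tsum (φ := fun p => (φ p).comp (R₀ ^ b).toLinearMap)
    (ψ := fun p => (ψ p).comp (R' ^ a).toLinearMap) (fun p => Real.sqrt_nonneg _)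
    (fun p => Real.sqrt_nonneg _) hA hB hsum fun F G => ?_⟩
  set X := (R₀ ^ b) F with hX
  set Y := (R' ^ a) G with hY
  have e1 : inner ℂ ((R ^ a * (R - R₀) * R₀ ^ b) F) G = (inner ℂ (R X) Y - inner ℂ (R₀ X) Y : ℂ) := by
    rw [mul_apply_eq_comp, mul_apply_eq_comp, inner_resolvent_pow false αp αm νp νm hΛ,
      _root_.sub_apply, inner_sub_left]
  obtain ⟨v, d, s, h, hP, hM, h0, hv⟩ := hφ X
  obtain ⟨w, e, t, h', hP', hM', h0', hw⟩ := hψ Y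
  have hz : (fun p => (starRingEnd ℂ) (0 : ℂ) * w p 0 - (starRingEnd ℂ) (v p 0) * ψ p Y) =
      fun p => -((starRingEnd ℂ) (φ p X) * ψ p Y) := by
    ext p; rw [(hv p).1, map_zero]; ring
  have hs : Summable fun p => (starRingEnd ℂ) (φ p X) * ψ p Y := by
    refine Summable.of_norm_bounded (hsum.mul_right (‖F‖ * ‖G‖)) fun p => ?_
    rw [norm_mul, RCLike.norm_conj]
    refine (mul_le_mul (hA p F) (hB p G) (norm_nonneg _)
      (mul_nonneg (Real.sqrt_nonneg _) (norm_nonneg _))).trans_eq ?_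
    ring
  -- R X belongs to the domain of A_α, so its derivative has no jump at 0; of the two origin terms
  -- only conj (v_p(0)) times the jump of the other solution is left.
  have hG := h.inner_sub_eq hP hM h' hP' hM' (j := fun _ => 0) (k := fun p => ψ p Y)
    (fun p => h0.hasJump p) (fun p => (hw p).2) (by rw [hz]; exact hs.neg)
  rw [hz, tsum_neg, neg_neg, inner_add_right, inner_add_left, inner_smul_right,
    inner_smul_left, add_sub_add_right_eq_sub,
    ← inner_resolvent true αp αm νp νm hΛ X Y] at hG
  rw [e1, hG]
  rfl

/-- Telescoping without commutativity: R³ - R₀³ = R² (R - R₀) + R (R - R₀) R₀ + (R - R₀) R₀². -/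
theorem isTraceClass_resolvent_pow_sub {αp αm νp νm : ℝ} (hp : 0 < νp) (hm : 0 < νm) {Λ : ℂ}
    (hΛ : Λ.im ≠ 0) : IsTraceClass
      (resolvent true αp αm νp νm Λ ^ 3 - resolvent false αp αm νp νm Λ ^ 3) := by
  obtain ⟨C₁, h₁⟩ := hasTraceBound_resolvent_sub (αp := αp) (αm := αm) hp hm hΛ (a := 2) (b := 0) rfl
  obtain ⟨C₂, h₂⟩ := hasTraceBound_resolvent_sub (αp := αp) (αm := αm) hp hm hΛ (a := 1) (b := 1) rfl
  obtain ⟨C₃, h₃⟩ := hasTraceBound_resolvent_sub (αp := αp) (αm := αm) hp hm hΛ (a := 0) (b := 2) rfl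
  have h := ((h₁.add h₂).add h₃).neg.isTraceClass
  convert h using 1
  noncomm_ring

end Smilansky

end

theorem theorem2p6 (αp αm νp νm : ℝ) (hαp : 0 ≤ αp) (hαm : 0 ≤ αm) (hνp : 0 < νp) (hνm : 0 < νm)
    (Λ : ℂ) (hΛ : Λ.im ≠ 0) :
    ∃ Rcirc R : Smilansky.L2R3 →L[ℂ] Smilansky.L2R3,
      Smilansky.IsResolventAt (Smilansky.opACirc αp αm νp νm) Λ Rcirc ∧
      Smilansky.IsResolventAt (Smilansky.opA αp αm νp νm) Λ R ∧
      Smilansky.IsTraceClass (Rcirc ^ 3 - R ^ 3) := by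
  refine ⟨Smilansky.resolvent true αp αm νp νm Λ, Smilansky.resolvent false αp αm νp νm Λ, ?_, ?_,
    Smilansky.isTraceClass_resolvent_pow_sub hνp hνm hΛ⟩
  · rw [Smilansky.opACirc_eq_opGraph]
    exact Smilansky.isResolventAt_resolvent true αp αm νp νm hΛ
  · rw [Smilansky.opA_eq_opGraph]
    exact Smilansky.isResolventAt_resolvent false αp αm νp νm hΛ
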